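/- Let $k>0$ with $2k\in\{2,3,\dots\}$. **Group, domain, multiplier.** $SU(1,1)$ is the group of matrices $g=\begin{pmatrix}a&b\\ \bar b&\bar a\end{pmatrix}$, $|a|^2-|b|^2=1$, acting on $\mathbb C$ by $g\cdot\alpha=a\alpha+b\bar\alpha$. The Jacobi group $G^J_1=H_1\rtimes SU(1,1)$ is the topological group of triples $(g,\alpha,t)\in SU(1,1)\times\mathbb C\times\mathbb R$ with $$(g_1,\alpha_1,t_1)(g_2,\alpha_2,t_2)=\big(g_1g_2,\;g_2^{-1}\cdot\alpha_1+\alpha_2,\;t_1+t_2+\operatorname{Im}((g_2^{-1}\cdot\alpha_1)\bar\alpha_2)\big);$$ one writes $(g,\alpha)=(g,\alpha,0)$. It acts on $\mathcal D^J_1=\mathbb C\times\{|w|<1\}\ni x=(z,w)$ by $h\cdot(z,w)=(z_1,w_1)$, $$z_1=\frac{\alpha-\bar\alpha w+z}{\bar bw+\bar a},\qquad w_1=\frac{aw+b}{\bar bw+\bar a}\qquad(h=(g,\alpha,t)).$$ With $\alpha_0=\frac{z+\bar zw}{1-w\bar w}$ and $\alpha_2=(\alpha+\alpha_0)a+(\bar\alpha+\bar\alpha_0)b$,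 put $$\lambda(h,x)=(\bar a+\bar bw)^{-2k}\exp\!\Big(\frac z2\bar\alpha_0-\frac{z_1}2\bar\alpha_2\Big)\,e^{i\operatorname{Im}(\alpha\bar\alpha_0)}\,e^{it},\qquad J(h,x)=\lambda(h,x)^{-1}.$$ **Kernel and Hilbert space.** Let $$K(x,x')=K(z,w;\bar z',\bar w')=(1-w\bar w')^{-2k}\exp\frac{2\bar z'z+z^2\bar w'+\bar z'^2w}{2(1-w\bar w')},$$ and let $\mathcal F_K$ be the space of holomorphic functions on $\mathcal D^J_1$ of finite norm for $$(f_1,f_2)=\Lambda\int_{z\in\mathbb C,|w|<1}\bar f_1f_2\,(1-w\bar w)^{2k}\exp\Big(-\frac{|z|^2}{1-w\bar w}\Big)\exp\Big(-\frac{z^2\bar w+\bar z^2w}{2(1-w\bar w)}\Big)\,\frac{d\operatorname{Re}w\,d\operatorname{Im}w\,d\operatorname{Re}z\,d\operatorname{Im}z}{(1-w\bar w)^3},\qquad\Lambda=\frac{4k-3}{2\pi^2}.$$ **The representation $\pi(g,\alpha)=S(g)D(\alpha)$.** Let $\pi$ be a strongly continuous unitary representation of $G^J_1$ on a complex Hilbert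 space $\mathcal H$ (scalar product antilinear in the first variable) with $\pi(1,0,t)=e^{it}$, and put $S(g)=\pi(g,0,0)$, $D(\alpha)=\pi(1,\alpha,0)$, so that $\pi(g,\alpha,t)=e^{it}S(g)D(\alpha)$. Let the operators $a,a^+,K_0,K_\pm$ on smooth vectors be determined by the derived representation: $\alpha a^+-\bar\alpha a=\frac{d}{ds}|_{0}D(s\alpha)$ for $\alpha\in\mathbb C$, $yK_+-\bar yK_-=\frac{d}{ds}|_0S\big(\exp s\begin{pmatrix}0&y\\ \bar y&0\end{pmatrix}\big)$ for $y\in\mathbb C$, $2iK_0=\frac{d}{ds}|_0S(\operatorname{diag}(e^{is},e^{-is}))$. Assume there is a cyclic smooth unit vector $e_0$ with $ae_0=0$, $K_-e_0=0$, $K_0e_0=ke_0$. **Proposition.** 1. $K$ is a positive definite kernel, holomorphic in $x$ and antiholomorphic in $x'$; $\mathcal F_K$ is a Hilbert space, and $K$ is its reproducing kernel. Moreover $J(h_1h_2,x)=J(h_1,h_2\cdot x)J(h_2,x)$ and $K(h\cdot x,h\cdot x')=J(h,x)K(x,x')\overline{J(h,x')}$. 2. The formula $$(\pi_K(h)f)(x)=J(h^{-1},x)^{-1}f(h^{-1}\cdot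 x)=\lambda(h^{-1},x)f(h^{-1}\cdot x),\qquad h\in G^J_1,\ f\in\mathcal F_K,\ x\in\mathcal D^J_1,$$ defines a strongly continuous unitary representation $\pi_K$ of $G^J_1$ on $\mathcal F_K$. 3. For every $(\pi,\mathcal H,e_0)$ as above, the series $e_{z,w}=\exp(za^++wK_+)e_0=\sum_m\frac1{m!}(za^++wK_+)^me_0$ converges for all $x=(z,w)\in\mathcal D^J_1$; with $e_x=e_{z,w}$ one has $\pi(h)e_x=\lambda(h,x)e_{h\cdot x}$ and $(e_{x'},e_x)=K(x,x')$; and $\Phi(\ell)(x)=\ell(e_x)$ defines an isometric isomorphism $\Phi:\mathcal H^*\to\mathcal F_K$ that carries the dual representation $\ell\mapsto\ell\circ\pi(h)^{-1}$ to $\pi_K(h)$. Thus $\pi_K$ is the representation attached to the kernel $K$. -/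

import Mathlib

open MeasureTheory
open scoped ComplexConjugate ComplexOrder InnerProductSpace

noncomputable section

/-! ### The group `SU(1,1)` -/

/-- `SU(1,1)`: the complex matrices `[[a, b], [conj b, conj a]]` with `|a|² - |b|² = 1`
(the last condition says that the determinant is one). -/
def SU11Subgroup : Subgroup (Matrix.SpecialLinearGroup (Fin 2) ℂ) where
  carrier := {g | g 1 0 = conj (g 0 1) ∧ g 1 1 = conj (g 0 0)}
  one_mem' := by simp
  mul_mem' := by
    rintro g h ⟨hg1, hg2⟩ ⟨hh1, hh2⟩
    simp only [Set.mem_ofPred_eq, Matrix.SpecialLinearGroup.coe_mul, Matrix.mul_apply,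
      Fin.sum_univ_two, hg1, hg2, hh1, hh2, map_add, map_mul, Complex.conj_conj]
    constructor <;> ring
  inv_mem' := by
    rintro g ⟨hg1, hg2⟩
    simp [Matrix.SpecialLinearGroup.coe_inv, Matrix.adjugate_fin_two, hg1, hg2]

/-- The group `SU(1,1)`, with the topology of a group of matrices. -/
abbrev SU11 : Type := SU11Subgroup

namespace SU11

/-- The entry `a` of `g = [[a, b], [conj b, conj a]]`. -/
def a (g : SU11) : ℂ := g.1 0 0

/-- The entry `b` of `g = [[a, b], [conj b, conj a]]`. -/
def b (g : SU11) : ℂ := g.1 0 1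

/-- The element `[[a, b], [conj b, conj a]]` of `SU(1,1)`. -/
def mk (a b : ℂ) (h : a * conj a - b * conj b = 1) : SU11 :=
  ⟨⟨!![a, b; conj b, conj a], by rw [Matrix.det_fin_two_of]; exact h⟩, by simp, by simp⟩

lemma det_eq (g : SU11) : g.a * conj g.a - g.b * conj g.b = 1 := by
  have h := g.1.2
  rw [Matrix.det_fin_two] at h
  have h1 : (g.1 : Matrix (Fin 2) (Fin 2) ℂ) 1 0 = conj g.b := g.2.1
  have h2 : (g.1 : Matrix (Fin 2) (Fin 2) ℂ) 1 1 = conj g.a := g.2.2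
  rw [h1, h2] at h
  exact h

@[simp] lemma a_one : (1 : SU11).a = 1 := by simp [a]

@[simp] lemma b_one : (1 : SU11).b = 0 := by simp [b]

lemma a_mul (g h : SU11) : (g * h).a = g.a * h.a + g.b * conj h.b := by
  have h1 : (h.1 : Matrix (Fin 2) (Fin 2) ℂ) 1 0 = conj h.b := h.2.1
  simp only [a, b, Subgroup.coe_mul, Matrix.SpecialLinearGroup.coe_mul, Matrix.mul_apply,
    Fin.sum_univ_two]
  rw [h1]; rfl

lemma b_mul (g h : SU11) : (g * h).b = g.a * h.b + g.b * conj h.a := by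
  have h1 : (h.1 : Matrix (Fin 2) (Fin 2) ℂ) 1 1 = conj h.a := h.2.2
  simp only [a, b, Subgroup.coe_mul, Matrix.SpecialLinearGroup.coe_mul, Matrix.mul_apply,
    Fin.sum_univ_two]
  rw [h1]; rfl

@[simp] lemma a_inv (g : SU11) : (g⁻¹).a = conj g.a := by
  have h1 : (g.1 : Matrix (Fin 2) (Fin 2) ℂ) 1 1 = conj g.a := g.2.2
  simp only [a, Subgroup.coe_inv, Matrix.SpecialLinearGroup.coe_inv, Matrix.adjugate_fin_two]
  exact h1

@[simp] lemma b_inv (g : SU11) : (g⁻¹).b = -g.b := by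
  simp [b, Matrix.SpecialLinearGroup.coe_inv, Matrix.adjugate_fin_two]

/-- The natural action of `SU(1,1)` on `ℂ`: `α_g = a α + b conj α`. -/
def rot (g : SU11) (α : ℂ) : ℂ := g.a * α + g.b * conj α

lemma rot_one (α : ℂ) : rot 1 α = α := by simp [rot]

lemma rot_zero (g : SU11) : rot g 0 = 0 := by simp [rot]

lemma rot_add (g : SU11) (α β : ℂ) : rot g (α + β) = rot g α + rot g β := by
  simp only [rot, map_add]; ring

lemma rot_neg (g : SU11) (α : ℂ) : rot g (-α) = -rot g α := by
  simp only [rot, map_neg]; ring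

lemma rot_mul (g h : SU11) (α : ℂ) : rot (g * h) α = rot g (rot h α) := by
  simp only [rot, a_mul, b_mul, map_add, map_mul, Complex.conj_conj]; ring

lemma rot_symplectic (g : SU11) (α β : ℂ) :
    (rot g α * conj (rot g β)).im = (α * conj β).im := by
  have h : rot g α * conj (rot g β) - conj (rot g α) * rot g β = α * conj β - conj α * β := by
    simp only [rot, map_add, map_mul, Complex.conj_conj]
    linear_combination (α * conj β - conj α * β) * g.det_eq
  have h2 := congrArg Complex.im h
  simp only [Complex.sub_im, Complex.mul_im, Complex.conj_re, Complex.conj_im] at h2 ⊢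
  linarith

end SU11

/-! ### The Jacobi group `H₁ ⋊ SU(1,1)` -/

/-- The Jacobi group. The triple `(g, α, t)` stands for `S(g) D(α) e^{it}`; the pair `(g, α)` is
the triple `(g, α, 0)`. -/
@[ext] structure JacobiGroup where
  g : SU11
  α : ℂ
  t : ℝ

namespace JacobiGroup

/-- The composition law
`(g₁, α₁, t₁)(g₂, α₂, t₂) = (g₁g₂, g₂⁻¹·α₁ + α₂, t₁ + t₂ + Im((g₂⁻¹·α₁) conj α₂))`. -/
instance : Mul JacobiGroup where
  mul h k := ⟨h.g * k.g, SU11.rot k.g⁻¹ h.α + k.α,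
    h.t + k.t + (SU11.rot k.g⁻¹ h.α * conj k.α).im⟩

instance : One JacobiGroup := ⟨⟨1, 0, 0⟩⟩

instance : Inv JacobiGroup where
  inv h := ⟨h.g⁻¹, -SU11.rot h.g h.α, -h.t⟩

lemma mul_def (h k : JacobiGroup) : h * k = ⟨h.g * k.g, SU11.rot k.g⁻¹ h.α + k.α,
    h.t + k.t + (SU11.rot k.g⁻¹ h.α * conj k.α).im⟩ := rfl

lemma one_def : (1 : JacobiGroup) = ⟨1, 0, 0⟩ := rfl

lemma inv_def (h : JacobiGroup) : h⁻¹ = ⟨h.g⁻¹, -SU11.rot h.g h.α, -h.t⟩ := rfl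

instance : Group JacobiGroup := Group.ofLeftAxioms
  (by
    intro x y z
    have h := SU11.rot_symplectic z.g⁻¹ (SU11.rot y.g⁻¹ x.α) y.α
    simp only [mul_def, mul_inv_rev, SU11.rot_mul, SU11.rot_add, mk.injEq, map_add, mul_add,
      add_mul, Complex.add_im]
    refine ⟨mul_assoc _ _ _, by ring, ?_⟩
    rw [h]; ring)
  (by
    intro x
    simp [mul_def, one_def, SU11.rot_zero])
  (by
    intro x
    simp only [mul_def, one_def, inv_def, mk.injEq]
    have h : SU11.rot x.g⁻¹ (-SU11.rot x.g x.α) = -x.α := by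
      rw [SU11.rot_neg, ← SU11.rot_mul, inv_mul_cancel, SU11.rot_one]
    refine ⟨inv_mul_cancel _, by rw [h]; ring, ?_⟩
    rw [h, neg_mul, Complex.mul_conj]
    simp)

/-- The topology of `SU(1,1) × ℂ × ℝ`. -/
instance : TopologicalSpace JacobiGroup :=
  TopologicalSpace.induced (fun h => (h.g, h.α, h.t)) inferInstance

end JacobiGroup

/-! ### The domain `ℂ × {|w| < 1}`, the group action, the kernel and the multiplier -/

/-- The domain `ℂ × {|w| < 1}`, with points `x = (z, w)`. -/
abbrev JacobiDomain : Type := {x : ℂ × ℂ // ‖x.2‖ < 1}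

namespace JacobiDomain

/-- The coordinate `z` of `x = (z, w)`. -/
def z (x : JacobiDomain) : ℂ := x.1.1

/-- The coordinate `w` of `x = (z, w)`. -/
def w (x : JacobiDomain) : ℂ := x.1.2

lemma norm_w_lt (x : JacobiDomain) : ‖x.w‖ < 1 := x.2

lemma one_sub_pos (x : JacobiDomain) : 0 < 1 - ‖x.w‖ ^ 2 := by
  have h1 := x.norm_w_lt
  have h2 := norm_nonneg x.w
  nlinarith

end JacobiDomain

lemma SU11.normSq_den_sub (g : SU11) (w : ℂ) :
    ‖conj g.b * w + conj g.a‖ ^ 2 - ‖g.a * w + g.b‖ ^ 2 = 1 - ‖w‖ ^ 2 := by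
  have h : (conj g.b * w + conj g.a) * conj (conj g.b * w + conj g.a)
      - (g.a * w + g.b) * conj (g.a * w + g.b) = 1 - w * conj w := by
    simp only [map_add, map_mul, Complex.conj_conj]
    linear_combination (1 - w * conj w) * g.det_eq
  simp only [Complex.mul_conj, Complex.normSq_eq_norm_sq] at h
  exact_mod_cast h

lemma SU11.den_ne_zero (g : SU11) (x : JacobiDomain) : conj g.b * x.w + conj g.a ≠ 0 := by
  intro h
  have h1 := g.normSq_den_sub x.w
  have h2 := x.one_sub_pos
  rw [h, norm_zero] at h1
  nlinarith [sq_nonneg ‖g.a * x.w + g.b‖]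

/-- The action of the Jacobi group on the domain:
`(g, α, t)·(z, w) = ((α - conj α w + z)/(conj b w + conj a), (a w + b)/(conj b w + conj a))`. -/
instance : SMul JacobiGroup JacobiDomain where
  smul h x := ⟨((h.α - conj h.α * x.w + x.z) / (conj h.g.b * x.w + conj h.g.a),
      (h.g.a * x.w + h.g.b) / (conj h.g.b * x.w + conj h.g.a)), by
    have h1 := h.g.normSq_den_sub x.w
    have h2 := x.one_sub_pos
    have h3 : 0 < ‖conj h.g.b * x.w + conj h.g.a‖ := norm_pos_iff.2 (h.g.den_ne_zero x)
    rw [norm_div, div_lt_one h3]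
    exact lt_of_pow_lt_pow_left₀ 2 h3.le (by linarith)⟩

lemma JacobiDomain.smul_z (h : JacobiGroup) (x : JacobiDomain) :
    (h • x).z = (h.α - conj h.α * x.w + x.z) / (conj h.g.b * x.w + conj h.g.a) := rfl

lemma JacobiDomain.smul_w (h : JacobiGroup) (x : JacobiDomain) :
    (h • x).w = (h.g.a * x.w + h.g.b) / (conj h.g.b * x.w + conj h.g.a) := rfl

lemma JacobiDomain.ext' {x y : JacobiDomain} (h1 : x.z = y.z) (h2 : x.w = y.w) : x = y :=
  Subtype.ext (Prod.ext h1 h2)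

instance : MulAction JacobiGroup JacobiDomain where
  one_smul x := by
    apply JacobiDomain.ext' <;>
      simp [JacobiDomain.smul_z, JacobiDomain.smul_w, JacobiGroup.one_def]
  mul_smul h k x := by
    have hd := k.g.den_ne_zero x
    have hd2 := h.g.den_ne_zero (k • x)
    have hd3 := (h * k).g.den_ne_zero x
    have hk := k.g.det_eq
    rw [JacobiDomain.smul_w] at hd2
    simp only [JacobiGroup.mul_def, SU11.a_mul, SU11.b_mul, map_add, map_mul,
      Complex.conj_conj] at hd3
    have key : conj h.g.b * ((k.g.a * x.w + k.g.b) / (conj k.g.b * x.w + conj k.g.a))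
        + conj h.g.a = ((conj h.g.a * conj k.g.b + conj h.g.b * k.g.a) * x.w +
          (conj h.g.a * conj k.g.a + conj h.g.b * k.g.b)) /
          (conj k.g.b * x.w + conj k.g.a) := by
      rw [mul_div_assoc', div_add' _ _ _ hd]
      congr 1
      ring
    apply JacobiDomain.ext'
    · simp only [JacobiDomain.smul_z, JacobiDomain.smul_w]
      rw [key]
      simp only [JacobiGroup.mul_def, SU11.a_mul, SU11.b_mul, map_add, map_mul,
        Complex.conj_conj, SU11.rot, SU11.a_inv, SU11.b_inv, map_neg]
      rw [div_div_eq_mul_div]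
      congr 1
      rw [add_mul _ _ (conj k.g.b * x.w + conj k.g.a), sub_mul, mul_assoc,
        div_mul_cancel₀ _ hd, div_mul_cancel₀ _ hd]
      ring
    · simp only [JacobiDomain.smul_w]
      rw [key]
      simp only [JacobiGroup.mul_def, SU11.a_mul, SU11.b_mul, map_add, map_mul,
        Complex.conj_conj]
      rw [div_div_eq_mul_div]
      congr 1
      rw [add_mul _ _ (conj k.g.b * x.w + conj k.g.a),
        mul_assoc h.g.a (_ / _), div_mul_cancel₀ _ hd]
      ring

/-- The kernel `K(z, w; conj z', conj w')`, as a function of `x = (z, w)` and `y = (z', w')`;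
the natural number `n` is `2k`. -/
def jacobiKernel (n : ℕ) (x y : JacobiDomain) : ℂ :=
  ((1 - x.w * conj y.w) ^ n)⁻¹ *
    Complex.exp ((2 * conj y.z * x.z + x.z ^ 2 * conj y.w + conj y.z ^ 2 * x.w) /
      (2 * (1 - x.w * conj y.w)))

/-- `α₀ = (z + conj z w) / (1 - w conj w)`. -/
def JacobiDomain.α₀ (x : JacobiDomain) : ℂ := (x.z + conj x.z * x.w) / (1 - x.w * conj x.w)

/-- The multiplier `λ(h, x)` of `h = (g, α, t)` at `x = (z, w)`, with `n = 2k`,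
`α₂ = (α + α₀) a + (conj α + conj α₀) b`, `z₁` the first coordinate of `h·x` and
`θ_h(α, α₀) = Im(α conj α₀)`; the central variable contributes the factor `e^{it}`. -/
def jacobiMultiplier (n : ℕ) (h : JacobiGroup) (x : JacobiDomain) : ℂ :=
  ((conj h.g.a + conj h.g.b * x.w) ^ n)⁻¹ *
    Complex.exp (x.z / 2 * conj x.α₀ -
      (h • x).z / 2 * conj ((h.α + x.α₀) * h.g.a + (conj h.α + conj x.α₀) * h.g.b)) *
    Complex.exp (Complex.I * ((h.α * conj x.α₀).im : ℂ)) *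
    Complex.exp (Complex.I * (h.t : ℂ))

/-- The cocycle `J(h, x) = λ(h, x)⁻¹`. -/
def jacobiCocycle (n : ℕ) (h : JacobiGroup) (x : JacobiDomain) : ℂ :=
  (jacobiMultiplier n h x)⁻¹

/-! ### The Hilbert space of holomorphic functions -/

/-- Holomorphic functions on the domain. -/
def JacobiHolomorphic (f : JacobiDomain → ℂ) : Prop :=
  ∃ F : ℂ × ℂ → ℂ, DifferentiableOn ℂ F {x | ‖x.2‖ < 1} ∧ ∀ x : JacobiDomain, F x.1 = f x

lemma JacobiHolomorphic.continuous {f : JacobiDomain → ℂ} (hf : JacobiHolomorphic f) :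
    Continuous f := by
  obtain ⟨F, hF, hFf⟩ := hf
  have : f = fun x : JacobiDomain => F x.1 := funext fun x => (hFf x).symm
  rw [this]
  exact hF.continuousOn.comp_continuous continuous_subtype_val fun x => x.2

/-- Lebesgue measure `d(Re w) d(Im w) d(Re z) d(Im z)` on the domain. -/
def jacobiLebesgue : Measure JacobiDomain :=
  Measure.comap (Subtype.val : JacobiDomain → ℂ × ℂ) volume

/-- The measure `dν = (1 - |w|²)⁻³ d(Re w) d(Im w) d(Re z) d(Im z)`. -/
def jacobiMeasure : Measure JacobiDomain :=
  jacobiLebesgue.withDensity fun x : JacobiDomain =>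
    ENNReal.ofReal (((1 - ‖x.w‖ ^ 2) ^ 3)⁻¹)

/-- The weight
`(1 - |w|²)^{2k} exp(-|z|²/(1 - |w|²)) exp(-(z² conj w + (conj z)² w)/(2 (1 - |w|²)))`;
the numerator in the last exponent is real. -/
def jacobiWeight (n : ℕ) (x : JacobiDomain) : ℝ :=
  (1 - ‖x.w‖ ^ 2) ^ n * Real.exp (-(‖x.z‖ ^ 2 / (1 - ‖x.w‖ ^ 2))) *
    Real.exp (-((x.z ^ 2 * conj x.w + conj x.z ^ 2 * x.w).re / (2 * (1 - ‖x.w‖ ^ 2))))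

/-- The constant `Λ = (4k - 3)/(2π²)`, with `n = 2k`. -/
def jacobiConst (n : ℕ) : ℝ := (2 * n - 3) / (2 * Real.pi ^ 2)

/-- The scalar product of two functions,
`Λ ∫ conj f(z, w) g(z, w) (1 - |w|²)^{2k} exp(…) exp(…) dν`. -/
def fockInner (n : ℕ) (f g : JacobiDomain → ℂ) : ℂ :=
  jacobiConst n * ∫ x, conj (f x) * g x * jacobiWeight n x ∂jacobiMeasure

lemma JacobiDomain.continuous_z : Continuous JacobiDomain.z :=
  continuous_fst.comp continuous_subtype_val

lemma JacobiDomain.continuous_w : Continuous JacobiDomain.w :=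
  continuous_snd.comp continuous_subtype_val

lemma jacobiWeight_pos (n : ℕ) (x : JacobiDomain) : 0 < jacobiWeight n x := by
  have := x.one_sub_pos
  unfold jacobiWeight
  positivity

lemma jacobiWeight_continuous (n : ℕ) : Continuous (jacobiWeight n) := by
  have hz := JacobiDomain.continuous_z
  have hw := JacobiDomain.continuous_w
  have h1 : ∀ x : JacobiDomain, 1 - ‖x.w‖ ^ 2 ≠ 0 := fun x => x.one_sub_pos.ne'
  have h2 : ∀ x : JacobiDomain, 2 * (1 - ‖x.w‖ ^ 2) ≠ 0 := fun x =>
    mul_ne_zero two_ne_zero (h1 x)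
  have hc : Continuous fun x : JacobiDomain => (x.z ^ 2 * conj x.w + conj x.z ^ 2 * x.w).re :=
    Complex.continuous_re.comp (((hz.pow 2).mul (Complex.continuous_conj.comp hw)).add
      (((Complex.continuous_conj.comp hz).pow 2).mul hw))
  have hd : Continuous fun x : JacobiDomain => 1 - ‖x.w‖ ^ 2 :=
    continuous_const.sub (hw.norm.pow 2)
  exact ((hd.pow n).mul (Real.continuous_exp.comp ((hz.norm.pow 2).div hd h1).neg)).mul
    (Real.continuous_exp.comp (hc.div (continuous_const.mul hd) h2).neg)

lemma jacobiConst_pos (n : ℕ) [hn : Fact (2 ≤ n)] : 0 < jacobiConst n := by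
  have : (2 : ℝ) ≤ n := by exact_mod_cast hn.out
  unfold jacobiConst
  have := Real.pi_pos
  apply div_pos <;> nlinarith

/-- The functions that are square integrable for the weighted measure. -/
def FockIntegrable (n : ℕ) (f : JacobiDomain → ℂ) : Prop :=
  Integrable (fun x => ‖f x‖ ^ 2 * jacobiWeight n x) jacobiMeasure

/-- The space of holomorphic functions on the domain that are square integrable for the
weighted measure. -/
def fockSubmodule (n : ℕ) : Submodule ℂ (JacobiDomain → ℂ) where
  carrier := {f | JacobiHolomorphic f ∧ FockIntegrable n f}
  zero_mem' := ⟨⟨0, differentiableOn_const 0, fun _ => rfl⟩, by simp [FockIntegrable]⟩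
  add_mem' := by
    rintro f g ⟨hf, hf2⟩ ⟨hg, hg2⟩
    refine ⟨?_, ?_⟩
    · obtain ⟨F, hF, hFf⟩ := hf
      obtain ⟨G, hG, hGg⟩ := hg
      exact ⟨F + G, hF.add hG, fun x => by simp [hFf, hGg]⟩
    · refine ((hf2.add hg2).const_mul 2).mono' ?_ (Filter.Eventually.of_forall fun x => ?_)
      · exact ((((hf.continuous.add hg.continuous).norm.pow 2).mul
          (jacobiWeight_continuous n))).aestronglyMeasurable
      · have hw := (jacobiWeight_pos n x).le
        rw [Real.norm_of_nonneg (by positivity)]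
        have h1 : ‖(f + g) x‖ ≤ ‖f x‖ + ‖g x‖ := norm_add_le _ _
        have h2 : ‖(f + g) x‖ ^ 2 ≤ 2 * (‖f x‖ ^ 2 + ‖g x‖ ^ 2) := by
          nlinarith [norm_nonneg ((f + g) x), sq_nonneg (‖f x‖ - ‖g x‖)]
        calc ‖(f + g) x‖ ^ 2 * jacobiWeight n x
            ≤ 2 * (‖f x‖ ^ 2 + ‖g x‖ ^ 2) * jacobiWeight n x := by gcongr
          _ = _ := by simp only [Pi.add_apply]; ring
  smul_mem' := by
    rintro c f ⟨⟨F, hF, hFf⟩, hf2⟩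
    refine ⟨⟨c • F, hF.const_smul c, fun x => by simp [hFf]⟩, ?_⟩
    have := hf2.const_mul (‖c‖ ^ 2)
    refine this.congr (Filter.Eventually.of_forall fun x => ?_)
    simp only [Pi.smul_apply, norm_smul, mul_pow]
    ring

/-- The Fock space `F_K`; as a type of its own, so that it does not carry the topology of
pointwise convergence but only the one of its norm, defined below. -/
def FockSpace (n : ℕ) : Type := fockSubmodule n

instance (n : ℕ) : AddCommGroup (FockSpace n) := inferInstanceAs (AddCommGroup (fockSubmodule n))

instance (n : ℕ) : Module ℂ (FockSpace n) := inferInstanceAs (Module ℂ (fockSubmodule n))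

instance (n : ℕ) : FunLike (FockSpace n) JacobiDomain ℂ where
  coe f := Subtype.val (p := fun f => f ∈ fockSubmodule n) f
  coe_injective _ _ h := Subtype.ext h

lemma FockSpace.mem {n : ℕ} (f : FockSpace n) : JacobiHolomorphic f ∧ FockIntegrable n f :=
  Subtype.property (p := fun f => f ∈ fockSubmodule n) f

lemma FockSpace.add_apply {n : ℕ} (f g : FockSpace n) (x : JacobiDomain) :
    (f + g) x = f x + g x := rfl

lemma FockSpace.smul_apply {n : ℕ} (c : ℂ) (f : FockSpace n) (x : JacobiDomain) :
    (c • f) x = c * f x := rfl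

lemma fockIntegrable_mul (n : ℕ) (f g : FockSpace n) :
    Integrable (fun x => conj (f x) * g x * (jacobiWeight n x : ℂ)) jacobiMeasure := by
  refine (f.mem.2.add g.mem.2).mono' ?_ (Filter.Eventually.of_forall fun x => ?_)
  · exact (((Complex.continuous_conj.comp f.mem.1.continuous).mul g.mem.1.continuous).mul
      (Complex.continuous_ofReal.comp (jacobiWeight_continuous n))).aestronglyMeasurable
  · have hw := jacobiWeight_pos n x
    simp only [norm_mul, RCLike.norm_conj, Complex.norm_real, Real.norm_of_nonneg hw.le,
      Pi.add_apply]
    nlinarith [sq_nonneg (‖f x‖ - ‖g x‖), mul_nonneg (sq_nonneg (‖f x‖ - ‖g x‖)) hw.le,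
      mul_nonneg (mul_nonneg (norm_nonneg (f x)) (norm_nonneg (g x))) hw.le]

lemma fockInner_self (n : ℕ) (f : JacobiDomain → ℂ) : fockInner n f f =
    ((jacobiConst n * ∫ x, ‖f x‖ ^ 2 * jacobiWeight n x ∂jacobiMeasure : ℝ) : ℂ) := by
  unfold fockInner
  rw [Complex.ofReal_mul, ← integral_complex_ofReal]
  congr 2
  ext x
  rw [mul_comm (conj (f x)), Complex.mul_conj, Complex.normSq_eq_norm_sq]
  push_cast
  rfl

lemma fock_definite (n : ℕ) [Fact (2 ≤ n)] (f : FockSpace n) (h : fockInner n f f = 0) :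
    f = 0 := by
  rw [fockInner_self] at h
  have h1 : ∫ x, ‖f x‖ ^ 2 * jacobiWeight n x ∂jacobiMeasure = 0 := by
    have h2 := Complex.ofReal_eq_zero.1 h
    exact (mul_eq_zero.1 h2).resolve_left (jacobiConst_pos n).ne'
  rw [integral_eq_zero_iff_of_nonneg
    (fun x => mul_nonneg (sq_nonneg _) (jacobiWeight_pos n x).le) f.mem.2] at h1
  have hd : Continuous fun x : JacobiDomain => 1 - ‖x.w‖ ^ 2 :=
    continuous_const.sub (JacobiDomain.continuous_w.norm.pow 2)
  have h2 : (fun x : JacobiDomain => ‖f x‖ ^ 2 * jacobiWeight n x)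
      =ᵐ[jacobiLebesgue] 0 := by
    unfold jacobiMeasure at h1
    have := (ae_withDensity_iff (μ := jacobiLebesgue) (ENNReal.measurable_ofReal.comp ((hd.pow 3).measurable.inv))).1 h1
    filter_upwards [this] with x hx
    apply hx
    have := x.one_sub_pos
    simp only [Function.comp_apply, Pi.inv_apply, ne_eq, ENNReal.ofReal_eq_zero, not_le]
    exact inv_pos.2 (pow_pos this 3)
  have hopen : IsOpen {x : ℂ × ℂ | ‖x.2‖ < 1} :=
    isOpen_lt continuous_snd.norm continuous_const
  have hF := f.mem.1
  have h3 : jacobiLebesgue.IsOpenPosMeasure :=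
    ⟨fun U hU hne h0 => by
      have h0 := ((MeasurableEmbedding.subtype_coe hopen.measurableSet).comap_apply
        (volume : Measure (ℂ × ℂ)) U).symm.trans h0
      exact (hopen.isOpenMap_subtype_val U hU).measure_ne_zero volume (hne.image _) h0⟩
  have h4 := Continuous.ae_eq_iff_eq jacobiLebesgue
    ((hF.continuous.norm.pow 2).mul (jacobiWeight_continuous n)) continuous_const |>.1 h2
  refine DFunLike.ext _ _ fun x => ?_
  have h5 : ‖f x‖ ^ 2 * jacobiWeight n x = 0 := congrFun h4 x
  have h6 := (mul_eq_zero.1 h5).resolve_right (jacobiWeight_pos n x).ne'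
  exact norm_eq_zero.1 (pow_eq_zero_iff two_ne_zero |>.1 h6)

/-- The scalar product `fockInner` on the Fock space. -/
@[reducible] def fockCore (n : ℕ) [Fact (2 ≤ n)] : InnerProductSpace.Core ℂ (FockSpace n) where
  inner f g := fockInner n f g
  conj_inner_symm f g := by
    unfold fockInner
    rw [map_mul, Complex.conj_ofReal, ← integral_conj]
    congr 2
    ext x
    simp only [map_mul, Complex.conj_conj, Complex.conj_ofReal]
    ring
  re_inner_nonneg f := by
    rw [fockInner_self]
    exact mul_nonneg (jacobiConst_pos n).le (integral_nonneg fun x =>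
      mul_nonneg (sq_nonneg _) (jacobiWeight_pos n x).le)
  add_left f g h := by
    unfold fockInner
    rw [← mul_add, ← integral_add (fockIntegrable_mul n f h) (fockIntegrable_mul n g h)]
    congr 2
    ext x
    simp only [FockSpace.add_apply, map_add]
    ring
  smul_left f g c := by
    unfold fockInner
    rw [mul_left_comm, ← integral_const_mul (conj c)]
    congr 2
    ext x
    simp only [FockSpace.smul_apply, map_mul]
    ring
  definite f h := fock_definite n f h

instance (n : ℕ) [Fact (2 ≤ n)] : NormedAddCommGroup (FockSpace n) :=
  (fockCore n).toNormedAddCommGroup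

instance (n : ℕ) [Fact (2 ≤ n)] : InnerProductSpace ℂ (FockSpace n) :=
  InnerProductSpace.ofCore (fockCore n).toCore

/-! ### The representation `π(g, α) = S(g) D(α)` and the coherent state vectors -/

section Representation

variable {H : Type*} [NormedAddCommGroup H] [InnerProductSpace ℂ H]

/-- The parametrization of the Jacobi group by
`(b, φ, α, t) ↦ ([[√(1+|b|²) e^{iφ}, b], [conj b, √(1+|b|²) e^{-iφ}]], α, t)`. It is a surjective
local diffeomorphism (a covering), so it carries the smooth structure of the group. -/
def jacobiParam (p : ℂ × ℝ × ℂ × ℝ) : JacobiGroup :=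
  ⟨SU11.mk (Real.sqrt (1 + ‖p.1‖ ^ 2) * Complex.exp (Complex.I * p.2.1)) p.1 (by
      have h : (0 : ℝ) ≤ 1 + ‖p.1‖ ^ 2 := by positivity
      have h2 : ‖(Real.sqrt (1 + ‖p.1‖ ^ 2) * Complex.exp (Complex.I * p.2.1) : ℂ)‖ ^ 2
          = 1 + ‖p.1‖ ^ 2 := by
        rw [norm_mul, mul_comm Complex.I, Complex.norm_exp_ofReal_mul_I, mul_one,
          Complex.norm_real, Real.norm_of_nonneg (Real.sqrt_nonneg _), Real.sq_sqrt h]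
      rw [Complex.mul_conj, Complex.mul_conj, Complex.normSq_eq_norm_sq,
        Complex.normSq_eq_norm_sq, h2]
      push_cast
      ring), p.2.2.1, p.2.2.2⟩

/-- Smooth vectors: the orbit map `h ↦ π(h) v` is smooth on the group. -/
def IsSmoothVector (π : JacobiGroup →* (H ≃ₗᵢ[ℂ] H)) (v : H) : Prop :=
  ContDiff ℝ ((⊤ : ℕ∞) : WithTop ℕ∞) fun p : ℂ × ℝ × ℂ × ℝ => π (jacobiParam p) v

/-- The derived representation on the generator of the one-parameter subgroup `γ`. -/
def derivedRep (π : JacobiGroup →* (H ≃ₗᵢ[ℂ] H)) (γ : ℝ → JacobiGroup) (v : H) : H :=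
  deriv (fun s : ℝ => π (γ s) v) 0

/-- The one-parameter subgroup `s ↦ D(s x) = exp s(x a⁺ - conj x a)`. -/
def heisenbergFlow (x : ℂ) (s : ℝ) : JacobiGroup := ⟨1, s * x, 0⟩

/-- The one-parameter subgroup `s ↦ S(exp s[[0, y], [conj y, 0]]) = exp s(y K₊ - conj y K₋)`,
for `|y| = 1`. -/
def boostFlow (y : ℂ) (hy : ‖y‖ = 1) (s : ℝ) : JacobiGroup :=
  ⟨SU11.mk (Real.cosh s) (y * Real.sinh s) (by
    have h : (Real.cosh s : ℂ) ^ 2 - (Real.sinh s : ℂ) ^ 2 = 1 := by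
      exact_mod_cast Real.cosh_sq_sub_sinh_sq s
    have h2 : y * conj y = 1 := by
      rw [Complex.mul_conj, Complex.normSq_eq_norm_sq, hy]; simp
    simp only [map_mul, Complex.conj_ofReal]
    linear_combination h - (Real.sinh s : ℂ) ^ 2 * h2), 0, 0⟩

/-- The one-parameter subgroup `s ↦ S(diag(e^{is}, e^{-is})) = exp(2 i s K₀)`. -/
def rotationFlow (s : ℝ) : JacobiGroup :=
  ⟨SU11.mk (Complex.exp (s * Complex.I)) 0 (by
    rw [Complex.mul_conj, Complex.normSq_eq_norm_sq, Complex.norm_exp_ofReal_mul_I]; simp), 0, 0⟩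

/-- The operator `a⁺`, from `dπ(1) = a⁺ - a` and `dπ(i) = i a⁺ + i a` on the Heisenberg part. -/
def opCreate (π : JacobiGroup →* (H ≃ₗᵢ[ℂ] H)) (v : H) : H :=
  (1 / 2 : ℂ) • (derivedRep π (heisenbergFlow 1) v
    - Complex.I • derivedRep π (heisenbergFlow Complex.I) v)

/-- The operator `a`. -/
def opAnnihilate (π : JacobiGroup →* (H ≃ₗᵢ[ℂ] H)) (v : H) : H :=
  -(1 / 2 : ℂ) • (derivedRep π (heisenbergFlow 1) v
    + Complex.I • derivedRep π (heisenbergFlow Complex.I) v)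

/-- The operator `K₊`. -/
def opKPlus (π : JacobiGroup →* (H ≃ₗᵢ[ℂ] H)) (v : H) : H :=
  (1 / 2 : ℂ) • (derivedRep π (boostFlow 1 norm_one) v
    - Complex.I • derivedRep π (boostFlow Complex.I Complex.norm_I) v)

/-- The operator `K₋`. -/
def opKMinus (π : JacobiGroup →* (H ≃ₗᵢ[ℂ] H)) (v : H) : H :=
  -(1 / 2 : ℂ) • (derivedRep π (boostFlow 1 norm_one) v
    + Complex.I • derivedRep π (boostFlow Complex.I Complex.norm_I) v)

/-- The operator `K₀`. -/
def opKZero (π : JacobiGroup →* (H ≃ₗᵢ[ℂ] H)) (v : H) : H :=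
  -(Complex.I / 2) • derivedRep π rotationFlow v

/-- A continuous unitary representation `π(g, α, t) = e^{it} S(g) D(α)` of the Jacobi group with
a cyclic smooth unit vector `e₀` such that `a e₀ = 0`, `K₋ e₀ = 0` and `K₀ e₀ = k e₀`, where
`n = 2k`. -/
structure IsJacobiRep (n : ℕ) (π : JacobiGroup →* (H ≃ₗᵢ[ℂ] H)) (e₀ : H) : Prop where
  continuous : ∀ v : H, Continuous fun h => π h v
  central : ∀ (t : ℝ) (v : H), π ⟨1, 0, t⟩ v = Complex.exp (Complex.I * t) • v
  smooth : IsSmoothVector π e₀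
  norm_eq_one : ‖e₀‖ = 1
  cyclic : (Submodule.span ℂ (Set.range fun h => π h e₀)).topologicalClosure = ⊤
  annihilate : opAnnihilate π e₀ = 0
  kMinus : opKMinus π e₀ = 0
  kZero : opKZero π e₀ = ((n : ℂ) / 2) • e₀

/-- The terms of the exponential series of the coherent state vector
`e_{z,w} = exp(z a⁺ + w K₊) e₀`. -/
def coherentTerm (π : JacobiGroup →* (H ≃ₗᵢ[ℂ] H)) (e₀ : H) (x : JacobiDomain) (m : ℕ) : H :=
  ((m.factorial : ℂ)⁻¹) • (fun v => x.z • opCreate π v + x.w • opKPlus π v)^[m] e₀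

end Representation

end

noncomputable section

/-! ### The multiplier in holomorphic form -/

/-! The group acts transitively on the domain and λ is a multiplier for this action, so nearly
everything reduces to the base point (0, 0), whose stabilizer is the circle of rotations times the
centre. Although λ is written with the non-holomorphic quantity α₀, it is holomorphic in x
(`jacobiMultiplier_eq`); in that form the cocycle identity and the covariance of K are rational
identities. Since the weight is 1/K(x, x), the action multiplies it by |λ|², and since the measure
is invariant, f ↦ λ(h, ·) f(h · ) is isometric.

The reproducing property comes from averaging over rotations. By the mean value property the
integral of f against the weight is f(0, 0) times the total mass of the weight, and Λ is the inverse
of that mass. So the constant 1 represents evaluation at the base point (`fockOne_inner`), and its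
translates are, up to scalars, the functions K(·, y) (`exists_fockKernel`). Positivity, the bound
|f(y)| ≤ K(y, y)^(1/2) ‖f‖, completeness and strong continuity follow.

For an abstract π, the stabilizer acts on e₀ through λ (`IsJacobiRep.stabilizer_apply`), so e_x =
λ(σ, 0)⁻¹ π(σ) e₀ with σ·0 = x is well defined and equivariant. The equations a e₀ = 0 and K₋ e₀ = 0
are the Cauchy-Riemann equations for e at the base point, and equivariance carries them to every
point. The function ⟪e₀, e_x⟫ is holomorphic and rotation invariant, hence 1, and equivariance then
gives ⟪e_y, e_x⟫ = K(x, y).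

On the vectors e_x the operators a⁺ and K₊ act as ∂/∂z and ∂/∂w, so the exponential series is the
Taylor series of t ↦ e_{tx} at t = 1 (`IsJacobiRep.hasSum_coherentTerm`). Finally the functionals
⟪e_y, ·⟫ and the functions K(·, y) have the same Gram matrix and dense spans, which produces Φ
(`IsJacobiRep.dualIsometry`). -/

/-- The automorphy factor `conj b w + conj a`. -/
def SU11.den (g : SU11) (w : ℂ) : ℂ := conj g.b * w + conj g.a

lemma SU11.den_ne (g : SU11) (x : JacobiDomain) : g.den x.w ≠ 0 := g.den_ne_zero x

/-- The numerator `z + α - conj α w` of the first coordinate of `h·(z, w)`. -/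
def jacobiShift (h : JacobiGroup) (x : JacobiDomain) : ℂ := x.z + h.α - conj h.α * x.w

/-- The exponent of the multiplier, a holomorphic function of `x`. -/
def jacobiExponent (h : JacobiGroup) (x : JacobiDomain) : ℂ :=
  -(conj h.g.b * jacobiShift h x ^ 2 / (2 * h.g.den x.w)) - h.α * conj h.α / 2
    - conj h.α * x.z + x.w * conj h.α ^ 2 / 2 + Complex.I * h.t

namespace JacobiDomain

lemma smul_z' (h : JacobiGroup) (x : JacobiDomain) :
    (h • x).z = jacobiShift h x / h.g.den x.w := by
  rw [smul_z]; unfold jacobiShift SU11.den; congr 1; ring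

lemma smul_w' (h : JacobiGroup) (x : JacobiDomain) :
    (h • x).w = (h.g.a * x.w + h.g.b) / h.g.den x.w := rfl

lemma one_sub_mul_conj_ne_zero (x y : JacobiDomain) : 1 - x.w * conj y.w ≠ 0 := by
  intro h
  have h1 : ‖x.w * conj y.w‖ = 1 := by
    rw [← sub_eq_zero.1 h, norm_one]
  rw [norm_mul, RCLike.norm_conj] at h1
  have := x.norm_w_lt
  have := y.norm_w_lt
  nlinarith [norm_nonneg x.w, norm_nonneg y.w]

lemma eq_α₀_sub (x : JacobiDomain) : x.z = x.α₀ - x.w * conj x.α₀ := by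
  have h := x.one_sub_mul_conj_ne_zero x
  have h' : 1 - conj x.w * x.w ≠ 0 := by rwa [mul_comm]
  simp only [α₀, map_div₀, map_add, map_mul, map_sub, map_one, Complex.conj_conj]
  field_simp
  ring

end JacobiDomain

lemma Complex.I_mul_im_mul_conj (u v : ℂ) :
    Complex.I * ((u * conj v).im : ℂ) = (u * conj v - conj u * v) / 2 := by
  rw [Complex.im_eq_sub_conj, map_mul, Complex.conj_conj]
  field_simp

/-- After the substitution z = α₀ - w conj α₀ the exponent depends on α₀ through α + α₀ and its
conjugate, and all terms that are not holomorphic in x cancel. -/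
lemma jacobiMultiplier_eq (n : ℕ) (h : JacobiGroup) (x : JacobiDomain) :
    jacobiMultiplier n h x = ((h.g.den x.w) ^ n)⁻¹ * Complex.exp (jacobiExponent h x) := by
  have hd := h.g.den_ne x
  unfold jacobiMultiplier
  rw [mul_assoc, mul_assoc, ← Complex.exp_add, ← Complex.exp_add, Complex.I_mul_im_mul_conj,
    JacobiDomain.smul_z']
  congr 2
  · rw [add_comm]; rfl
  · have hz := x.eq_α₀_sub
    have hs : jacobiShift h x = (h.α + x.α₀) - x.w * conj (h.α + x.α₀) := by
      unfold jacobiShift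
      rw [hz]
      simp only [map_add]
      ring
    unfold jacobiExponent
    rw [hs, hz]
    simp only [map_add, map_mul, Complex.conj_conj]
    have hden : h.g.den x.w = conj h.g.b * x.w + conj h.g.a := rfl
    -- From here the conjugates count as independent variables, and the claim is a rational
    -- identity.
    generalize h.g.den x.w = d at *
    generalize conj h.α = αc at *
    generalize conj x.α₀ = βc at *
    generalize conj h.g.a = ac at *
    generalize conj h.g.b = bc at *
    obtain rfl : ac = d - bc * x.w := by rw [hden]; ring
    field_simp
    ring

lemma jacobiMultiplier_ne_zero (n : ℕ) (h : JacobiGroup) (x : JacobiDomain) :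
    jacobiMultiplier n h x ≠ 0 := by
  rw [jacobiMultiplier_eq]
  exact mul_ne_zero (inv_ne_zero (pow_ne_zero _ (h.g.den_ne x))) (Complex.exp_ne_zero _)

lemma SU11.den_mul (h k : JacobiGroup) (x : JacobiDomain) :
    (h * k).g.den x.w = h.g.den (k • x).w * k.g.den x.w := by
  have hd := k.g.den_ne x
  rw [JacobiDomain.smul_w']
  unfold SU11.den at *
  simp only [JacobiGroup.mul_def, SU11.a_mul, SU11.b_mul, map_add, map_mul, Complex.conj_conj]
  field_simp
  ring

/-- The quadratic term splits by the chain rule for Möbius denominators; the remaining terms match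
because of the phase Im((g₂⁻¹·α₁) conj α₂) in the group law. -/
lemma jacobiExponent_mul (h k : JacobiGroup) (x : JacobiDomain) :
    jacobiExponent (h * k) x = jacobiExponent h (k • x) + jacobiExponent k x := by
  have hd := k.g.den_ne x
  have hD := h.g.den_ne (k • x)
  have hdet := k.g.det_eq
  unfold jacobiExponent
  rw [SU11.den_mul]
  have hs : jacobiShift h (k • x) = jacobiShift (h * k) x / k.g.den x.w := by
    unfold jacobiShift
    rw [JacobiDomain.smul_z', JacobiDomain.smul_w']
    field_simp
    unfold jacobiShift SU11.den
    simp only [JacobiGroup.mul_def, map_add, map_mul, map_neg, Complex.conj_conj, SU11.rot,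
      SU11.a_inv, SU11.b_inv]
    ring
  rw [hs]
  have hD' : h.g.den (k • x).w =
      (conj h.g.b * (k.g.a * x.w + k.g.b) + conj h.g.a * k.g.den x.w) / k.g.den x.w := by
    change conj h.g.b * (k • x).w + conj h.g.a = _
    rw [JacobiDomain.smul_w']
    field_simp
  -- Rests on conj b_{hk} · den_k = conj b_h + conj b_k · den_{hk}, which is the determinant
  -- condition for k.
  have h1 : conj (h * k).g.b * jacobiShift (h * k) x ^ 2 /
        (2 * (h.g.den (k • x).w * k.g.den x.w)) =
      conj h.g.b * (jacobiShift (h * k) x / k.g.den x.w) ^ 2 / (2 * h.g.den (k • x).w)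
        + conj k.g.b * jacobiShift (h * k) x ^ 2 / (2 * k.g.den x.w) := by
    have hb : conj (h * k).g.b * k.g.den x.w = conj h.g.b +
        conj k.g.b * (h.g.den (k • x).w * k.g.den x.w) := by
      rw [hD', div_mul_cancel₀ _ hd]
      unfold SU11.den
      simp only [JacobiGroup.mul_def, SU11.b_mul, map_add, map_mul, Complex.conj_conj]
      linear_combination conj h.g.b * hdet
    have hb' : conj (h * k).g.b = (conj h.g.b +
        conj k.g.b * (h.g.den (k • x).w * k.g.den x.w)) / k.g.den x.w := by
      rw [← hb, mul_div_cancel_right₀ _ hd]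
    rw [hb']
    field_simp
  rw [h1]
  have hsk : jacobiShift (h * k) x = jacobiShift k x + (SU11.rot k.g⁻¹ h.α)
      - conj (SU11.rot k.g⁻¹ h.α) * x.w := by
    unfold jacobiShift
    simp only [JacobiGroup.mul_def, map_add]
    ring
  rw [hsk, JacobiDomain.smul_z', JacobiDomain.smul_w']
  simp only [JacobiGroup.mul_def]
  push_cast
  rw [mul_add, mul_add, Complex.I_mul_im_mul_conj]
  have hz : x.z = jacobiShift k x - k.α + conj k.α * x.w := by unfold jacobiShift; ring
  rw [hz]
  generalize jacobiShift k x = u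
  -- This and `hq` eliminate α of h in favour of p = k.g⁻¹·α and q = conj p, treated as independent
  -- unknowns.
  have hp : conj k.g.b * SU11.rot k.g⁻¹ h.α + conj k.g.a * conj (SU11.rot k.g⁻¹ h.α)
      = conj h.α := by
    simp only [SU11.rot, map_add, map_mul, map_neg, Complex.conj_conj, SU11.a_inv, SU11.b_inv]
    linear_combination conj h.α * hdet
  have hq : SU11.rot k.g⁻¹ h.α - conj (SU11.rot k.g⁻¹ h.α) * x.w =
      h.α * k.g.den x.w - conj h.α * (k.g.a * x.w + k.g.b) := by
    unfold SU11.den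
    simp only [SU11.rot, map_add, map_mul, map_neg, Complex.conj_conj, SU11.a_inv, SU11.b_inv]
    ring
  have hden : k.g.den x.w = conj k.g.b * x.w + conj k.g.a := rfl
  simp only [map_add]
  generalize SU11.rot k.g⁻¹ h.α = p at *
  generalize conj p = q at *
  generalize conj h.α = αc at *
  generalize conj k.α = βc at *
  generalize conj k.g.b = bc at *
  generalize conj k.g.a = ac at *
  generalize k.g.den x.w = d at *
  generalize k.g.a * x.w + k.g.b = e at *
  have ha : ac = d - bc * x.w := by rw [hden]; ring
  subst ha
  generalize conj h.g.b * ((u + p - q * x.w) / d) ^ 2 / (2 * h.g.den (k • x).w) = R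
  subst hp
  have hα : h.α = (p - q * x.w + (bc * p + (d - bc * x.w) * q) * e) / d := by
    rw [hq]; field_simp; ring
  rw [hα]
  field_simp
  ring

lemma jacobiMultiplier_mul (n : ℕ) (h k : JacobiGroup) (x : JacobiDomain) :
    jacobiMultiplier n (h * k) x = jacobiMultiplier n h (k • x) * jacobiMultiplier n k x := by
  simp only [jacobiMultiplier_eq]
  rw [SU11.den_mul, jacobiExponent_mul, Complex.exp_add, mul_pow, mul_inv]
  ring

lemma jacobiMultiplier_one (n : ℕ) (x : JacobiDomain) : jacobiMultiplier n 1 x = 1 := by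
  rw [jacobiMultiplier_eq]
  simp [jacobiExponent, JacobiGroup.one_def, SU11.den]

lemma jacobiMultiplier_inv_smul (n : ℕ) (h : JacobiGroup) (x : JacobiDomain) :
    jacobiMultiplier n h⁻¹ (h • x) * jacobiMultiplier n h x = 1 := by
  rw [← jacobiMultiplier_mul, inv_mul_cancel, jacobiMultiplier_one]

/-! ### Covariance of the kernel and of the weight. -/

lemma jacobiKernel_smul_mul (n : ℕ) (h : JacobiGroup) (x y : JacobiDomain) :
    jacobiKernel n (h • x) (h • y) * jacobiMultiplier n h x * conj (jacobiMultiplier n h y)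
      = jacobiKernel n x y := by
  have hx := h.g.den_ne x
  have hy : conj (h.g.den y.w) ≠ 0 := (map_ne_zero _).2 (h.g.den_ne y)
  have hdet := h.g.det_eq
  have hxy := x.one_sub_mul_conj_ne_zero y
  -- This identity absorbs the factors den⁻ⁿ of the two multipliers; `h2` compares the exponents.
  have h1 : 1 - (h • x).w * conj (h • y).w =
      (1 - x.w * conj y.w) / (h.g.den x.w * conj (h.g.den y.w)) := by
    simp only [JacobiDomain.smul_w', map_div₀, map_add, map_mul]
    field_simp
    unfold SU11.den
    simp only [map_add, map_mul, Complex.conj_conj]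
    linear_combination (1 - x.w * conj y.w) * hdet
  simp only [jacobiMultiplier_eq, jacobiKernel]
  rw [h1]
  have h2 : (2 * conj (h • y).z * (h • x).z + (h • x).z ^ 2 * conj (h • y).w
        + conj (h • y).z ^ 2 * (h • x).w) /
          (2 * ((1 - x.w * conj y.w) / (h.g.den x.w * conj (h.g.den y.w))))
      + jacobiExponent h x + conj (jacobiExponent h y) =
      (2 * conj y.z * x.z + x.z ^ 2 * conj y.w + conj y.z ^ 2 * x.w) /
        (2 * (1 - x.w * conj y.w)) := by
    simp only [JacobiDomain.smul_z', JacobiDomain.smul_w', jacobiExponent]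
    simp only [map_add, map_mul, map_sub, map_neg, map_div₀, map_pow, Complex.conj_conj,
      Complex.conj_I, Complex.conj_ofReal, map_ofNat]
    have hdx : h.g.den x.w = conj h.g.b * x.w + conj h.g.a := rfl
    have hdy : conj (h.g.den y.w) = h.g.b * conj y.w + h.g.a := by
      unfold SU11.den; simp
    have hz : x.z = jacobiShift h x - h.α + conj h.α * x.w := by unfold jacobiShift; ring
    have hw : conj y.z = conj (jacobiShift h y) - conj h.α + h.α * conj y.w := by
      unfold jacobiShift; simp only [map_add, map_sub, map_mul, Complex.conj_conj]; ring
    rw [hz, hw]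
    generalize h.g.den x.w = d at *
    generalize conj (h.g.den y.w) = d' at *
    generalize jacobiShift h x = u at *
    generalize conj (jacobiShift h y) = v at *
    generalize conj h.g.b = bc at *
    generalize conj h.g.a = ac at *
    generalize conj h.α = αc at *
    generalize conj y.w = W at *
    obtain rfl : ac = d - bc * x.w := by rw [hdx]; ring
    have ha : h.g.a = d' - h.g.b * W := by rw [hdy]; ring
    rw [ha]
    field_simp
    ring
  rw [← h2, Complex.exp_add, Complex.exp_add, map_mul, ← Complex.exp_conj, map_inv₀, map_pow,
    div_pow, mul_pow]
  field_simp

lemma jacobiCocycle_mul (n : ℕ) (h₁ h₂ : JacobiGroup) (x : JacobiDomain) :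
    jacobiCocycle n (h₁ * h₂) x = jacobiCocycle n h₁ (h₂ • x) * jacobiCocycle n h₂ x := by
  unfold jacobiCocycle
  rw [jacobiMultiplier_mul, mul_inv]

lemma jacobiKernel_smul (n : ℕ) (h : JacobiGroup) (x y : JacobiDomain) :
    jacobiKernel n (h • x) (h • y) =
      jacobiCocycle n h x * jacobiKernel n x y * conj (jacobiCocycle n h y) := by
  have hx := jacobiMultiplier_ne_zero n h x
  have hy : conj (jacobiMultiplier n h y) ≠ 0 :=
    (map_ne_zero _).2 (jacobiMultiplier_ne_zero n h y)
  rw [← jacobiKernel_smul_mul n h x y]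
  unfold jacobiCocycle
  rw [map_inv₀]
  field_simp

lemma conj_jacobiKernel (n : ℕ) (x y : JacobiDomain) :
    conj (jacobiKernel n x y) = jacobiKernel n y x := by
  unfold jacobiKernel
  simp only [map_mul, map_inv₀, map_pow, map_sub, map_one, Complex.conj_conj, ← Complex.exp_conj,
    map_div₀, map_add, map_ofNat]
  rw [mul_comm (conj x.w)]
  congr 3
  ring

/-- Ties the kernel to the scalar product: through it, covariance of K on the diagonal becomes the
transformation law of the weight. -/
lemma jacobiKernel_self (n : ℕ) (x : JacobiDomain) :
    jacobiKernel n x x = (((jacobiWeight n x)⁻¹ : ℝ) : ℂ) := by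
  have hD : (1 : ℂ) - x.w * conj x.w = ((1 - ‖x.w‖ ^ 2 : ℝ) : ℂ) := by
    rw [Complex.mul_conj, Complex.normSq_eq_norm_sq]; push_cast; rfl
  have hD' := x.one_sub_pos
  obtain ⟨r, hr⟩ : ∃ r : ℝ, x.z ^ 2 * conj x.w + conj x.z ^ 2 * x.w = (r : ℂ) := by
    refine ⟨_, Complex.ext rfl ?_⟩
    simp [pow_two]
    ring
  have hN : conj x.z * x.z = ((‖x.z‖ ^ 2 : ℝ) : ℂ) := by
    rw [mul_comm, Complex.mul_conj, Complex.normSq_eq_norm_sq]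
  unfold jacobiKernel jacobiWeight
  rw [hD, mul_assoc 2, hN, add_assoc, hr, Complex.ofReal_re, mul_inv, mul_inv,
    ← Real.exp_neg, ← Real.exp_neg, mul_assoc, ← Real.exp_add]
  push_cast
  have : (1 : ℂ) - (‖x.w‖ : ℂ) ^ 2 ≠ 0 := by exact_mod_cast hD'.ne'
  congr 2
  field_simp

/-- The weight is transformed by the square of the multiplier. -/
lemma jacobiWeight_smul (n : ℕ) (h : JacobiGroup) (x : JacobiDomain) :
    jacobiWeight n (h • x) = ‖jacobiMultiplier n h x‖ ^ 2 * jacobiWeight n x := by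
  have h1 := jacobiKernel_smul_mul n h x x
  rw [jacobiKernel_self, jacobiKernel_self, mul_assoc, Complex.mul_conj,
    Complex.normSq_eq_norm_sq] at h1
  have h2 : (jacobiWeight n (h • x))⁻¹ * ‖jacobiMultiplier n h x‖ ^ 2 = (jacobiWeight n x)⁻¹ := by
    exact_mod_cast h1
  have hp := jacobiWeight_pos n x
  have hp' := jacobiWeight_pos n (h • x)
  field_simp at h2
  linarith

/-! ### The base point and a section -/

/-- The base point `(0, 0)`. -/
def JacobiDomain.origin : JacobiDomain := ⟨(0, 0), by simp⟩

@[simp] lemma JacobiDomain.origin_z : JacobiDomain.origin.z = 0 := rfl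

@[simp] lemma JacobiDomain.origin_w : JacobiDomain.origin.w = 0 := rfl

lemma jacobiKernel_origin (n : ℕ) (x : JacobiDomain) :
    jacobiKernel n x JacobiDomain.origin = 1 := by
  simp [jacobiKernel]

/-- Covariance with the second point at the base point, where K(·, 0) = 1. Up to a scalar, K(·, h·0)
is thus the translate by h of the constant function 1. -/
lemma jacobiKernel_smul_origin (n : ℕ) (h : JacobiGroup) (x : JacobiDomain) :
    jacobiKernel n x (h • JacobiDomain.origin) * conj (jacobiMultiplier n h JacobiDomain.origin) =
      jacobiMultiplier n h⁻¹ x := by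
  have h1 := jacobiKernel_smul_mul n h (h⁻¹ • x) JacobiDomain.origin
  rw [jacobiKernel_origin, smul_inv_smul] at h1
  have h2 := jacobiMultiplier_inv_smul n h (h⁻¹ • x)
  rw [smul_inv_smul] at h2
  have h3 := jacobiMultiplier_ne_zero n h (h⁻¹ • x)
  rw [eq_comm, ← mul_left_inj' h3, h2, ← h1]
  ring

/-- Coordinates of a group element that moves the base point to `(z, w)`. -/
def sectionCoord (x : ℂ × ℂ) : ℂ × ℝ × ℂ × ℝ :=
  ((((Real.sqrt (1 - ‖x.2‖ ^ 2))⁻¹ : ℝ) : ℂ) * x.2, 0,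
    (((Real.sqrt (1 - ‖x.2‖ ^ 2))⁻¹ : ℝ) : ℂ) * x.1, 0)

lemma jacobiParam_sectionCoord_a (x : JacobiDomain) :
    (jacobiParam (sectionCoord x.1)).g.a = (((Real.sqrt (1 - ‖x.w‖ ^ 2))⁻¹ : ℝ) : ℂ) := by
  have h : 1 + ‖(((Real.sqrt (1 - ‖x.w‖ ^ 2))⁻¹ : ℝ) : ℂ) * x.w‖ ^ 2 = (1 - ‖x.w‖ ^ 2)⁻¹ := by
    have := x.one_sub_pos
    rw [norm_mul, mul_pow, Complex.norm_real, Real.norm_of_nonneg (by positivity), inv_pow,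
      Real.sq_sqrt this.le]
    field_simp
    ring
  change ((Real.sqrt (1 + ‖(((Real.sqrt (1 - ‖x.w‖ ^ 2))⁻¹ : ℝ) : ℂ) * x.w‖ ^ 2) : ℝ) : ℂ) *
    Complex.exp (Complex.I * ((0 : ℝ) : ℂ)) = _
  rw [h, Real.sqrt_inv]
  simp

/-- The angle 0 makes a equal to (1 - |w|²)^(-1/2), so division of α and b by conj a returns z and
w. -/
lemma jacobiParam_sectionCoord_smul (x : JacobiDomain) :
    jacobiParam (sectionCoord x.1) • JacobiDomain.origin = x := by
  have ha := jacobiParam_sectionCoord_a x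
  have hne : (((Real.sqrt (1 - ‖x.w‖ ^ 2))⁻¹ : ℝ) : ℂ) ≠ 0 := by
    have := Real.sqrt_pos.2 x.one_sub_pos
    exact_mod_cast (inv_pos.2 this).ne'
  have hb : (jacobiParam (sectionCoord x.1)).g.b =
    (((Real.sqrt (1 - ‖x.w‖ ^ 2))⁻¹ : ℝ) : ℂ) * x.w := rfl
  have hα : (jacobiParam (sectionCoord x.1)).α =
    (((Real.sqrt (1 - ‖x.w‖ ^ 2))⁻¹ : ℝ) : ℂ) * x.z := rfl
  apply JacobiDomain.ext'
  · rw [JacobiDomain.smul_z, ha, hb, hα]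
    simp only [JacobiDomain.origin_z, JacobiDomain.origin_w, mul_zero, sub_zero, add_zero,
      zero_add, Complex.conj_ofReal]
    rw [mul_div_cancel_left₀ _ hne]
  · rw [JacobiDomain.smul_w, ha, hb]
    simp only [JacobiDomain.origin_w, mul_zero, zero_add, Complex.conj_ofReal]
    rw [mul_div_cancel_left₀ _ hne]

lemma exists_smul_origin (x : JacobiDomain) : ∃ h : JacobiGroup, h • JacobiDomain.origin = x :=
  ⟨_, jacobiParam_sectionCoord_smul x⟩

/-! ### Continuity of the group operations -/

namespace JacobiGroup

lemma continuous_coord : Continuous fun h : JacobiGroup => (h.g, h.α, h.t) :=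
  continuous_induced_dom

lemma continuous_g : Continuous JacobiGroup.g := continuous_coord.fst

lemma continuous_α : Continuous JacobiGroup.α := continuous_coord.snd.fst

lemma continuous_t : Continuous JacobiGroup.t := continuous_coord.snd.snd

lemma _root_.SU11.continuous_a : Continuous SU11.a := by
  have h : Continuous fun g : SU11 => ((g : Matrix.SpecialLinearGroup (Fin 2) ℂ) :
    Matrix (Fin 2) (Fin 2) ℂ) := continuous_subtype_val.comp continuous_subtype_val
  exact h.matrix_elem 0 0

lemma _root_.SU11.continuous_b : Continuous SU11.b := by
  have h : Continuous fun g : SU11 => ((g : Matrix.SpecialLinearGroup (Fin 2) ℂ) :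
    Matrix (Fin 2) (Fin 2) ℂ) := continuous_subtype_val.comp continuous_subtype_val
  exact h.matrix_elem 0 1

end JacobiGroup

lemma continuous_smul_left (x : JacobiDomain) : Continuous fun h : JacobiGroup => h • x := by
  have ha := SU11.continuous_a.comp JacobiGroup.continuous_g
  have hb := SU11.continuous_b.comp JacobiGroup.continuous_g
  have hα := JacobiGroup.continuous_α
  have hc := Complex.continuous_conj
  refine Continuous.subtype_mk (Continuous.prodMk ?_ ?_) _
  · exact Continuous.div (by fun_prop) (by fun_prop) fun h => h.g.den_ne_zero x
  · exact Continuous.div (by fun_prop) (by fun_prop) fun h => h.g.den_ne_zero x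

lemma continuous_smul_right (h : JacobiGroup) : Continuous fun x : JacobiDomain => h • x := by
  have hz := JacobiDomain.continuous_z
  have hw := JacobiDomain.continuous_w
  refine Continuous.subtype_mk (Continuous.prodMk ?_ ?_) _
  · exact Continuous.div (by fun_prop) (by fun_prop) fun x => h.g.den_ne_zero x
  · exact Continuous.div (by fun_prop) (by fun_prop) fun x => h.g.den_ne_zero x

lemma continuous_jacobiMultiplier_left (n : ℕ) (x : JacobiDomain) :
    Continuous fun h : JacobiGroup => jacobiMultiplier n h x := by
  have ha := SU11.continuous_a.comp JacobiGroup.continuous_g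
  have hb := SU11.continuous_b.comp JacobiGroup.continuous_g
  have hα := JacobiGroup.continuous_α
  have ht := JacobiGroup.continuous_t
  have hc := Complex.continuous_conj
  have hd : Continuous fun h : JacobiGroup => h.g.den x.w := by unfold SU11.den; fun_prop
  simp only [jacobiMultiplier_eq, jacobiExponent, jacobiShift]
  have h2 : Continuous fun h : JacobiGroup =>
      conj h.g.b * (x.z + h.α - conj h.α * x.w) ^ 2 / (2 * h.g.den x.w) :=
    Continuous.div (by fun_prop) (by fun_prop)
      fun h => mul_ne_zero two_ne_zero (h.g.den_ne x)
  refine ((hd.pow n).inv₀ fun h => pow_ne_zero _ (h.g.den_ne x)).mul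
    (Complex.continuous_exp.comp ?_)
  fun_prop

lemma continuous_jacobiKernel (n : ℕ) :
    Continuous fun p : JacobiDomain × JacobiDomain => jacobiKernel n p.1 p.2 := by
  have hz := JacobiDomain.continuous_z
  have hw := JacobiDomain.continuous_w
  have hc := Complex.continuous_conj
  unfold jacobiKernel
  have h : Continuous fun p : JacobiDomain × JacobiDomain => 1 - p.1.w * conj p.2.w := by fun_prop
  refine ((h.pow n).inv₀ fun p => pow_ne_zero _ (p.1.one_sub_mul_conj_ne_zero p.2)).mul
    (Complex.continuous_exp.comp ?_)
  exact Continuous.div (by fun_prop) (by fun_prop)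
    fun p => mul_ne_zero two_ne_zero (p.1.one_sub_mul_conj_ne_zero p.2)

/-! ### The action on an open subset of `ℂ × ℂ` and its derivative -/

/-- The domain as a subset of `ℂ × ℂ`. -/
def jacobiSet : Set (ℂ × ℂ) := {x | ‖x.2‖ < 1}

lemma isOpen_jacobiSet : IsOpen jacobiSet := isOpen_lt continuous_snd.norm continuous_const

lemma measurableEmbedding_jacobiDomain :
    MeasurableEmbedding (Subtype.val : JacobiDomain → ℂ × ℂ) :=
  MeasurableEmbedding.subtype_coe isOpen_jacobiSet.measurableSet

/-- The formula of the action on `ℂ × ℂ`. -/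
def jacobiAct (h : JacobiGroup) (p : ℂ × ℂ) : ℂ × ℂ :=
  ((h.α - conj h.α * p.2 + p.1) / (conj h.g.b * p.2 + conj h.g.a),
    (h.g.a * p.2 + h.g.b) / (conj h.g.b * p.2 + conj h.g.a))

lemma jacobiAct_coe (h : JacobiGroup) (x : JacobiDomain) : jacobiAct h x.1 = (h • x).1 := rfl

/-- The complex derivative of the action. -/
def jacobiActDeriv (h : JacobiGroup) (p : ℂ × ℂ) : ℂ × ℂ →L[ℂ] ℂ × ℂ :=
  ((h.g.den p.2)⁻¹ • ContinuousLinearMap.fst ℂ ℂ ℂ +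
    (-(conj h.α * h.g.den p.2 + conj h.g.b * (h.α - conj h.α * p.2 + p.1)) / h.g.den p.2 ^ 2) •
      ContinuousLinearMap.snd ℂ ℂ ℂ).prod
    ((h.g.den p.2 ^ 2)⁻¹ • ContinuousLinearMap.snd ℂ ℂ ℂ)

lemma hasFDerivAt_jacobiAct (h : JacobiGroup) (x : JacobiDomain) :
    HasFDerivAt (jacobiAct h) (jacobiActDeriv h x.1) x.1 := by
  have hd : conj h.g.b * x.1.2 + conj h.g.a ≠ 0 := h.g.den_ne_zero x
  have h1 : HasFDerivAt (fun p : ℂ × ℂ => p.1) (ContinuousLinearMap.fst ℂ ℂ ℂ) x.1 :=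
    hasFDerivAt_fst
  have h2 : HasFDerivAt (fun p : ℂ × ℂ => p.2) (ContinuousLinearMap.snd ℂ ℂ ℂ) x.1 :=
    hasFDerivAt_snd
  have hden : HasFDerivAt (fun p : ℂ × ℂ => conj h.g.b * p.2 + conj h.g.a)
    (conj h.g.b • ContinuousLinearMap.snd ℂ ℂ ℂ) x.1 := (h2.const_mul _).add_const _
  refine HasFDerivAt.prodMk ?_ ?_
  · have := (((h2.const_mul (conj h.α)).const_sub h.α).add h1).mul
      ((hasDerivAt_inv hd).comp_hasFDerivAt x.1 hden)
    refine this.congr_fderiv ?_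
    refine ContinuousLinearMap.ext fun v => ?_
    simp only [SU11.den, add_apply, smul_apply, neg_apply,
      ContinuousLinearMap.coe_fst', ContinuousLinearMap.coe_snd', smul_eq_mul, Pi.add_apply,
      Function.comp_apply]
    field_simp
    ring
  · have := ((h2.const_mul h.g.a).add_const h.g.b).mul
      ((hasDerivAt_inv hd).comp_hasFDerivAt x.1 hden)
    refine this.congr_fderiv ?_
    refine ContinuousLinearMap.ext fun v => ?_
    simp only [SU11.den, add_apply, smul_apply, ContinuousLinearMap.coe_snd', smul_eq_mul,
      Function.comp_apply]
    generalize hdd : conj h.g.b * x.1.2 + conj h.g.a = d at hd ⊢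
    field_simp
    rw [← hdd]
    -- The numerator of the derivative of the Möbius map is |a|² - |b|² = 1.
    linear_combination v.2 * h.g.det_eq

/-- The complex derivative is triangular with diagonal den⁻¹, den⁻², and a real determinant is the
squared modulus of the complex one. -/
lemma det_jacobiActDeriv (h : JacobiGroup) (p : ℂ × ℂ) :
    ((jacobiActDeriv h p).restrictScalars ℝ).det = (‖h.g.den p.2‖ ^ 6)⁻¹ := by
  have h1 : LinearMap.det ((jacobiActDeriv h p : ℂ × ℂ →L[ℂ] ℂ × ℂ) : ℂ × ℂ →ₗ[ℂ] ℂ × ℂ)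
      = (h.g.den p.2 ^ 3)⁻¹ := by
    rw [← LinearMap.det_toMatrix (Module.Basis.finTwoProd ℂ), Matrix.det_fin_two]
    simp only [LinearMap.toMatrix_apply]
    simp [jacobiActDeriv]
    ring
  have h2 : ((jacobiActDeriv h p).restrictScalars ℝ).det = LinearMap.det
    (((jacobiActDeriv h p : ℂ × ℂ →L[ℂ] ℂ × ℂ) : ℂ × ℂ →ₗ[ℂ] ℂ × ℂ).restrictScalars ℝ) := rfl
  rw [h2, LinearMap.det_restrictScalars, h1, Algebra.norm_complex_apply,
    Complex.normSq_eq_norm_sq, norm_inv, norm_pow, inv_pow, ← pow_mul]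

lemma one_sub_normSq_smul (h : JacobiGroup) (x : JacobiDomain) :
    1 - ‖(h • x).w‖ ^ 2 = (1 - ‖x.w‖ ^ 2) / ‖h.g.den x.w‖ ^ 2 := by
  have h1 := h.g.normSq_den_sub x.w
  have h2 := norm_pos_iff.2 (h.g.den_ne x)
  rw [JacobiDomain.smul_w', norm_div, div_pow]
  change ‖h.g.den x.w‖ ^ 2 - _ = _ at h1
  field_simp
  linarith

/-! ### Invariance of the measure -/

/-- The density of the invariant measure. -/
def jacobiDensity (p : ℂ × ℂ) : ENNReal := ENNReal.ofReal (((1 - ‖p.2‖ ^ 2) ^ 3)⁻¹)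

lemma measurable_jacobiDensity : Measurable jacobiDensity := by
  unfold jacobiDensity
  fun_prop

lemma setLIntegral_jacobiMeasure {A : Set JacobiDomain} (hA : MeasurableSet A)
    {F : ℂ × ℂ → ENNReal} (hF : Measurable F) :
    ∫⁻ x in A, F x.1 ∂jacobiMeasure = ∫⁻ p in Subtype.val '' A, jacobiDensity p * F p := by
  have hm := measurable_jacobiDensity.comp measurableEmbedding_jacobiDomain.measurable
  unfold jacobiMeasure
  change ∫⁻ x in A, F x.1 ∂(jacobiLebesgue.withDensity (jacobiDensity ∘ Subtype.val)) = _
  have h0 := setLIntegral_withDensity_eq_setLIntegral_mul jacobiLebesgue hm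
    (hF.comp measurableEmbedding_jacobiDomain.measurable) hA
  refine h0.trans ?_
  unfold jacobiLebesgue
  rw [measurableEmbedding_jacobiDomain.restrict_comap]
  have h := measurableEmbedding_jacobiDomain.lintegral_map (μ := Measure.comap Subtype.val
    ((volume : Measure (ℂ × ℂ)).restrict (Subtype.val '' A))) fun p => jacobiDensity p * F p
  rw [measurableEmbedding_jacobiDomain.map_comap, Measure.restrict_restrict
    measurableEmbedding_jacobiDomain.measurableSet_range,
    Set.inter_eq_self_of_subset_right (Set.image_subset_range _ _)] at h
  exact h.symm

lemma lintegral_jacobiMeasure {F : ℂ × ℂ → ENNReal} (hF : Measurable F) :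
    ∫⁻ x, F x.1 ∂jacobiMeasure = ∫⁻ p in jacobiSet, jacobiDensity p * F p := by
  rw [← setLIntegral_univ, setLIntegral_jacobiMeasure MeasurableSet.univ hF, Set.image_univ]
  congr 2
  exact Subtype.range_coe

lemma jacobiMeasure_apply {A : Set JacobiDomain} (hA : MeasurableSet A) :
    jacobiMeasure A = ∫⁻ p in Subtype.val '' A, jacobiDensity p := by
  have := setLIntegral_jacobiMeasure hA (F := fun _ => 1) measurable_const
  simpa using this

/-- The Jacobian |den|⁻⁶ cancels the factor |den|⁶ that `one_sub_normSq_smul` produces in the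
density (1 - |w|²)⁻³. -/
lemma jacobiMeasure_smul_image (h : JacobiGroup) {A : Set JacobiDomain} (hA : MeasurableSet A)
    (hA' : MeasurableSet ((fun x => h • x) '' A)) :
    jacobiMeasure ((fun x => h • x) '' A) = jacobiMeasure A := by
  have hmeas : MeasurableSet (Subtype.val '' A : Set (ℂ × ℂ)) :=
    measurableEmbedding_jacobiDomain.measurableSet_image.2 hA
  have himg : (Subtype.val '' ((fun x : JacobiDomain => h • x) '' A) : Set (ℂ × ℂ)) =
      jacobiAct h '' (Subtype.val '' A) := by
    rw [Set.image_image, Set.image_image]; rfl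
  have : (volume : Measure (ℂ × ℂ)).IsAddHaarMeasure := Measure.prod.instIsAddHaarMeasure _ _
  rw [jacobiMeasure_apply hA, jacobiMeasure_apply hA', himg,
    lintegral_image_eq_lintegral_abs_det_fderiv_mul volume hmeas
      (f' := fun p => (jacobiActDeriv h p).restrictScalars ℝ)]
  · refine setLIntegral_congr_fun hmeas ?_
    rintro _ ⟨(x : JacobiDomain), -, rfl⟩
    have h1 := one_sub_normSq_smul h x
    have h2 := norm_pos_iff.2 (h.g.den_ne x)
    have h3 := x.one_sub_pos
    simp only [det_jacobiActDeriv, jacobiDensity]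
    rw [← ENNReal.ofReal_mul (abs_nonneg _)]
    congr 1
    change |(‖h.g.den x.w‖ ^ 6)⁻¹| * ((1 - ‖(h • x).w‖ ^ 2) ^ 3)⁻¹ = ((1 - ‖x.w‖ ^ 2) ^ 3)⁻¹
    rw [h1, abs_of_pos (by positivity)]
    field_simp
  · rintro _ ⟨(x : JacobiDomain), -, rfl⟩
    exact ((hasFDerivAt_jacobiAct h x).restrictScalars ℝ).hasFDerivWithinAt
  · rintro _ ⟨(x : JacobiDomain), -, rfl⟩ _ ⟨(y : JacobiDomain), -, rfl⟩ hxy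
    rw [jacobiAct_coe, jacobiAct_coe] at hxy
    rw [MulAction.injective h (Subtype.ext hxy)]

lemma measurePreserving_jacobi_smul (h : JacobiGroup) :
    MeasurePreserving (fun x : JacobiDomain => h • x) jacobiMeasure jacobiMeasure := by
  have hm (k : JacobiGroup) : Measurable fun x : JacobiDomain => k • x :=
    (continuous_smul_right k).measurable
  refine ⟨hm h, Measure.ext fun A hA => ?_⟩
  have hpre : (fun x : JacobiDomain => h • x) ⁻¹' A = (fun x => h⁻¹ • x) '' A := by
    ext x
    simp only [Set.mem_preimage, Set.mem_image]
    constructor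
    · intro hx
      exact ⟨_, hx, inv_smul_smul h x⟩
    · rintro ⟨y, hy, rfl⟩
      rwa [smul_inv_smul]
  rw [Measure.map_apply (hm h) hA, hpre, jacobiMeasure_smul_image _ hA]
  rw [← hpre]
  exact hm h hA

lemma measurableEmbedding_jacobi_smul (h : JacobiGroup) :
    MeasurableEmbedding (fun x : JacobiDomain => h • x) :=
  (MeasurableEquiv.mk (MulAction.toPerm h) (continuous_smul_right h).measurable
    (continuous_smul_right h⁻¹).measurable).measurableEmbedding

/-! ### The norm of the constant function -/

lemma lintegral_gaussian {b : ℝ} (hb : 0 < b) :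
    ∫⁻ x : ℝ, ENNReal.ofReal (Real.exp (-b * x ^ 2)) =
      ENNReal.ofReal (Real.sqrt (Real.pi / b)) := by
  rw [← integral_gaussian, ofReal_integral_eq_lintegral_ofReal (integrable_exp_neg_mul_sq hb)]
  exact Filter.Eventually.of_forall fun x => (Real.exp_pos _).le

lemma lintegral_gaussian_quadratic {p q r : ℝ} (hp : 0 < p) (hd : 0 < p * r - q ^ 2) :
    ∫⁻ z : ℂ, ENNReal.ofReal (Real.exp (-(p * z.re ^ 2 + 2 * q * z.re * z.im + r * z.im ^ 2))) =
      ENNReal.ofReal (Real.pi / Real.sqrt (p * r - q ^ 2)) := by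
  have h1 : ∫⁻ z : ℂ, ENNReal.ofReal
        (Real.exp (-(p * z.re ^ 2 + 2 * q * z.re * z.im + r * z.im ^ 2))) =
      ∫⁻ v : ℝ × ℝ, ENNReal.ofReal
        (Real.exp (-(p * v.1 ^ 2 + 2 * q * v.1 * v.2 + r * v.2 ^ 2))) :=
    Complex.volume_preserving_equiv_real_prod.lintegral_comp_emb
      Complex.measurableEquivRealProd.measurableEmbedding
      (fun v : ℝ × ℝ => ENNReal.ofReal
        (Real.exp (-(p * v.1 ^ 2 + 2 * q * v.1 * v.2 + r * v.2 ^ 2))))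
  rw [h1, Measure.volume_eq_prod, lintegral_prod_symm' _ (by fun_prop)]
  -- Completing the square in x by the translation -qy/p leaves the coefficient (pr - q²)/p of y².
  have h2 (y : ℝ) : ∫⁻ x : ℝ, ENNReal.ofReal
        (Real.exp (-(p * x ^ 2 + 2 * q * x * y + r * y ^ 2))) =
      ENNReal.ofReal (Real.sqrt (Real.pi / p)) *
        ENNReal.ofReal (Real.exp (-((p * r - q ^ 2) / p) * y ^ 2)) := by
    rw [← lintegral_gaussian hp, ← lintegral_mul_const _ (by fun_prop),
      ← lintegral_add_right_eq_self _ (-(q * y / p))]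
    refine lintegral_congr fun x => ?_
    rw [← ENNReal.ofReal_mul (Real.exp_pos _).le, ← Real.exp_add]
    congr 2
    field_simp
    ring
  simp_rw [h2]
  rw [lintegral_const_mul _ (by fun_prop), lintegral_gaussian (div_pos hd hp),
    ← ENNReal.ofReal_mul (Real.sqrt_nonneg _), ← Real.sqrt_mul (by positivity)]
  congr 1
  have hpi := Real.pi_pos
  rw [eq_div_iff (Real.sqrt_pos.2 hd).ne', ← Real.sqrt_mul (by positivity)]
  have h3 : Real.pi / p * (Real.pi / ((p * r - q ^ 2) / p)) * (p * r - q ^ 2) = Real.pi ^ 2 := by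
    have := hd.ne'
    field_simp
  rw [h3, Real.sqrt_sq hpi.le]

lemma lintegral_ball_radial {G : ℝ → ℝ} (hG : ∀ y ∈ Set.Ioo (0 : ℝ) 1, 0 ≤ G y)
    (hG0 : 0 ≤ G 0) (hint : IntegrableOn (fun y => y * G y) (Set.Ioo 0 1)) :
    ∫⁻ w in Metric.ball (0 : ℂ) 1, ENNReal.ofReal (G ‖w‖) =
      ENNReal.ofReal (2 * Real.pi * ∫ y in Set.Ioo (0 : ℝ) 1, y * G y) := by
  have hGn : ∀ w ∈ Metric.ball (0 : ℂ) 1, 0 ≤ G ‖w‖ := by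
    intro w hw
    rcases (norm_nonneg w).eq_or_lt with h | h
    · rwa [← h]
    · exact hG _ ⟨h, by simpa using hw⟩
  have hi : IntegrableOn (fun w : ℂ => G ‖w‖) (Metric.ball 0 1) := by
    rw [integrableOn_fun_norm_addHaar (μ := (volume : Measure ℂ))]
    simpa using hint
  rw [← ofReal_integral_eq_lintegral_ofReal hi
    ((ae_restrict_iff' Metric.isOpen_ball.measurableSet).2 (Filter.Eventually.of_forall hGn))]
  congr 1
  have h1 : ∀ w : ℂ, (Metric.ball (0 : ℂ) 1).indicator (fun w => G ‖w‖) w =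
      (Set.Iio (1 : ℝ)).indicator G ‖w‖ := by
    intro w
    by_cases hw : ‖w‖ < 1 <;> simp [Set.indicator, hw]
  rw [← integral_indicator Metric.isOpen_ball.measurableSet]
  simp_rw [h1]
  rw [integral_fun_norm_addHaar (volume : Measure ℂ)]
  have h2 : ∀ y : ℝ, y ^ (Module.finrank ℝ ℂ - 1) • (Set.Iio (1 : ℝ)).indicator G y =
      (Set.Iio (1 : ℝ)).indicator (fun y => y * G y) y := by
    intro y
    by_cases hy : y < 1 <;> simp [Set.indicator, hy]
  simp_rw [h2]
  rw [setIntegral_indicator measurableSet_Iio]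
  have h3 : Set.Ioi (0 : ℝ) ∩ Set.Iio 1 = Set.Ioo 0 1 := rfl
  rw [h3, Measure.real, Complex.volume_ball]
  simp
  ring

lemma integral_radial_weight {s : ℝ} (hs : 0 < s) :
    IntegrableOn (fun y : ℝ => y * (1 - y ^ 2) ^ (s - 1)) (Set.Ioo 0 1) ∧
      ∫ y in Set.Ioo (0 : ℝ) 1, y * (1 - y ^ 2) ^ (s - 1) = 1 / (2 * s) := by
  have hcont : ContinuousOn (fun y : ℝ => -((1 - y ^ 2) ^ s / (2 * s))) (Set.Icc 0 1) := by
    have : Continuous fun y : ℝ => (1 - y ^ 2) ^ s :=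
      Continuous.rpow_const (by fun_prop) fun _ => Or.inr hs.le
    exact (this.div_const _).neg.continuousOn
  have hder : ∀ y ∈ Set.Ioo (0 : ℝ) 1, HasDerivAt (fun y : ℝ => -((1 - y ^ 2) ^ s / (2 * s)))
      (y * (1 - y ^ 2) ^ (s - 1)) y := by
    intro y hy
    have hpos : 0 < 1 - y ^ 2 := by nlinarith [hy.1, hy.2]
    have h1 : HasDerivAt (fun y : ℝ => 1 - y ^ 2) (-(2 * y)) y := by
      simpa using (hasDerivAt_pow 2 y).const_sub 1
    have h2 := ((h1.rpow_const (p := s) (Or.inl hpos.ne')).div_const (2 * s)).neg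
    convert! h2 using 1
    field_simp
  have hnn : ∀ y ∈ Set.Ioo (0 : ℝ) 1, 0 ≤ y * (1 - y ^ 2) ^ (s - 1) := by
    intro y hy
    have hpos : 0 < 1 - y ^ 2 := by nlinarith [hy.1, hy.2]
    exact mul_nonneg hy.1.le (Real.rpow_nonneg hpos.le _)
  -- The exponent s - 1 may be negative (s = 1/2 when n = 2), so the integrand can blow up at 1. It
  -- is integrable because it is nonnegative and has an antiderivative continuous up to the
  -- endpoints.
  have hint := intervalIntegral.integrableOn_deriv_of_nonneg hcont hder hnn
  refine ⟨hint.mono_set Set.Ioo_subset_Ioc_self, ?_⟩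
  have h3 := intervalIntegral.integral_eq_sub_of_hasDerivAt_of_le zero_le_one hcont hder
    ((intervalIntegrable_iff_integrableOn_Ioc_of_le zero_le_one).2 hint)
  rw [intervalIntegral.integral_of_le zero_le_one, integral_Ioc_eq_integral_Ioo] at h3
  rw [h3]
  simp [Real.zero_rpow hs.ne']

/-- The weight as a function on `ℂ × ℂ`. -/
def jacobiWeightExt (n : ℕ) (p : ℂ × ℂ) : ℝ :=
  (1 - ‖p.2‖ ^ 2) ^ n * Real.exp (-(‖p.1‖ ^ 2 / (1 - ‖p.2‖ ^ 2))) *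
    Real.exp (-((p.1 ^ 2 * conj p.2 + conj p.1 ^ 2 * p.2).re / (2 * (1 - ‖p.2‖ ^ 2))))

lemma measurable_jacobiWeightExt (n : ℕ) : Measurable (jacobiWeightExt n) := by
  have := Complex.continuous_conj.measurable
  unfold jacobiWeightExt
  have h : Measurable fun p : ℂ × ℂ => (p.1 ^ 2 * conj p.2 + conj p.1 ^ 2 * p.2).re :=
    Complex.measurable_re.comp (((measurable_fst.pow_const 2).mul (this.comp measurable_snd)).add
      (((this.comp measurable_fst).pow_const 2).mul measurable_snd))
  fun_prop

/-- With D = 1 - |w|², the exponent is minus the quadratic form with diagonal (1 ± Re w)/D and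
off-diagonal entry Im w/D. Its determinant is 1/D, whence the factor √D. -/
lemma lintegral_jacobiWeightExt_fiber (n : ℕ) {w : ℂ} (hw : ‖w‖ < 1) :
    ∫⁻ z, ENNReal.ofReal (jacobiWeightExt n (z, w)) =
      ENNReal.ofReal ((1 - ‖w‖ ^ 2) ^ n * (Real.pi * Real.sqrt (1 - ‖w‖ ^ 2))) := by
  have hD : 0 < 1 - ‖w‖ ^ 2 := by nlinarith [norm_nonneg w]
  have hDw : ‖w‖ ^ 2 = w.re ^ 2 + w.im ^ 2 := by
    rw [← Complex.normSq_eq_norm_sq, Complex.normSq_apply]; ring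
  have hre : -1 < w.re := by nlinarith [sq_nonneg w.im, sq_nonneg (w.re + 1)]
  set D := 1 - ‖w‖ ^ 2 with hDdef
  have h1 : ∀ z : ℂ, ENNReal.ofReal (jacobiWeightExt n (z, w)) = ENNReal.ofReal (D ^ n) *
      ENNReal.ofReal (Real.exp (-((1 + w.re) / D * z.re ^ 2 + 2 * (w.im / D) * z.re * z.im
        + (1 - w.re) / D * z.im ^ 2))) := by
    intro z
    rw [← ENNReal.ofReal_mul (by positivity)]
    unfold jacobiWeightExt
    rw [mul_assoc, ← Real.exp_add]
    congr 3
    have hz : ‖z‖ ^ 2 = z.re ^ 2 + z.im ^ 2 := by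
      rw [← Complex.normSq_eq_norm_sq, Complex.normSq_apply]; ring
    simp only [← hDdef, hz]
    simp [pow_two]
    field_simp
    ring
  simp_rw [h1]
  have hdet : (1 + w.re) / D * ((1 - w.re) / D) - (w.im / D) ^ 2 = 1 / D := by
    field_simp
    rw [hDdef, hDw]
    ring
  rw [lintegral_const_mul _ (by fun_prop), lintegral_gaussian_quadratic
    (div_pos (by linarith) hD) (by rw [hdet]; positivity), hdet,
    ← ENNReal.ofReal_mul (by positivity)]
  congr 2
  rw [one_div, Real.sqrt_inv, div_inv_eq_mul]

lemma lintegral_jacobiWeight (n : ℕ) [hn : Fact (2 ≤ n)] :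
    ∫⁻ x, ENNReal.ofReal (jacobiWeight n x) ∂jacobiMeasure = ENNReal.ofReal (jacobiConst n)⁻¹ := by
  have hn2 : (2 : ℝ) ≤ n := by exact_mod_cast hn.out
  have hF : Measurable fun p => ENNReal.ofReal (jacobiWeightExt n p) :=
    (measurable_jacobiWeightExt n).ennreal_ofReal
  have h1 := lintegral_jacobiMeasure hF
  have h2 : jacobiSet = Set.univ ×ˢ Metric.ball (0 : ℂ) 1 := by
    ext p; simp [jacobiSet]
  change ∫⁻ x, ENNReal.ofReal (jacobiWeight n x) ∂jacobiMeasure = _ at h1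
  have hm : Measurable fun p => jacobiDensity p * ENNReal.ofReal (jacobiWeightExt n p) :=
    measurable_jacobiDensity.mul hF
  rw [h1, h2, Measure.volume_eq_prod, ← Measure.prod_restrict, Measure.restrict_univ,
    lintegral_prod_symm' _ hm]
  -- With D = 1 - |w|², the density D⁻³ times the fibre integral π D^(n + 1/2) is π D^(s - 1) for s
  -- = n - 3/2. Integration over the disc gives 2π²/(2n - 3) = 1/Λ.
  have hs : (0 : ℝ) < n - 3 / 2 := by linarith
  have h3 : ∀ w ∈ Metric.ball (0 : ℂ) 1, ∫⁻ z, jacobiDensity (z, w) *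
        ENNReal.ofReal (jacobiWeightExt n (z, w)) =
      ENNReal.ofReal (Real.pi * (1 - ‖w‖ ^ 2) ^ ((n - 3 / 2 : ℝ) - 1)) := by
    intro w hw
    have hw' : ‖w‖ < 1 := by simpa using hw
    have hD : 0 < 1 - ‖w‖ ^ 2 := by nlinarith [norm_nonneg w]
    change ∫⁻ z : ℂ, ENNReal.ofReal (((1 - ‖w‖ ^ 2) ^ 3)⁻¹) *
      ENNReal.ofReal (jacobiWeightExt n (z, w)) = _
    have hFw : Measurable fun z : ℂ => ENNReal.ofReal (jacobiWeightExt n (z, w)) :=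
      hF.comp (measurable_id.prodMk measurable_const)
    rw [lintegral_const_mul _ hFw,
      lintegral_jacobiWeightExt_fiber n hw', ← ENNReal.ofReal_mul (by positivity)]
    congr 1
    have h4 : (n - 3 / 2 : ℝ) - 1 = (n : ℝ) + 1 / 2 - (3 : ℕ) := by push_cast; ring
    rw [h4, Real.rpow_sub_natCast hD.ne', Real.rpow_add hD, Real.rpow_natCast, Real.sqrt_eq_rpow]
    field_simp
  rw [setLIntegral_congr_fun Metric.isOpen_ball.measurableSet h3]
  obtain ⟨hi, hv⟩ := integral_radial_weight hs
  have h5 : (fun y : ℝ => y * (Real.pi * (1 - y ^ 2) ^ ((n - 3 / 2 : ℝ) - 1))) =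
      fun y => Real.pi * (y * (1 - y ^ 2) ^ ((n - 3 / 2 : ℝ) - 1)) := by
    ext y; ring
  rw [lintegral_ball_radial (G := fun y => Real.pi * (1 - y ^ 2) ^ ((n - 3 / 2 : ℝ) - 1)), h5,
    integral_const_mul, hv]
  · congr 1
    unfold jacobiConst
    have : (2 * (n : ℝ) - 3) ≠ 0 := by linarith
    have h6 : 2 * ((n : ℝ) - 3 / 2) = 2 * n - 3 := by ring
    rw [h6]
    field_simp
  · intro y hy
    have hpos : 0 < 1 - y ^ 2 := by nlinarith [hy.1, hy.2]
    positivity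
  · simp [Real.pi_pos.le]
  · rw [h5]
    exact hi.const_mul _

lemma integrable_jacobiWeight (n : ℕ) [Fact (2 ≤ n)] :
    Integrable (jacobiWeight n) jacobiMeasure := by
  refine ⟨(jacobiWeight_continuous n).aestronglyMeasurable, ?_⟩
  rw [hasFiniteIntegral_iff_ofReal (Filter.Eventually.of_forall fun x => (jacobiWeight_pos n x).le),
    lintegral_jacobiWeight]
  exact ENNReal.ofReal_lt_top

lemma integral_jacobiWeight (n : ℕ) [Fact (2 ≤ n)] :
    ∫ x, jacobiWeight n x ∂jacobiMeasure = (jacobiConst n)⁻¹ := by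
  rw [integral_eq_lintegral_of_nonneg_ae
    (Filter.Eventually.of_forall fun x => (jacobiWeight_pos n x).le)
    (jacobiWeight_continuous n).aestronglyMeasurable, lintegral_jacobiWeight,
    ENNReal.toReal_ofReal (inv_nonneg.2 (jacobiConst_pos n).le)]

/-! ### The action on holomorphic functions -/

/-- The multiplier as a function on `ℂ × ℂ`. -/
def jacobiMultiplierExt (n : ℕ) (h : JacobiGroup) (p : ℂ × ℂ) : ℂ :=
  ((conj h.g.b * p.2 + conj h.g.a) ^ n)⁻¹ *
    Complex.exp (-(conj h.g.b * (p.1 + h.α - conj h.α * p.2) ^ 2 /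
      (2 * (conj h.g.b * p.2 + conj h.g.a))) - h.α * conj h.α / 2
    - conj h.α * p.1 + p.2 * conj h.α ^ 2 / 2 + Complex.I * h.t)

lemma jacobiMultiplierExt_coe (n : ℕ) (h : JacobiGroup) (x : JacobiDomain) :
    jacobiMultiplierExt n h x.1 = jacobiMultiplier n h x :=
  (jacobiMultiplier_eq n h x).symm

lemma differentiableAt_jacobiMultiplierExt (n : ℕ) (h : JacobiGroup) (x : JacobiDomain) :
    DifferentiableAt ℂ (jacobiMultiplierExt n h) x.1 := by
  have hd : conj h.g.b * x.1.2 + conj h.g.a ≠ 0 := h.g.den_ne_zero x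
  unfold jacobiMultiplierExt
  have h1 : DifferentiableAt ℂ (fun p : ℂ × ℂ => conj h.g.b * p.2 + conj h.g.a) x.1 := by fun_prop
  have h2 : DifferentiableAt ℂ (fun p : ℂ × ℂ => ((conj h.g.b * p.2 + conj h.g.a) ^ n)⁻¹) x.1 :=
    (h1.pow n).inv (pow_ne_zero n hd)
  have h3 : DifferentiableAt ℂ (fun p : ℂ × ℂ => conj h.g.b * (p.1 + h.α - conj h.α * p.2) ^ 2 /
      (2 * (conj h.g.b * p.2 + conj h.g.a))) x.1 := by
    refine DifferentiableAt.mul (by fun_prop) (DifferentiableAt.inv (by fun_prop) ?_)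
    exact mul_ne_zero two_ne_zero hd
  fun_prop

lemma JacobiHolomorphic.comp_smul {f : JacobiDomain → ℂ} (hf : JacobiHolomorphic f) (n : ℕ)
    (h : JacobiGroup) : JacobiHolomorphic fun x => jacobiMultiplier n h x * f (h • x) := by
  obtain ⟨F, hF, hFf⟩ := hf
  refine ⟨fun p => jacobiMultiplierExt n h p * F (jacobiAct h p), fun p hp => ?_, fun x => ?_⟩
  · have h1 := differentiableAt_jacobiMultiplierExt n h ⟨p, hp⟩
    have h2 := (hasFDerivAt_jacobiAct h ⟨p, hp⟩).differentiableAt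
    have h3 : DifferentiableAt ℂ F (jacobiAct h p) :=
      (hF _ (h • (⟨p, hp⟩ : JacobiDomain)).2).differentiableAt
        (isOpen_jacobiSet.mem_nhds (h • (⟨p, hp⟩ : JacobiDomain)).2)
    exact (h1.mul (h3.comp p h2)).differentiableWithinAt
  · simp only [jacobiMultiplierExt_coe, jacobiAct_coe, hFf]

/-- Together with the invariance of the measure, this makes the translations isometric. -/
lemma normSq_comp_smul_mul_weight (n : ℕ) (h : JacobiGroup) (f : JacobiDomain → ℂ)
    (x : JacobiDomain) : ‖jacobiMultiplier n h x * f (h • x)‖ ^ 2 * jacobiWeight n x =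
      ‖f (h • x)‖ ^ 2 * jacobiWeight n (h • x) := by
  rw [jacobiWeight_smul, norm_mul]; ring

/-- The operator `f ↦ λ(h, ·) f(h · )` on the Fock space. -/
def fockTranslate (n : ℕ) (h : JacobiGroup) (f : FockSpace n) : FockSpace n :=
  (⟨fun x => jacobiMultiplier n h x * f (h • x), f.mem.1.comp_smul n h, by
    have h1 := ((measurePreserving_jacobi_smul h).integrable_comp_emb
      (measurableEmbedding_jacobi_smul h)).2
      f.mem.2
    refine h1.congr (Filter.Eventually.of_forall fun x => ?_)
    exact (normSq_comp_smul_mul_weight n h f x).symm⟩ : fockSubmodule n)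

lemma fockTranslate_apply (n : ℕ) (h : JacobiGroup) (f : FockSpace n) (x : JacobiDomain) :
    fockTranslate n h f x = jacobiMultiplier n h x * f (h • x) := rfl

/-- The order is reversed, which is why the representation translates by h⁻¹. -/
lemma fockTranslate_mul (n : ℕ) (h k : JacobiGroup) (f : FockSpace n) :
    fockTranslate n (h * k) f = fockTranslate n k (fockTranslate n h f) := by
  refine DFunLike.ext _ _ fun x => ?_
  simp only [fockTranslate_apply, jacobiMultiplier_mul, mul_smul]
  ring

lemma fockTranslate_one (n : ℕ) (f : FockSpace n) : fockTranslate n 1 f = f := by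
  refine DFunLike.ext _ _ fun x => ?_
  simp only [fockTranslate_apply, jacobiMultiplier_one, one_smul, one_mul]

lemma fock_inner_def (n : ℕ) [Fact (2 ≤ n)] (f g : FockSpace n) : ⟪f, g⟫_ℂ = fockInner n f g := rfl

lemma fock_norm_sq (n : ℕ) [Fact (2 ≤ n)] (f : FockSpace n) :
    ‖f‖ ^ 2 = jacobiConst n * ∫ x, ‖f x‖ ^ 2 * jacobiWeight n x ∂jacobiMeasure := by
  have h : ((‖f‖ ^ 2 : ℝ) : ℂ) = ⟪f, f⟫_ℂ := by
    rw [inner_self_eq_norm_sq_to_K]; push_cast; rfl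
  rw [fock_inner_def, fockInner_self] at h
  exact Complex.ofReal_injective h

lemma norm_fockTranslate (n : ℕ) [Fact (2 ≤ n)] (h : JacobiGroup) (f : FockSpace n) :
    ‖fockTranslate n h f‖ = ‖f‖ := by
  rw [← sq_eq_sq₀ (norm_nonneg _) (norm_nonneg _), fock_norm_sq, fock_norm_sq,
    ← (measurePreserving_jacobi_smul h).integral_comp (measurableEmbedding_jacobi_smul h)
      fun x => ‖f x‖ ^ 2 * jacobiWeight n x]
  congr 2
  ext x
  rw [fockTranslate_apply, normSq_comp_smul_mul_weight]

/-- The unitary representation of the Jacobi group on the Fock space. -/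
def fockRep (n : ℕ) [Fact (2 ≤ n)] : JacobiGroup →* (FockSpace n ≃ₗᵢ[ℂ] FockSpace n) where
  toFun h :=
    { toFun := fockTranslate n h⁻¹
      invFun := fockTranslate n h
      map_add' := fun f g => DFunLike.ext _ _ fun x => by
        simp only [fockTranslate_apply, FockSpace.add_apply]; ring
      map_smul' := fun c f => DFunLike.ext _ _ fun x => by
        simp only [fockTranslate_apply, FockSpace.smul_apply, RingHom.id_apply]; ring
      left_inv := fun f => by
        rw [← fockTranslate_mul, inv_mul_cancel, fockTranslate_one]
      right_inv := fun f => by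
        rw [← fockTranslate_mul, mul_inv_cancel, fockTranslate_one]
      norm_map' := norm_fockTranslate n h⁻¹ }
  map_one' := LinearIsometryEquiv.ext fun f => by
    change fockTranslate n 1⁻¹ f = f
    rw [inv_one, fockTranslate_one]
  map_mul' h k := LinearIsometryEquiv.ext fun f => by
    change fockTranslate n (h * k)⁻¹ f = fockTranslate n h⁻¹ (fockTranslate n k⁻¹ f)
    rw [mul_inv_rev, fockTranslate_mul]

lemma fockRep_apply (n : ℕ) [Fact (2 ≤ n)] (h : JacobiGroup) (f : FockSpace n) (x : JacobiDomain) :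
    fockRep n h f x = jacobiMultiplier n h⁻¹ x * f (h⁻¹ • x) := rfl

lemma fock_inner_rep_left (n : ℕ) [Fact (2 ≤ n)] (h : JacobiGroup) (f g : FockSpace n) :
    ⟪fockRep n h f, g⟫_ℂ = ⟪f, fockRep n h⁻¹ g⟫_ℂ := by
  have h1 : fockRep n h (fockRep n h⁻¹ g) = g := by
    change (fockRep n h * fockRep n h⁻¹) g = g
    rw [← map_mul, mul_inv_cancel, map_one]
    rfl
  rw [← (fockRep n h).inner_map_map f, h1]

/-! ### The reproducing property -/

/-- The constant function `1`. -/
def fockOne (n : ℕ) [Fact (2 ≤ n)] : FockSpace n :=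
  (⟨fun _ => 1, ⟨fun _ => 1, differentiableOn_const 1, fun _ => rfl⟩, by
    simpa [FockIntegrable] using integrable_jacobiWeight n⟩ : fockSubmodule n)

lemma fockOne_apply (n : ℕ) [Fact (2 ≤ n)] (x : JacobiDomain) : fockOne n x = 1 := rfl

lemma rotationFlow_smul (θ : ℝ) (x : JacobiDomain) : (rotationFlow θ • x).1 =
    (Complex.exp (θ * Complex.I) * x.z, Complex.exp (θ * Complex.I) ^ 2 * x.w) := by
  have h1 : conj (Complex.exp (θ * Complex.I)) = (Complex.exp (θ * Complex.I))⁻¹ := by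
    rw [← Complex.exp_conj, ← Complex.exp_neg]; simp
  have ha : (rotationFlow θ).g.a = Complex.exp (θ * Complex.I) := rfl
  have hb : (rotationFlow θ).g.b = 0 := rfl
  have hα : (rotationFlow θ).α = 0 := rfl
  have h2 := Complex.exp_ne_zero (θ * Complex.I)
  refine Prod.ext ?_ ?_
  · change (rotationFlow θ • x).z = _
    rw [JacobiDomain.smul_z, ha, hb, hα, h1]
    simp
    ring
  · change (rotationFlow θ • x).w = _
    rw [JacobiDomain.smul_w, ha, hb, h1]
    simp
    ring

lemma jacobiMultiplier_rotationFlow (n : ℕ) (θ : ℝ) (x : JacobiDomain) :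
    jacobiMultiplier n (rotationFlow θ) x = Complex.exp (θ * Complex.I) ^ n := by
  have h1 : conj (Complex.exp (θ * Complex.I)) = (Complex.exp (θ * Complex.I))⁻¹ := by
    rw [← Complex.exp_conj, ← Complex.exp_neg]; simp
  have ha : (rotationFlow θ).g.a = Complex.exp (θ * Complex.I) := rfl
  have hb : (rotationFlow θ).g.b = 0 := rfl
  have hα : (rotationFlow θ).α = 0 := rfl
  have ht : (rotationFlow θ).t = 0 := rfl
  rw [jacobiMultiplier_eq]
  simp [jacobiExponent, SU11.den, ha, hb, hα, ht, h1]

lemma jacobiWeight_rotationFlow (n : ℕ) (θ : ℝ) (x : JacobiDomain) :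
    jacobiWeight n (rotationFlow θ • x) = jacobiWeight n x := by
  rw [jacobiWeight_smul, jacobiMultiplier_rotationFlow, norm_pow, Complex.norm_exp_ofReal_mul_I]
  simp

/-- The mean value property along the orbits of the rotations. -/
lemma JacobiHolomorphic.circleAverage_rotation {f : JacobiDomain → ℂ} (hf : JacobiHolomorphic f)
    (x : JacobiDomain) :
    ∫ θ in (0 : ℝ)..2 * Real.pi, f (rotationFlow θ • x) =
      2 * Real.pi * f JacobiDomain.origin := by
  obtain ⟨F, hF, hFf⟩ := hf
  -- The orbit of x under the rotations bounds the disc ζ ↦ (ζz, ζ²w), |ζ| ≤ 1, inside the domain,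
  -- with the base point at its centre ζ = 0.
  set φ : ℂ → ℂ := fun ζ => F (ζ * x.z, ζ ^ 2 * x.w) with hφ
  have hmem : ∀ ζ ∈ Metric.closedBall (0 : ℂ) 1, (ζ * x.z, ζ ^ 2 * x.w) ∈ jacobiSet := by
    intro ζ hζ
    have h1 : ‖ζ‖ ≤ 1 := by simpa using hζ
    change ‖ζ ^ 2 * x.w‖ < 1
    rw [norm_mul, norm_pow]
    have h2 : ‖ζ‖ ^ 2 ≤ 1 := pow_le_one₀ (norm_nonneg _) h1
    nlinarith [x.norm_w_lt, norm_nonneg x.w]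
  have hd : ∀ ζ ∈ Metric.closedBall (0 : ℂ) 1, DifferentiableAt ℂ φ ζ := by
    intro ζ hζ
    have h1 : DifferentiableAt ℂ F (ζ * x.z, ζ ^ 2 * x.w) :=
      (hF _ (hmem ζ hζ)).differentiableAt (isOpen_jacobiSet.mem_nhds (hmem ζ hζ))
    exact h1.comp ζ (by fun_prop)
  have h2 : Real.circleAverage φ 0 1 = φ 0 := by
    refine circleAverage_of_differentiable_on_off_countable Set.countable_empty ?_ ?_
    · rw [abs_one]
      exact fun ζ hζ => (hd ζ hζ).continuousAt.continuousWithinAt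
    · rw [abs_one]
      exact fun ζ hζ => hd ζ (Metric.ball_subset_closedBall hζ.1)
  have h3 : φ 0 = f JacobiDomain.origin := by
    rw [← hFf]
    simp [hφ, JacobiDomain.origin]
  have h4 : ∀ θ : ℝ, f (rotationFlow θ • x) = φ (circleMap 0 1 θ) := by
    intro θ
    rw [← hFf, rotationFlow_smul]
    simp [hφ, circleMap]
  simp_rw [h4]
  rw [Real.circleAverage_def, h3] at h2
  rw [← h2]
  have hpi := Real.pi_ne_zero
  simp only [Complex.real_smul, Complex.ofReal_inv, Complex.ofReal_mul, Complex.ofReal_ofNat]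
  field_simp

instance : SFinite jacobiMeasure := by
  have : SigmaFinite jacobiLebesgue := by
    refine SigmaFinite.of_map _ measurableEmbedding_jacobiDomain.measurable.aemeasurable ?_
    unfold jacobiLebesgue
    rw [measurableEmbedding_jacobiDomain.map_comap]
    infer_instance
  unfold jacobiMeasure
  infer_instance

lemma continuous_rotationFlow_smul :
    Continuous fun p : ℝ × JacobiDomain => rotationFlow p.1 • p.2 := by
  rw [continuous_induced_rng]
  have hz := JacobiDomain.continuous_z
  have hw := JacobiDomain.continuous_w
  have : (Subtype.val ∘ fun p : ℝ × JacobiDomain => rotationFlow p.1 • p.2) = fun p =>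
      (Complex.exp (p.1 * Complex.I) * p.2.z, Complex.exp (p.1 * Complex.I) ^ 2 * p.2.w) :=
    funext fun p => rotationFlow_smul p.1 p.2
  rw [this]
  fun_prop

/-- Measure and weight are rotation invariant, so f may be replaced by its average over rotations,
which is the constant f(0, 0). -/
lemma integral_mul_jacobiWeight (n : ℕ) [Fact (2 ≤ n)] (f : FockSpace n) :
    ∫ x, f x * jacobiWeight n x ∂jacobiMeasure = f JacobiDomain.origin * (jacobiConst n)⁻¹ := by
  have hg : Integrable (fun x => f x * jacobiWeight n x) jacobiMeasure := by
    simpa [fockOne_apply] using fockIntegrable_mul n (fockOne n) f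
  have hfc := f.mem.1.continuous
  have hwc := jacobiWeight_continuous n
  have hrot : ∀ θ : ℝ, ∀ x, f (rotationFlow θ • x) * (jacobiWeight n x : ℂ) =
      f (rotationFlow θ • x) * jacobiWeight n (rotationFlow θ • x) := by
    intro θ x
    rw [jacobiWeight_rotationFlow]
  have h1 : ∀ θ : ℝ, ∫ x, f (rotationFlow θ • x) * jacobiWeight n x ∂jacobiMeasure =
      ∫ x, f x * jacobiWeight n x ∂jacobiMeasure := by
    intro θ
    simp_rw [hrot]
    exact (measurePreserving_jacobi_smul (rotationFlow θ)).integral_comp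
      (measurableEmbedding_jacobi_smul _)
      fun x => f x * (jacobiWeight n x : ℂ)
  have h1n : ∀ θ : ℝ, ∫ x, ‖f (rotationFlow θ • x) * jacobiWeight n x‖ ∂jacobiMeasure =
      ∫ x, ‖f x * jacobiWeight n x‖ ∂jacobiMeasure := by
    intro θ
    simp_rw [hrot]
    exact (measurePreserving_jacobi_smul (rotationFlow θ)).integral_comp
      (measurableEmbedding_jacobi_smul _)
      fun x => ‖f x * (jacobiWeight n x : ℂ)‖
  -- Fubini applies because every rotated slice has the same L¹ norm and θ runs over a bounded
  -- interval.
  have hint : Integrable (Function.uncurry fun (θ : ℝ) (x : JacobiDomain) =>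
      f (rotationFlow θ • x) * (jacobiWeight n x : ℂ))
      ((volume.restrict (Set.Ioc 0 (2 * Real.pi))).prod jacobiMeasure) := by
    have hsm : Continuous (Function.uncurry fun (θ : ℝ) (x : JacobiDomain) =>
        f (rotationFlow θ • x) * (jacobiWeight n x : ℂ)) :=
      (hfc.comp continuous_rotationFlow_smul).mul
        (Complex.continuous_ofReal.comp (hwc.comp continuous_snd))
    rw [integrable_prod_iff hsm.aestronglyMeasurable]
    refine ⟨Filter.Eventually.of_forall fun θ => ?_, ?_⟩
    · have h5 := ((measurePreserving_jacobi_smul (rotationFlow θ)).integrable_comp_emb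
        (measurableEmbedding_jacobi_smul (rotationFlow θ))
        (g := fun x => f x * (jacobiWeight n x : ℂ))).2 hg
      exact h5.congr (Filter.Eventually.of_forall fun x => (hrot θ x).symm)
    · exact (integrable_const (∫ x, ‖f x * (jacobiWeight n x : ℂ)‖ ∂jacobiMeasure)).congr
        (Filter.Eventually.of_forall fun θ => (h1n θ).symm)
  have h2 := integral_integral_swap hint
  simp_rw [h1] at h2
  have h3 : ∀ x, ∫ θ in Set.Ioc 0 (2 * Real.pi), f (rotationFlow θ • x) * (jacobiWeight n x : ℂ) =
      2 * Real.pi * f JacobiDomain.origin * jacobiWeight n x := by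
    intro x
    rw [integral_mul_const, ← f.mem.1.circleAverage_rotation x,
      intervalIntegral.integral_of_le Real.two_pi_pos.le]
  simp_rw [h3] at h2
  rw [integral_const_mul, integral_complex_ofReal, integral_jacobiWeight] at h2
  simp only [integral_const, MeasurableSet.univ, measureReal_restrict_apply, Set.univ_inter,
    Real.volume_real_Ioc_of_le Real.two_pi_pos.le, sub_zero, Complex.real_smul] at h2
  have hpi : (2 * Real.pi : ℂ) ≠ 0 := by exact_mod_cast Real.two_pi_pos.ne'
  push_cast at h2 ⊢
  rw [mul_assoc (2 * Real.pi : ℂ)] at h2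
  exact mul_left_cancel₀ hpi h2

lemma fockOne_inner (n : ℕ) [Fact (2 ≤ n)] (f : FockSpace n) :
    ⟪fockOne n, f⟫_ℂ = f JacobiDomain.origin := by
  rw [fock_inner_def, fockInner]
  simp only [fockOne_apply, map_one, one_mul]
  rw [integral_mul_jacobiWeight]
  have : (jacobiConst n : ℂ) ≠ 0 := by exact_mod_cast (jacobiConst_pos n).ne'
  push_cast
  field_simp

/-- Unitarity of the translation by h moves the reproducing property of the constant 1 from the base
point to h·0; the scalar compensates for the multiplier. -/
lemma exists_fockKernel (n : ℕ) [Fact (2 ≤ n)] (y : JacobiDomain) :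
    ∃ k : FockSpace n, (∀ x, k x = jacobiKernel n x y) ∧ ∀ f : FockSpace n, ⟪k, f⟫_ℂ = f y := by
  obtain ⟨h, rfl⟩ := exists_smul_origin y
  have h0 := jacobiMultiplier_ne_zero n h JacobiDomain.origin
  have h0' : conj (jacobiMultiplier n h JacobiDomain.origin) ≠ 0 := (map_ne_zero _).2 h0
  refine ⟨(conj (jacobiMultiplier n h JacobiDomain.origin))⁻¹ • fockRep n h (fockOne n),
    fun x => ?_, fun f => ?_⟩
  · rw [FockSpace.smul_apply, fockRep_apply, fockOne_apply, mul_one, ← jacobiKernel_smul_origin]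
    field_simp
  · rw [inner_smul_left, fock_inner_rep_left, fockOne_inner, fockRep_apply, inv_inv, map_inv₀,
      Complex.conj_conj, inv_mul_cancel_left₀ h0]

/-- The reproducing kernel at `y`. -/
def fockKernel (n : ℕ) [Fact (2 ≤ n)] (y : JacobiDomain) : FockSpace n :=
  (exists_fockKernel n y).choose

lemma fockKernel_apply (n : ℕ) [Fact (2 ≤ n)] (x y : JacobiDomain) :
    fockKernel n y x = jacobiKernel n x y := (exists_fockKernel n y).choose_spec.1 x

lemma fockKernel_inner (n : ℕ) [Fact (2 ≤ n)] (y : JacobiDomain) (f : FockSpace n) :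
    ⟪fockKernel n y, f⟫_ℂ = f y := (exists_fockKernel n y).choose_spec.2 f

lemma norm_fockKernel_sq (n : ℕ) [Fact (2 ≤ n)] (y : JacobiDomain) :
    ‖fockKernel n y‖ ^ 2 = (jacobiWeight n y)⁻¹ := by
  have h : ((‖fockKernel n y‖ ^ 2 : ℝ) : ℂ) = ⟪fockKernel n y, fockKernel n y⟫_ℂ := by
    rw [inner_self_eq_norm_sq_to_K]; push_cast; rfl
  rw [fockKernel_inner, fockKernel_apply, jacobiKernel_self] at h
  exact Complex.ofReal_injective h

/-- The constant is K(y, y)^(1/2), locally bounded in y, so norm convergence implies locally uniform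
convergence. -/
lemma fock_norm_apply_le (n : ℕ) [Fact (2 ≤ n)] (f : FockSpace n) (y : JacobiDomain) :
    ‖f y‖ ≤ ‖fockKernel n y‖ * ‖f‖ := by
  rw [← fockKernel_inner]
  exact norm_inner_le_norm _ _

lemma posSemidef_jacobiKernel (n : ℕ) [Fact (2 ≤ n)] (m : ℕ) (x : Fin m → JacobiDomain) :
    (Matrix.of fun i j => jacobiKernel n (x i) (x j)).PosSemidef := by
  have h : (Matrix.of fun i j => jacobiKernel n (x i) (x j)) =
      Matrix.gram ℂ fun i => fockKernel n (x i) := by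
    ext i j
    rw [Matrix.gram_apply, fockKernel_inner, fockKernel_apply, Matrix.of_apply]
  rw [h]
  exact Matrix.posSemidef_gram ℂ _

/-! ### Locally uniform limits of holomorphic functions -/

-- Cauchy's estimate in one variable, on the disc of radius r/‖v‖ in each complex line x + ℂv.
open Filter Topology in
lemma norm_fderiv_le_of_forall_mem_closedBall {E : Type*} [NormedAddCommGroup E] [NormedSpace ℂ E]
    {F : E → ℂ} {x : E} {r C : ℝ} (hr : 0 < r)
    (hF : ∀ y ∈ Metric.closedBall x r, DifferentiableAt ℂ F y)
    (hC : ∀ y ∈ Metric.closedBall x r, ‖F y‖ ≤ C) : ‖fderiv ℂ F x‖ ≤ C / r := by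
  have hC0 : 0 ≤ C := (norm_nonneg _).trans (hC x (Metric.mem_closedBall_self hr.le))
  refine ContinuousLinearMap.opNorm_le_bound _ (by positivity) fun v => ?_
  rcases eq_or_ne v 0 with rfl | hv
  · simp
  have hv' := norm_pos_iff.2 hv
  have hmem : ∀ t ∈ Metric.closedBall (0 : ℂ) (r / ‖v‖), x + t • v ∈ Metric.closedBall x r := by
    intro t ht
    have h1 : ‖t‖ ≤ r / ‖v‖ := by simpa using ht
    rw [mem_closedBall_iff_norm, add_sub_cancel_left, norm_smul]
    exact (le_div_iff₀ hv').1 h1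
  have hd : ∀ t ∈ Metric.closedBall (0 : ℂ) (r / ‖v‖),
      DifferentiableAt ℂ (fun t : ℂ => F (x + t • v)) t := by
    intro t ht
    exact (hF _ (hmem t ht)).comp t (by fun_prop)
  have h1 : deriv (fun t : ℂ => F (x + t • v)) 0 = fderiv ℂ F x v := by
    have h2 : HasFDerivAt F (fderiv ℂ F x) (x + (0 : ℂ) • v) := by
      simpa using (hF x (Metric.mem_closedBall_self hr.le)).hasFDerivAt
    have h3 : HasDerivAt (fun t : ℂ => x + t • v) v 0 := by
      simpa using ((hasDerivAt_id (0 : ℂ)).smul_const v).const_add x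
    exact (h2.comp_hasDerivAt 0 h3).deriv
  rw [← h1]
  have h4 := Complex.norm_deriv_le_of_forall_mem_sphere_norm_le (f := fun t : ℂ => F (x + t • v))
    (c := 0) (R := r / ‖v‖) (C := C) (by positivity)
    (DifferentiableOn.diffContOnCl_ball (U := Metric.closedBall 0 (r / ‖v‖))
      (fun t ht => (hd t ht).differentiableWithinAt) subset_rfl)
    fun t ht => hC _ (hmem t (Metric.sphere_subset_closedBall ht))
  refine h4.trans_eq ?_
  field_simp

-- Weierstrass' theorem in a complex normed space: by Cauchy's estimate the derivatives are
-- uniformly Cauchy on a smaller ball, and a uniform limit of derivatives is the derivative of the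
-- limit.
open Filter Topology in
lemma differentiableAt_of_tendstoUniformlyOn_ball {E : Type*} [NormedAddCommGroup E]
    [NormedSpace ℂ E] {u : ℕ → E → ℂ} {g : E → ℂ} {x : E} {r : ℝ} (hr : 0 < r)
    (hu : ∀ n, ∀ y ∈ Metric.ball x r, DifferentiableAt ℂ (u n) y)
    (h : TendstoUniformlyOn u g atTop (Metric.ball x r)) : DifferentiableAt ℂ g x := by
  have hsub : ∀ y ∈ Metric.ball x (r / 2), Metric.closedBall y (r / 4) ⊆ Metric.ball x r := by
    intro y hy z hz
    rw [Metric.mem_ball] at hy ⊢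
    rw [Metric.mem_closedBall] at hz
    have := dist_triangle z y x
    linarith
  have hc : UniformCauchySeqOn (fun n => fderiv ℂ (u n)) atTop (Metric.ball x (r / 2)) := by
    rw [Metric.uniformCauchySeqOn_iff]
    intro ε hε
    -- Balls of radius r/4 about points of the half ball stay in the ball, so Cauchy's estimate
    -- yields (ε r/8)/(r/4) = ε/2.
    obtain ⟨N, hN⟩ := Metric.uniformCauchySeqOn_iff.1 h.uniformCauchySeqOn (ε * (r / 8))
      (by positivity)
    refine ⟨N, fun m hm n hn y hy => ?_⟩
    have hy' : y ∈ Metric.ball x r := hsub y hy (Metric.mem_closedBall_self (by positivity))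
    rw [dist_eq_norm, ← fderiv_sub (hu m y hy') (hu n y hy')]
    have h1 := norm_fderiv_le_of_forall_mem_closedBall (F := u m - u n) (x := y) (r := r / 4)
      (C := ε * (r / 8)) (by positivity)
      (fun z hz => (hu m z (hsub y hy hz)).sub (hu n z (hsub y hy hz)))
      (fun z hz => by
        have := hN m hm n hn z (hsub y hy hz)
        rw [dist_eq_norm] at this
        exact this.le)
    refine h1.trans_lt ?_
    rw [div_lt_iff₀ (by positivity)]
    nlinarith
  have hlim : ∀ y ∈ Metric.ball x (r / 2), ∃ L, Tendsto (fun n => fderiv ℂ (u n) y) atTop (𝓝 L) :=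
    fun y hy => cauchySeq_tendsto_of_complete (hc.cauchySeq hy)
  choose! L hL using hlim
  have hunif : TendstoUniformlyOn (fun n => fderiv ℂ (u n)) L atTop (Metric.ball x (r / 2)) :=
    hc.tendstoUniformlyOn_of_tendsto fun y hy => hL y hy
  refine (hasFDerivAt_of_tendstoUniformlyOn Metric.isOpen_ball hunif
    (fun n y hy => (hu n y (Metric.ball_subset_ball (by linarith) hy)).hasFDerivAt)
    (fun y hy => h.tendsto_at (Metric.ball_subset_ball (by linarith) hy))
    (Metric.mem_ball_self (by positivity))).differentiableAt

/-- Extension by zero of a function on the domain. -/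
def jacobiExtend (f : JacobiDomain → ℂ) (p : ℂ × ℂ) : ℂ :=
  open Classical in if hp : ‖p.2‖ < 1 then f ⟨p, hp⟩ else 0

lemma jacobiExtend_coe (f : JacobiDomain → ℂ) (x : JacobiDomain) : jacobiExtend f x.1 = f x :=
  dif_pos x.2

lemma JacobiHolomorphic.differentiableAt_extend {f : JacobiDomain → ℂ} (hf : JacobiHolomorphic f)
    (x : JacobiDomain) : DifferentiableAt ℂ (jacobiExtend f) x.1 := by
  obtain ⟨F, hF, hFf⟩ := hf
  have h1 : DifferentiableAt ℂ F x.1 := (hF _ x.2).differentiableAt (isOpen_jacobiSet.mem_nhds x.2)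
  refine h1.congr_of_eventuallyEq ?_
  filter_upwards [isOpen_jacobiSet.mem_nhds x.2] with p hp
  rw [hFf ⟨p, hp⟩, ← jacobiExtend_coe f ⟨p, hp⟩]

lemma JacobiHolomorphic.of_differentiableAt_extend {f : JacobiDomain → ℂ}
    (hf : ∀ x : JacobiDomain, DifferentiableAt ℂ (jacobiExtend f) x.1) : JacobiHolomorphic f :=
  ⟨jacobiExtend f, fun p hp => (hf ⟨p, hp⟩).differentiableWithinAt, jacobiExtend_coe f⟩

/-! ### Completeness of the Fock space -/

open Filter Topology in
/-- Fatou's lemma for the weighted square norm. -/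
lemma fock_fatou (n : ℕ) [Fact (2 ≤ n)] {u : ℕ → FockSpace n} {g : JacobiDomain → ℂ}
    (hg : JacobiHolomorphic g) (hlim : ∀ x, Tendsto (fun m => u m x) atTop (𝓝 (g x))) {C : ℝ}
    (hC : ∀ᶠ m in atTop, ‖u m‖ ≤ C) :
    FockIntegrable n g ∧
      jacobiConst n * ∫ x, ‖g x‖ ^ 2 * jacobiWeight n x ∂jacobiMeasure ≤ C ^ 2 := by
  have hΛ := jacobiConst_pos n
  have hcont : ∀ f : JacobiDomain → ℂ, Continuous f →
      Continuous fun x => ‖f x‖ ^ 2 * jacobiWeight n x := fun f hf =>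
    (hf.norm.pow 2).mul (jacobiWeight_continuous n)
  have hnn : ∀ (f : JacobiDomain → ℂ) (x : JacobiDomain), 0 ≤ ‖f x‖ ^ 2 * jacobiWeight n x :=
    fun f x => mul_nonneg (sq_nonneg _) (jacobiWeight_pos n x).le
  have h1 : ∫⁻ x, ENNReal.ofReal (‖g x‖ ^ 2 * jacobiWeight n x) ∂jacobiMeasure ≤
      ENNReal.ofReal (C ^ 2 / jacobiConst n) := by
    have h2 : ∀ x, ENNReal.ofReal (‖g x‖ ^ 2 * jacobiWeight n x) =
        liminf (fun m => ENNReal.ofReal (‖u m x‖ ^ 2 * jacobiWeight n x)) atTop := by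
      intro x
      refine (Tendsto.liminf_eq ?_).symm
      exact (ENNReal.continuous_ofReal.tendsto _).comp ((((hlim x).norm.pow 2)).mul_const _)
    simp_rw [h2]
    refine (lintegral_liminf_le fun m =>
      (hcont _ (u m).mem.1.continuous).measurable.ennreal_ofReal).trans ?_
    refine liminf_le_of_frequently_le' (Eventually.frequently ?_)
    filter_upwards [hC] with m hm
    rw [← ofReal_integral_eq_lintegral_ofReal (u m).mem.2 (Eventually.of_forall (hnn _))]
    refine ENNReal.ofReal_le_ofReal ?_
    rw [le_div_iff₀ hΛ, mul_comm, ← fock_norm_sq]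
    exact pow_le_pow_left₀ (norm_nonneg _) hm 2
  have hint : FockIntegrable n g := by
    refine ⟨(hcont g hg.continuous).aestronglyMeasurable, ?_⟩
    rw [hasFiniteIntegral_iff_ofReal (Eventually.of_forall (hnn g))]
    exact h1.trans_lt ENNReal.ofReal_lt_top
  refine ⟨hint, ?_⟩
  rw [← ofReal_integral_eq_lintegral_ofReal hint (Eventually.of_forall (hnn _)),
    ENNReal.ofReal_le_ofReal_iff (by positivity), le_div_iff₀ hΛ] at h1
  linarith

-- A Cauchy sequence converges pointwise, and locally uniformly, to a holomorphic g by the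
-- evaluation bound. Fatou's lemma puts g in the space; applied to u m - u k as k → ∞, it also gives
-- convergence in norm.
open Filter Topology in
instance (n : ℕ) [Fact (2 ≤ n)] : CompleteSpace (FockSpace n) := by
  refine Metric.complete_of_cauchySeq_tendsto fun u hu => ?_
  have hsub : ∀ (f g : FockSpace n) x, (f - g) x = f x - g x := fun f g x => rfl
  have hbound : ∀ x m k, ‖u m x - u k x‖ ≤ ‖fockKernel n x‖ * ‖u m - u k‖ := by
    intro x m k
    rw [← hsub]
    exact fock_norm_apply_le n _ x
  have hex : ∀ x, ∃ y, Tendsto (fun m => u m x) atTop (𝓝 y) := by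
    intro x
    refine cauchySeq_tendsto_of_complete (Metric.cauchySeq_iff.2 fun ε hε => ?_)
    obtain ⟨N, hN⟩ := Metric.cauchySeq_iff.1 hu (ε / (‖fockKernel n x‖ + 1)) (by positivity)
    refine ⟨N, fun m hm k hk => ?_⟩
    have h1 := hN m hm k hk
    rw [dist_eq_norm, lt_div_iff₀ (by positivity)] at h1
    rw [dist_eq_norm]
    refine (hbound x m k).trans_lt ?_
    nlinarith [norm_nonneg (u m - u k)]
  choose g hg using hex
  have hlimbound : ∀ ε > 0, ∃ N, ∀ m ≥ N, ∀ x, ‖u m x - g x‖ ≤ ‖fockKernel n x‖ * ε := by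
    intro ε hε
    obtain ⟨N, hN⟩ := Metric.cauchySeq_iff.1 hu ε hε
    refine ⟨N, fun m hm x => ?_⟩
    refine le_of_tendsto ((tendsto_const_nhds.sub (hg x)).norm) ?_
    filter_upwards [eventually_ge_atTop N] with k hk
    refine (hbound x m k).trans ?_
    have := hN m hm k hk
    rw [dist_eq_norm] at this
    gcongr
  have hhol : JacobiHolomorphic g := by
    refine JacobiHolomorphic.of_differentiableAt_extend fun x => ?_
    have hc : ContinuousAt (fun y : JacobiDomain => (jacobiWeight n y)⁻¹) x :=
      ((jacobiWeight_continuous n).inv₀ fun y => (jacobiWeight_pos n y).ne').continuousAt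
    have hev : ∀ᶠ y in 𝓝 x, (jacobiWeight n y)⁻¹ < (jacobiWeight n x)⁻¹ + 1 :=
      hc.eventually_lt_const (by linarith)
    rw [nhds_subtype_eq_comap] at hev
    obtain ⟨ε, hε, hball⟩ : ∃ ε > 0, ∀ p ∈ Metric.ball x.1 ε, ∃ hp : ‖p.2‖ < 1,
        (jacobiWeight n ⟨p, hp⟩)⁻¹ < (jacobiWeight n x)⁻¹ + 1 := by
      have h1 := eventually_comap.1 hev
      have h2 := h1.and (isOpen_jacobiSet.mem_nhds x.2)
      obtain ⟨ε, hε, h3⟩ := Metric.eventually_nhds_iff_ball.1 h2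
      exact ⟨ε, hε, fun p hp => ⟨(h3 p hp).2, (h3 p hp).1 ⟨p, (h3 p hp).2⟩ rfl⟩⟩
    -- A bound near x for ‖K(·, y)‖, which is the inverse square root of the weight at y.
    set M := Real.sqrt ((jacobiWeight n x)⁻¹ + 1) with hM
    have hM0 : 0 < (jacobiWeight n x)⁻¹ + 1 := by
      have := jacobiWeight_pos n x
      positivity
    have hMpos : 0 < M := Real.sqrt_pos.2 hM0
    refine differentiableAt_of_tendstoUniformlyOn_ball (u := fun m => jacobiExtend (u m)) hε ?_ ?_
    · intro m p hp
      exact (u m).mem.1.differentiableAt_extend ⟨p, (hball p hp).1⟩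
    · rw [Metric.tendstoUniformlyOn_iff]
      intro δ hδ
      obtain ⟨N, hN⟩ := hlimbound (δ / (2 * M)) (by positivity)
      filter_upwards [eventually_ge_atTop N] with m hm p hp
      obtain ⟨hp1, hp2⟩ := hball p hp
      have h4 := hN m hm ⟨p, hp1⟩
      have h5 : ‖fockKernel n ⟨p, hp1⟩‖ ≤ M := by
        rw [hM]
        refine Real.le_sqrt_of_sq_le ?_
        rw [norm_fockKernel_sq]
        exact hp2.le
      rw [jacobiExtend_coe _ ⟨p, hp1⟩, jacobiExtend_coe _ ⟨p, hp1⟩, dist_comm, dist_eq_norm]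
      refine h4.trans_lt ?_
      calc ‖fockKernel n ⟨p, hp1⟩‖ * (δ / (2 * M)) ≤ M * (δ / (2 * M)) := by gcongr
        _ = δ / 2 := by field_simp
        _ < δ := by linarith
  obtain ⟨C, hC⟩ := hu.norm_bddAbove
  have hint := (fock_fatou n hhol hg (C := C) (Eventually.of_forall fun m =>
    hC (Set.mem_range_self m))).1
  let G : FockSpace n := (⟨g, hhol, hint⟩ : fockSubmodule n)
  refine ⟨G, Metric.tendsto_atTop.2 fun ε hε => ?_⟩
  obtain ⟨N, hN⟩ := Metric.cauchySeq_iff.1 hu (ε / 2) (by positivity)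
  refine ⟨N, fun m hm => ?_⟩
  have h6 := (fock_fatou n (u := fun k => u m - u k) (g := (u m - G : FockSpace n))
    (u m - G).mem.1 (fun x => (tendsto_const_nhds.sub (hg x))) (C := ε / 2) (by
      filter_upwards [eventually_ge_atTop N] with k hk
      rw [← dist_eq_norm]
      exact (hN m hm k hk).le)).2
  rw [← fock_norm_sq] at h6
  rw [dist_eq_norm]
  have h7 := (sq_le_sq₀ (norm_nonneg _) (by positivity)).1 h6
  linarith

/-! ### Strong continuity -/

-- The squared distance is K(x, x) - 2 Re K(x, y) + K(y, y), which is continuous in x and vanishes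
-- at x = y.
open Filter Topology in
lemma continuous_fockKernel (n : ℕ) [Fact (2 ≤ n)] : Continuous (fockKernel n) := by
  refine continuous_iff_continuousAt.2 fun y => tendsto_iff_norm_sub_tendsto_zero.2 ?_
  have hk := continuous_jacobiKernel n
  have h1 : Tendsto (fun x => ‖fockKernel n x - fockKernel n y‖ ^ 2) (𝓝 y) (𝓝 0) := by
    have h2 : ∀ x, ‖fockKernel n x - fockKernel n y‖ ^ 2 = (jacobiKernel n x x).re
        - 2 * (jacobiKernel n x y).re + (jacobiKernel n y y).re := by
      intro x
      rw [@norm_sub_sq ℂ, fockKernel_inner, fockKernel_apply, norm_fockKernel_sq,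
        norm_fockKernel_sq, jacobiKernel_self, jacobiKernel_self, Complex.ofReal_re,
        Complex.ofReal_re]
      rfl
    simp_rw [h2]
    have h3 : Continuous fun x => (jacobiKernel n x x).re
        - 2 * (jacobiKernel n x y).re + (jacobiKernel n y y).re :=
      ((Complex.continuous_re.comp (hk.comp (continuous_id.prodMk continuous_id))).sub
        (continuous_const.mul (Complex.continuous_re.comp
          (hk.comp (continuous_id.prodMk continuous_const))))).add continuous_const
    have h4 := h3.tendsto y
    convert! h4 using 2
    ring
  have h5 := (Real.continuous_sqrt.tendsto 0).comp h1
  simpa [Function.comp_def, Real.sqrt_sq (norm_nonneg _)] using h5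

/-- A function orthogonal to all kernel functions vanishes at every point. -/
lemma span_fockKernel_dense (n : ℕ) [Fact (2 ≤ n)] :
    (Submodule.span ℂ (Set.range (fockKernel n))).topologicalClosure = ⊤ := by
  rw [Submodule.topologicalClosure_eq_top_iff, Submodule.eq_bot_iff]
  intro f hf
  refine DFunLike.ext _ _ fun x => ?_
  rw [← fockKernel_inner]
  exact (Submodule.mem_orthogonal _ _).1 hf _ (Submodule.subset_span (Set.mem_range_self x))

lemma fockRep_fockKernel (n : ℕ) [Fact (2 ≤ n)] (h : JacobiGroup) (y : JacobiDomain) :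
    fockRep n h (fockKernel n y) = conj (jacobiMultiplier n h y) • fockKernel n (h • y) := by
  refine DFunLike.ext _ _ fun x => ?_
  rw [fockRep_apply, FockSpace.smul_apply, fockKernel_apply, fockKernel_apply,
    ← jacobiKernel_smul_mul n h (h⁻¹ • x) y, smul_inv_smul]
  have h2 := jacobiMultiplier_inv_smul n h (h⁻¹ • x)
  rw [smul_inv_smul] at h2
  linear_combination (jacobiKernel n x (h • y) * conj (jacobiMultiplier n h y)) * h2

/-- Orbit maps of kernel functions are explicit by `fockRep_fockKernel`. Since the operators are
isometries, approximation from the dense span is uniform in h. -/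
lemma continuous_fockRep (n : ℕ) [Fact (2 ≤ n)] (f : FockSpace n) :
    Continuous fun h => fockRep n h f := by
  have hspan : ∀ v ∈ Submodule.span ℂ (Set.range (fockKernel n)),
      Continuous fun h => fockRep n h v := by
    intro v hv
    induction hv using Submodule.span_induction with
    | mem v hv =>
      obtain ⟨y, rfl⟩ := hv
      simp_rw [fockRep_fockKernel]
      exact (Complex.continuous_conj.comp (continuous_jacobiMultiplier_left n y)).smul
        ((continuous_fockKernel n).comp (continuous_smul_left y))
    | zero => simpa using continuous_const
    | add v w _ _ hv hw => exact (hv.add hw).congr fun h => (map_add (fockRep n h) v w).symm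
    | smul c v _ hv => exact (hv.const_smul c).congr fun h => (map_smul (fockRep n h) c v).symm
  have hf : f ∈ closure (Submodule.span ℂ (Set.range (fockKernel n)) : Set (FockSpace n)) := by
    rw [← Submodule.topologicalClosure_coe, span_fockKernel_dense]
    trivial
  refine continuous_of_uniform_approx_of_continuous fun U hU => ?_
  obtain ⟨ε, hε, hU'⟩ := Metric.mem_uniformity_dist.1 hU
  obtain ⟨v, hv, hfv⟩ := Metric.mem_closure_iff.1 hf ε hε
  exact ⟨_, hspan v hv, fun h => hU' (by rwa [(fockRep n h).dist_map])⟩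

/-! ### The coherent state vectors of a representation -/

section CoherentVector

variable {H : Type*} [NormedAddCommGroup H] [InnerProductSpace ℂ H]

lemma SU11.ext' {g h : SU11} (ha : g.a = h.a) (hb : g.b = h.b) : g = h := by
  refine Subtype.ext (Matrix.SpecialLinearGroup.ext _ _ fun i j => ?_)
  fin_cases i <;> fin_cases j
  · exact ha
  · exact hb
  · exact g.2.1.trans ((congrArg conj hb).trans h.2.1.symm)
  · exact g.2.2.trans ((congrArg conj ha).trans h.2.2.symm)

lemma SU11.a_mk (a b : ℂ) (h : a * conj a - b * conj b = 1) : (SU11.mk a b h).a = a := rfl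

lemma SU11.b_mk (a b : ℂ) (h : a * conj a - b * conj b = 1) : (SU11.mk a b h).b = b := rfl

lemma rotationFlow_eq_jacobiParam (s : ℝ) : rotationFlow s = jacobiParam (0, s, 0, 0) := by
  refine JacobiGroup.ext (SU11.ext' ?_ rfl) rfl rfl
  simp [rotationFlow, jacobiParam, SU11.a_mk, mul_comm]

lemma rotationFlow_add (s t : ℝ) : rotationFlow (s + t) = rotationFlow s * rotationFlow t := by
  refine JacobiGroup.ext (SU11.ext' ?_ ?_) ?_ ?_
  · rw [JacobiGroup.mul_def, SU11.a_mul]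
    simp [rotationFlow, SU11.a_mk, SU11.b_mk, add_mul, Complex.exp_add]
  · rw [JacobiGroup.mul_def, SU11.b_mul]
    simp [rotationFlow, SU11.a_mk, SU11.b_mk]
  · simp [JacobiGroup.mul_def, rotationFlow, SU11.rot_zero]
  · simp [JacobiGroup.mul_def, rotationFlow, SU11.rot_zero]

lemma rep_mul_apply (π : JacobiGroup →* (H ≃ₗᵢ[ℂ] H)) (h k : JacobiGroup) (v : H) :
    π (h * k) v = π h (π k v) := by
  rw [map_mul]; rfl

lemma rep_one_apply (π : JacobiGroup →* (H ≃ₗᵢ[ℂ] H)) (v : H) : π 1 v = v := by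
  rw [map_one]; rfl

lemma rep_inner_left (π : JacobiGroup →* (H ≃ₗᵢ[ℂ] H)) (h : JacobiGroup) (v w : H) :
    ⟪π h v, w⟫_ℂ = ⟪v, π h⁻¹ w⟫_ℂ := by
  rw [← (π h).inner_map_map v, ← rep_mul_apply, mul_inv_cancel, rep_one_apply]

lemma jacobiParam_zero : jacobiParam (0, 0, 0, 0) = 1 := by
  refine JacobiGroup.ext (SU11.ext' ?_ ?_) rfl rfl
  · simp [jacobiParam, SU11.a_mk, JacobiGroup.one_def]
  · simp [jacobiParam, SU11.b_mk, JacobiGroup.one_def]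

lemma rotationFlow_zero : rotationFlow 0 = 1 := by
  rw [rotationFlow_eq_jacobiParam, jacobiParam_zero]

namespace IsJacobiRep

variable {n : ℕ} {π : JacobiGroup →* (H ≃ₗᵢ[ℂ] H)} {e₀ : H}

/-- The eigenvalue n/2 of K₀ gives the derivative i n e₀ at s = 0, and the group law carries it to
every s. The resulting differential equation is solved by checking that exp(-ins) π(rotation by s)
e₀ is constant. -/
lemma rotationFlow_apply (hπ : IsJacobiRep n π e₀) (s : ℝ) :
    π (rotationFlow s) e₀ = Complex.exp (s * Complex.I) ^ n • e₀ := by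
  have hdiff : Differentiable ℝ fun s : ℝ => π (rotationFlow s) e₀ := by
    simp_rw [rotationFlow_eq_jacobiParam]
    have h1 : Differentiable ℝ fun p : ℂ × ℝ × ℂ × ℝ => π (jacobiParam p) e₀ :=
      hπ.smooth.differentiable (by simp)
    exact h1.comp (g := fun p : ℂ × ℝ × ℂ × ℝ => π (jacobiParam p) e₀)
      (f := fun s : ℝ => ((0, s, 0, 0) : ℂ × ℝ × ℂ × ℝ)) (by fun_prop)
  have h0 : derivedRep π rotationFlow e₀ = (Complex.I * n) • e₀ := by
    have h1 := hπ.kZero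
    unfold opKZero at h1
    have h2 : derivedRep π rotationFlow e₀ =
        (2 * Complex.I) • (-(Complex.I / 2) • derivedRep π rotationFlow e₀) := by
      rw [smul_smul]
      have : 2 * Complex.I * -(Complex.I / 2) = 1 := by
        linear_combination -Complex.I_mul_I
      rw [this, one_smul]
    rw [h2, h1, smul_smul]
    congr 1
    ring
  have h1 : HasDerivAt (fun s : ℝ => π (rotationFlow s) e₀) ((Complex.I * n) • e₀) 0 := by
    rw [← h0]
    exact (hdiff 0).hasDerivAt
  have hder : ∀ s : ℝ, HasDerivAt (fun s : ℝ => π (rotationFlow s) e₀)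
      ((Complex.I * n) • π (rotationFlow s) e₀) s := by
    intro s
    have h2 : (fun t : ℝ => π (rotationFlow t) e₀) =
        fun t => π (rotationFlow s) (π (rotationFlow (t - s)) e₀) := by
      ext t
      rw [← rep_mul_apply, ← rotationFlow_add, add_sub_cancel]
    rw [h2]
    rw [← sub_self s] at h1
    have h4 := HasDerivAt.comp_sub_const s s h1
    have h5 := ((π (rotationFlow s)).toContinuousLinearEquiv : H →L[ℂ] H).restrictScalars ℝ
      |>.hasFDerivAt.comp_hasDerivAt s h4
    convert! h5 using 1
    simp
  have hconst : ∀ s : ℝ, HasDerivAt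
      (fun s : ℝ => Complex.exp (-(Complex.I * n) * s) • π (rotationFlow s) e₀) 0 s := by
    intro s
    have h2 : HasDerivAt (fun s : ℝ => Complex.exp (-(Complex.I * n) * s))
        (Complex.exp (-(Complex.I * n) * s) * (-(Complex.I * n))) s := by
      have h3 : HasDerivAt (fun s : ℝ => -(Complex.I * n) * (s : ℂ)) (-(Complex.I * n)) s := by
        simpa using (Complex.ofRealCLM.hasDerivAt (x := s)).const_mul (-(Complex.I * n))
      exact h3.cexp
    have h4 := h2.smul (hder s)
    convert! h4 using 1
    rw [smul_smul, ← add_smul]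
    simp
  have h2 := is_const_of_deriv_eq_zero (fun s => (hconst s).differentiableAt)
    (fun s => (hconst s).deriv) s 0
  simp only [Complex.ofReal_zero, mul_zero, Complex.exp_zero, one_smul, rotationFlow_zero,
    rep_one_apply] at h2
  have h3 : (n : ℂ) * (s * Complex.I) + -(Complex.I * n) * s = 0 := by ring
  conv_rhs => rw [← h2, smul_smul, ← Complex.exp_nat_mul, ← Complex.exp_add, h3,
    Complex.exp_zero, one_smul]

/-- Fixing the base point forces b = 0 and α = 0, so h is a rotation times a central element, and
both act on e₀ by their multiplier. This makes e_x independent of the group element that reaches x.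
-/
lemma stabilizer_apply (hπ : IsJacobiRep n π e₀) {h : JacobiGroup}
    (hh : h • JacobiDomain.origin = JacobiDomain.origin) :
    π h e₀ = jacobiMultiplier n h JacobiDomain.origin • e₀ := by
  have hz := congrArg JacobiDomain.z hh
  have hw := congrArg JacobiDomain.w hh
  have hd := h.g.den_ne_zero JacobiDomain.origin
  rw [JacobiDomain.smul_z, div_eq_iff hd] at hz
  rw [JacobiDomain.smul_w, div_eq_iff hd] at hw
  simp only [JacobiDomain.origin_z, JacobiDomain.origin_w, mul_zero, sub_zero, add_zero, zero_add,
    zero_mul] at hz hw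
  have hdet := h.g.det_eq
  rw [hw, zero_mul, sub_zero, Complex.mul_conj, Complex.normSq_eq_norm_sq] at hdet
  have hnorm : ‖h.g.a‖ = 1 := by
    have h1 : ‖h.g.a‖ ^ 2 = 1 := by exact_mod_cast hdet
    exact (pow_eq_one_iff_of_nonneg (norm_nonneg _) two_ne_zero).1 h1
  have ha : h.g.a = Complex.exp (h.g.a.arg * Complex.I) := by
    have h1 := Complex.norm_mul_exp_arg_mul_I h.g.a
    rw [hnorm, Complex.ofReal_one, one_mul] at h1
    exact h1.symm
  have hfac : h = rotationFlow h.g.a.arg * ⟨1, 0, h.t⟩ := by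
    refine JacobiGroup.ext (SU11.ext' ?_ ?_) ?_ ?_
    · rw [JacobiGroup.mul_def, SU11.a_mul]
      simpa [rotationFlow, SU11.a_mk, SU11.b_mk] using ha
    · rw [JacobiGroup.mul_def, SU11.b_mul]
      simpa [rotationFlow, SU11.a_mk, SU11.b_mk] using hw
    · simpa [JacobiGroup.mul_def, rotationFlow, SU11.rot_zero] using hz
    · simp [JacobiGroup.mul_def, rotationFlow, SU11.rot_zero]
  have hmul : jacobiMultiplier n ⟨1, 0, h.t⟩ JacobiDomain.origin =
      Complex.exp (Complex.I * h.t) := by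
    rw [jacobiMultiplier_eq]
    simp [jacobiExponent, SU11.den]
  rw [hfac, rep_mul_apply, hπ.central, map_smul, hπ.rotationFlow_apply, jacobiMultiplier_mul,
    jacobiMultiplier_rotationFlow, smul_smul, mul_comm]
  congr 2
  exact hmul.symm

end IsJacobiRep

/-- The coherent state vector at `p`, as the image of `e₀` under a group element that moves the
base point to `p`, divided by the multiplier. -/
def coherentVec (n : ℕ) (π : JacobiGroup →* (H ≃ₗᵢ[ℂ] H)) (e₀ : H) (p : ℂ × ℂ) : H :=
  ((((Real.sqrt (1 - ‖p.2‖ ^ 2))⁻¹ ^ n : ℝ) : ℂ) *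
    Complex.exp ((conj p.2 * p.1 ^ 2 + p.1 * conj p.1) / 2 *
      (((Real.sqrt (1 - ‖p.2‖ ^ 2))⁻¹ ^ 2 : ℝ) : ℂ))) • π (jacobiParam (sectionCoord p)) e₀

/-- The explicit scalar in `coherentVec` is λ(σ, 0)⁻¹ for the section σ; the explicit form makes its
real smoothness visible. -/
lemma coherentVec_coe (n : ℕ) (π : JacobiGroup →* (H ≃ₗᵢ[ℂ] H)) (e₀ : H) (x : JacobiDomain) :
    coherentVec n π e₀ x.1 =
      (jacobiMultiplier n (jacobiParam (sectionCoord x.1)) JacobiDomain.origin)⁻¹ •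
        π (jacobiParam (sectionCoord x.1)) e₀ := by
  unfold coherentVec
  congr 1
  have ha := jacobiParam_sectionCoord_a x
  have hb : (jacobiParam (sectionCoord x.1)).g.b =
    (((Real.sqrt (1 - ‖x.w‖ ^ 2))⁻¹ : ℝ) : ℂ) * x.w := rfl
  have hα : (jacobiParam (sectionCoord x.1)).α =
    (((Real.sqrt (1 - ‖x.w‖ ^ 2))⁻¹ : ℝ) : ℂ) * x.z := rfl
  have ht : (jacobiParam (sectionCoord x.1)).t = 0 := rfl
  rw [jacobiMultiplier_eq]
  simp only [jacobiExponent, jacobiShift, SU11.den, JacobiDomain.origin_z, JacobiDomain.origin_w,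
    ha, hb, hα, ht, map_mul, Complex.conj_ofReal]
  change (((Real.sqrt (1 - ‖x.w‖ ^ 2))⁻¹ ^ n : ℝ) : ℂ) *
    Complex.exp ((conj x.w * x.z ^ 2 + x.z * conj x.z) / 2 *
      (((Real.sqrt (1 - ‖x.w‖ ^ 2))⁻¹ ^ 2 : ℝ) : ℂ)) = _
  have hs : (((Real.sqrt (1 - ‖x.w‖ ^ 2))⁻¹ : ℝ) : ℂ) ≠ 0 := by
    have := Real.sqrt_pos.2 x.one_sub_pos
    exact_mod_cast (inv_pos.2 this).ne'
  simp only [Complex.ofReal_pow]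
  generalize (((Real.sqrt (1 - ‖x.w‖ ^ 2))⁻¹ : ℝ) : ℂ) = s at *
  rw [mul_inv, ← Complex.exp_neg]
  simp only [mul_zero, zero_add, sub_zero, zero_mul, add_zero, Complex.ofReal_zero, inv_inv]
  congr 2
  field_simp
  ring

lemma contDiffAt_coherentVec (n : ℕ) {π : JacobiGroup →* (H ≃ₗᵢ[ℂ] H)} {e₀ : H}
    (hsm : IsSmoothVector π e₀) {p : ℂ × ℂ} (hp : ‖p.2‖ < 1) :
    ContDiffAt ℝ ((⊤ : ℕ∞) : WithTop ℕ∞) (coherentVec n π e₀) p := by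
  have hD : 1 - ‖p.2‖ ^ 2 ≠ 0 := by
    have : 0 < 1 - ‖p.2‖ ^ 2 := by nlinarith [norm_nonneg p.2]
    exact this.ne'
  have hD' : Real.sqrt (1 - ‖p.2‖ ^ 2) ≠ 0 := by
    have : 0 < 1 - ‖p.2‖ ^ 2 := by nlinarith [norm_nonneg p.2]
    exact (Real.sqrt_pos.2 this).ne'
  have h1 : ContDiffAt ℝ ((⊤ : ℕ∞) : WithTop ℕ∞)
      (fun p : ℂ × ℂ => (Real.sqrt (1 - ‖p.2‖ ^ 2))⁻¹) p :=
    ((contDiffAt_const.sub (contDiffAt_snd.norm_sq ℝ)).sqrt hD).inv hD'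
  have hz : ContDiffAt ℝ ((⊤ : ℕ∞) : WithTop ℕ∞) (fun p : ℂ × ℂ => p.1) p := contDiffAt_fst
  have hw : ContDiffAt ℝ ((⊤ : ℕ∞) : WithTop ℕ∞) (fun p : ℂ × ℂ => p.2) p := contDiffAt_snd
  have hc : ∀ {f : ℂ × ℂ → ℂ}, ContDiffAt ℝ ((⊤ : ℕ∞) : WithTop ℕ∞) f p →
      ContDiffAt ℝ ((⊤ : ℕ∞) : WithTop ℕ∞) (fun q => conj (f q)) p := fun hf =>
    Complex.conjCLE.contDiff.contDiffAt.comp p hf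
  have hr : ∀ {f : ℂ × ℂ → ℝ}, ContDiffAt ℝ ((⊤ : ℕ∞) : WithTop ℕ∞) f p →
      ContDiffAt ℝ ((⊤ : ℕ∞) : WithTop ℕ∞) (fun q => ((f q : ℝ) : ℂ)) p := fun hf =>
    Complex.ofRealCLM.contDiff.contDiffAt.comp p hf
  have hσ : ContDiffAt ℝ ((⊤ : ℕ∞) : WithTop ℕ∞) sectionCoord p :=
    ((hr h1).mul hw).prodMk (contDiffAt_const.prodMk (((hr h1).mul hz).prodMk contDiffAt_const))
  have hsm' : ContDiffAt ℝ ((⊤ : ℕ∞) : WithTop ℕ∞)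
      (fun p : ℂ × ℝ × ℂ × ℝ => π (jacobiParam p) e₀) (sectionCoord p) := hsm.contDiffAt
  refine ContDiffAt.smul (((hr (h1.pow n))).mul (ContDiffAt.cexp ?_)) (hsm'.comp p hσ)
  exact ((((hc hw).mul (hz.pow 2)).add (hz.mul (hc hz))).div_const 2).mul (hr (h1.pow 2))

namespace IsJacobiRep

variable {n : ℕ} {π : JacobiGroup →* (H ≃ₗᵢ[ℂ] H)} {e₀ : H}

lemma rep_apply_eq (hπ : IsJacobiRep n π e₀) (h : JacobiGroup) :
    π h e₀ = jacobiMultiplier n h JacobiDomain.origin •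
      coherentVec n π e₀ (h • JacobiDomain.origin).1 := by
  rw [coherentVec_coe]
  set σ := jacobiParam (sectionCoord (h • JacobiDomain.origin).1) with hσdef
  have hσ : σ • JacobiDomain.origin = h • JacobiDomain.origin := jacobiParam_sectionCoord_smul _
  have hk : (σ⁻¹ * h) • JacobiDomain.origin = JacobiDomain.origin := by
    rw [mul_smul, ← hσ, inv_smul_smul]
  have h1 := hπ.stabilizer_apply hk
  have h2 : h = σ * (σ⁻¹ * h) := by rw [mul_inv_cancel_left]
  have h3 := jacobiMultiplier_mul n σ (σ⁻¹ * h) JacobiDomain.origin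
  rw [← h2, hk] at h3
  have h4 := jacobiMultiplier_ne_zero n σ JacobiDomain.origin
  rw [h3, smul_smul, mul_comm, ← mul_assoc, inv_mul_cancel₀ h4, one_mul, ← map_smul, ← h1,
    ← rep_mul_apply, mul_inv_cancel_left]

/-- For x = k·0, compare the two expressions of π(hk) e₀ and use the cocycle identity. -/
lemma rep_coherentVec (hπ : IsJacobiRep n π e₀) (h : JacobiGroup) (x : JacobiDomain) :
    π h (coherentVec n π e₀ x.1) =
      jacobiMultiplier n h x • coherentVec n π e₀ (h • x).1 := by
  obtain ⟨k, rfl⟩ := exists_smul_origin x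
  have h1 := hπ.rep_apply_eq k
  have h2 := hπ.rep_apply_eq (h * k)
  have h4 := jacobiMultiplier_ne_zero n k JacobiDomain.origin
  rw [rep_mul_apply, h1, map_smul, jacobiMultiplier_mul, mul_smul h k, mul_comm, mul_smul] at h2
  exact smul_right_injective H h4 h2

lemma coherentVec_origin (hπ : IsJacobiRep n π e₀) : coherentVec n π e₀ (0, 0) = e₀ := by
  have h1 := hπ.rep_apply_eq 1
  rw [rep_one_apply, jacobiMultiplier_one, one_smul, one_smul] at h1
  exact h1.symm

/-! ### Holomorphy and scalar products of the coherent vectors. -/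

lemma hasFDerivAt_coherentVec (hπ : IsJacobiRep n π e₀) {p : ℂ × ℂ} (hp : ‖p.2‖ < 1) :
    HasFDerivAt (coherentVec n π e₀) (fderiv ℝ (coherentVec n π e₀) p) p :=
  ((contDiffAt_coherentVec n hπ.smooth hp).differentiableAt (by simp)).hasFDerivAt

/-- The orbit of e₀ is e_{(sy, 0)} times a Gaussian in s whose derivative at 0 vanishes, so only the
real directional derivative of e remains. For the boosts the factor is cosh⁻ⁿ and the point is (0, y
tanh s). -/
lemma hasDerivAt_heisenbergFlow (hπ : IsJacobiRep n π e₀) (y : ℂ) :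
    HasDerivAt (fun s : ℝ => π (heisenbergFlow y s) e₀)
      (fderiv ℝ (coherentVec n π e₀) (0, 0) (y, 0)) 0 := by
  have h1 : ∀ s : ℝ, π (heisenbergFlow y s) e₀ =
      Real.exp (-(s ^ 2 * ‖y‖ ^ 2 / 2)) • coherentVec n π e₀ (s • ((y, 0) : ℂ × ℂ)) := by
    intro s
    rw [hπ.rep_apply_eq, jacobiMultiplier_eq]
    have hx : (heisenbergFlow y s • JacobiDomain.origin).1 = s • ((y, 0) : ℂ × ℂ) := by
      refine Prod.ext ?_ ?_
      · change (heisenbergFlow y s • JacobiDomain.origin).z = _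
        simp [JacobiDomain.smul_z, heisenbergFlow]
      · change (heisenbergFlow y s • JacobiDomain.origin).w = _
        simp [JacobiDomain.smul_w, heisenbergFlow]
    rw [hx]
    refine Eq.trans ?_ (Complex.coe_smul _ _)
    congr 1
    simp only [jacobiExponent, SU11.den, heisenbergFlow, SU11.a_one, SU11.b_one, map_zero, map_one,
      JacobiDomain.origin_z, JacobiDomain.origin_w, map_mul, Complex.conj_ofReal]
    rw [Complex.ofReal_exp]
    have : (s : ℂ) * y * (s * conj y) = ((s ^ 2 * ‖y‖ ^ 2 : ℝ) : ℂ) := by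
      rw [mul_mul_mul_comm, Complex.mul_conj, Complex.normSq_eq_norm_sq]
      push_cast
      ring
    rw [this]
    simp
  simp_rw [h1]
  have h2 : HasDerivAt (fun s : ℝ => s • ((y, 0) : ℂ × ℂ)) (y, 0) 0 := by
    simpa using (hasDerivAt_id (0 : ℝ)).smul_const ((y, 0) : ℂ × ℂ)
  have h3 : HasDerivAt (fun s : ℝ => coherentVec n π e₀ (s • ((y, 0) : ℂ × ℂ)))
      (fderiv ℝ (coherentVec n π e₀) (0, 0) (y, 0)) 0 := by
    have h4 := hπ.hasFDerivAt_coherentVec (p := (0, 0)) (by simp)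
    have h5 : (0 : ℝ) • ((y, 0) : ℂ × ℂ) = (0, 0) := zero_smul _ _
    rw [← h5] at h4 ⊢
    exact h4.comp_hasDerivAt 0 h2
  have h6 : HasDerivAt (fun s : ℝ => Real.exp (-(s ^ 2 * ‖y‖ ^ 2 / 2))) 0 0 := by
    have h7 := ((((hasDerivAt_pow 2 (0 : ℝ)).mul_const (‖y‖ ^ 2)).div_const 2).neg).exp
    simpa using h7
  convert! h6.smul h3 using 1
  simp

lemma hasDerivAt_boostFlow (hπ : IsJacobiRep n π e₀) (y : ℂ) (hy : ‖y‖ = 1) :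
    HasDerivAt (fun s : ℝ => π (boostFlow y hy s) e₀)
      (fderiv ℝ (coherentVec n π e₀) (0, 0) (0, y)) 0 := by
  have h1 : ∀ s : ℝ, π (boostFlow y hy s) e₀ =
      (Real.cosh s ^ n)⁻¹ • coherentVec n π e₀ (Real.tanh s • ((0, y) : ℂ × ℂ)) := by
    intro s
    have hc : (Real.cosh s : ℂ) ≠ 0 := by exact_mod_cast (Real.cosh_pos s).ne'
    rw [hπ.rep_apply_eq, jacobiMultiplier_eq]
    have hx : (boostFlow y hy s • JacobiDomain.origin).1 = Real.tanh s • ((0, y) : ℂ × ℂ) := by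
      refine Prod.ext ?_ ?_
      · change (boostFlow y hy s • JacobiDomain.origin).z = _
        simp [JacobiDomain.smul_z, boostFlow]
      · change (boostFlow y hy s • JacobiDomain.origin).w = _
        rw [JacobiDomain.smul_w]
        simp only [boostFlow, SU11.a_mk, SU11.b_mk, JacobiDomain.origin_w, Prod.smul_snd,
          Complex.real_smul, Complex.conj_ofReal, mul_zero, zero_add, Real.tanh_eq_sinh_div_cosh,
          Complex.ofReal_div]
        ring
    rw [hx]
    refine Eq.trans ?_ (Complex.coe_smul _ _)
    congr 1
    simp [jacobiExponent, SU11.den, boostFlow, SU11.a_mk, SU11.b_mk, jacobiShift,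
      ← Complex.cosh_conj]
  simp_rw [h1]
  have ht : HasDerivAt Real.tanh 1 0 := by
    have h8 := (Real.hasDerivAt_sinh 0).div (Real.hasDerivAt_cosh 0) (Real.cosh_pos 0).ne'
    have h9 : Real.tanh = fun s => Real.sinh s / Real.cosh s :=
      funext fun s => Real.tanh_eq_sinh_div_cosh s
    rw [h9]
    convert! h8 using 1
    simp
  have h2 : HasDerivAt (fun s : ℝ => Real.tanh s • ((0, y) : ℂ × ℂ)) (0, y) 0 := by
    simpa using ht.smul_const ((0, y) : ℂ × ℂ)
  have h3 : HasDerivAt (fun s : ℝ => coherentVec n π e₀ (Real.tanh s • ((0, y) : ℂ × ℂ)))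
      (fderiv ℝ (coherentVec n π e₀) (0, 0) (0, y)) 0 := by
    have h4 := hπ.hasFDerivAt_coherentVec (p := (0, 0)) (by simp)
    have h5 : Real.tanh 0 • ((0, y) : ℂ × ℂ) = (0, 0) := by
      rw [Real.tanh_zero]
      exact zero_smul _ _
    rw [← h5] at h4 ⊢
    exact h4.comp_hasDerivAt 0 h2
  have h6 : HasDerivAt (fun s : ℝ => (Real.cosh s ^ n)⁻¹) 0 0 := by
    have h7 := ((Real.hasDerivAt_cosh 0).pow n).inv (pow_ne_zero n (Real.cosh_pos 0).ne')
    convert! h7 using 1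
    simp
  convert! h6.smul h3 using 1
  simp

/-- The Cauchy-Riemann equations at the base point. -/
lemma exists_hasFDerivAt_zero (hπ : IsJacobiRep n π e₀) :
    ∃ L : ℂ × ℂ →L[ℂ] H, HasFDerivAt (𝕜 := ℂ) (coherentVec n π e₀) L (0, 0) := by
  set D := fderiv ℝ (coherentVec n π e₀) (0, 0) with hD
  -- Here a e₀ = -(D(1, 0) + i D(i, 0))/2, so a e₀ = 0 is the Cauchy-Riemann equation in z; K₋ e₀ =
  -- 0 is the one in w.
  have h1 : D (Complex.I, 0) = Complex.I • D (1, 0) := by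
    have h := hπ.annihilate
    unfold opAnnihilate derivedRep at h
    rw [(hπ.hasDerivAt_heisenbergFlow 1).deriv, (hπ.hasDerivAt_heisenbergFlow Complex.I).deriv,
      smul_eq_zero] at h
    have h2 := h.resolve_left (by norm_num)
    rw [eq_neg_of_add_eq_zero_left h2, smul_neg, smul_smul, Complex.I_mul_I]
    simp
    rfl
  have h2 : D (0, Complex.I) = Complex.I • D (0, 1) := by
    have h := hπ.kMinus
    unfold opKMinus derivedRep at h
    rw [(hπ.hasDerivAt_boostFlow 1 _).deriv, (hπ.hasDerivAt_boostFlow Complex.I _).deriv,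
      smul_eq_zero] at h
    have h2 := h.resolve_left (by norm_num)
    rw [eq_neg_of_add_eq_zero_left h2, smul_neg, smul_smul, Complex.I_mul_I]
    simp
    rfl
  refine ⟨(ContinuousLinearMap.fst ℂ ℂ ℂ).smulRight (D (1, 0)) +
    (ContinuousLinearMap.snd ℂ ℂ ℂ).smulRight (D (0, 1)), ?_⟩
  refine hasFDerivAt_of_restrictScalars ℝ (hπ.hasFDerivAt_coherentVec (by simp)) ?_
  refine ContinuousLinearMap.ext fun v => ?_
  have h3 : v = v.1.re • ((1, 0) : ℂ × ℂ) + v.1.im • ((Complex.I, 0) : ℂ × ℂ)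
      + v.2.re • ((0, 1) : ℂ × ℂ) + v.2.im • ((0, Complex.I) : ℂ × ℂ) := by
    refine Prod.ext ?_ ?_ <;> simp [Complex.re_add_im]
  change v.1 • D (1, 0) + v.2 • D (0, 1) = D v
  conv_rhs => rw [h3]
  simp only [map_add, map_smul, h1, h2]
  conv_lhs => rw [← Complex.re_add_im v.1, ← Complex.re_add_im v.2]
  simp only [add_smul, mul_smul, Complex.coe_smul]
  abel

/-- Near x = h·0 one has e_p = λ(h⁻¹, p) π(h) e_{h⁻¹·p}, and λ and the action are holomorphic in p.
Complex differentiability at the base point therefore suffices. -/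
lemma differentiableAt_coherentVec (hπ : IsJacobiRep n π e₀) (x : JacobiDomain) :
    DifferentiableAt ℂ (coherentVec n π e₀) x.1 := by
  obtain ⟨h, rfl⟩ := exists_smul_origin x
  obtain ⟨L, hL⟩ := hπ.exists_hasFDerivAt_zero
  set x := h • JacobiDomain.origin with hx
  have h0 : jacobiAct h⁻¹ x.1 = (0, 0) := by
    rw [jacobiAct_coe, hx, inv_smul_smul]; rfl
  have h1 : DifferentiableAt ℂ (fun p => jacobiMultiplierExt n h⁻¹ p •
      π h (coherentVec n π e₀ (jacobiAct h⁻¹ p))) x.1 := by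
    refine (differentiableAt_jacobiMultiplierExt n h⁻¹ x).smul ?_
    have h2 : DifferentiableAt ℂ (coherentVec n π e₀) (jacobiAct h⁻¹ x.1) := by
      rw [h0]; exact hL.differentiableAt
    exact ((π h).toContinuousLinearEquiv : H →L[ℂ] H).differentiableAt.comp x.1
      (h2.comp x.1 (hasFDerivAt_jacobiAct h⁻¹ x).differentiableAt)
  refine h1.congr_of_eventuallyEq ?_
  filter_upwards [isOpen_jacobiSet.mem_nhds x.2] with p hp
  have h3 := hπ.rep_coherentVec h (h⁻¹ • ⟨p, hp⟩)
  rw [smul_inv_smul] at h3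
  have h4 := jacobiMultiplierExt_coe n h⁻¹ ⟨p, hp⟩
  have h5 := jacobiAct_coe h⁻¹ ⟨p, hp⟩
  simp only at h3 h4 h5
  rw [h4, h5, h3, smul_smul]
  have h6 := jacobiMultiplier_mul n h h⁻¹ ⟨p, hp⟩
  rw [mul_inv_cancel, jacobiMultiplier_one] at h6
  rw [mul_comm, ← h6, one_smul]

/-- Rotations multiply e₀ by a phase and carry e_x, up to the same phase, along its orbit. So this
holomorphic function of x is constant on rotation orbits and equals its mean, the value 1 at the
base point. -/
lemma inner_coherentVec_left (hπ : IsJacobiRep n π e₀) (x : JacobiDomain) :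
    ⟪e₀, coherentVec n π e₀ x.1⟫_ℂ = 1 := by
  set f : JacobiDomain → ℂ := fun x => ⟪e₀, coherentVec n π e₀ x.1⟫_ℂ with hf
  have hhol : JacobiHolomorphic f :=
    ⟨fun p => ⟪e₀, coherentVec n π e₀ p⟫_ℂ, fun p hp =>
      ((innerSL ℂ e₀).differentiableAt.comp p
        (hπ.differentiableAt_coherentVec ⟨p, hp⟩)).differentiableWithinAt, fun _ => rfl⟩
  have hrot : ∀ θ : ℝ, f (rotationFlow θ • x) = f x := by
    intro θ
    have h1 := hπ.rep_coherentVec (rotationFlow θ) x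
    have h2 := (π (rotationFlow θ)).inner_map_map e₀ (coherentVec n π e₀ x.1)
    have h3 : conj (Complex.exp (θ * Complex.I) ^ n) * Complex.exp (θ * Complex.I) ^ n = 1 := by
      rw [mul_comm, Complex.mul_conj, Complex.normSq_eq_norm_sq, norm_pow,
        Complex.norm_exp_ofReal_mul_I]
      simp
    rw [h1, hπ.rotationFlow_apply, jacobiMultiplier_rotationFlow, inner_smul_left,
      inner_smul_right, ← mul_assoc, h3, one_mul] at h2
    exact h2
  have h4 := hhol.circleAverage_rotation x
  simp_rw [hrot] at h4
  rw [intervalIntegral.integral_const, sub_zero, Complex.real_smul] at h4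
  have h5 : f JacobiDomain.origin = 1 := by
    change ⟪e₀, coherentVec n π e₀ (0, 0)⟫_ℂ = 1
    rw [hπ.coherentVec_origin, inner_self_eq_norm_sq_to_K, hπ.norm_eq_one]
    simp
  have hpi : (2 * Real.pi : ℂ) ≠ 0 := by exact_mod_cast Real.two_pi_pos.ne'
  rw [h5] at h4
  push_cast at h4
  exact mul_left_cancel₀ hpi h4

/-- For y = h·0, unitarity turns ⟪π(h) e₀, e_x⟫ into λ(h⁻¹, x) ⟪e₀, e_{h⁻¹·x}⟫ = λ(h⁻¹, x), which
`jacobiKernel_smul_origin` expresses through K. -/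
lemma inner_coherentVec (hπ : IsJacobiRep n π e₀) (x y : JacobiDomain) :
    ⟪coherentVec n π e₀ y.1, coherentVec n π e₀ x.1⟫_ℂ = jacobiKernel n x y := by
  obtain ⟨h, rfl⟩ := exists_smul_origin y
  have h0 : conj (jacobiMultiplier n h JacobiDomain.origin) ≠ 0 :=
    (map_ne_zero _).2 (jacobiMultiplier_ne_zero n h JacobiDomain.origin)
  have h1 : ⟪π h e₀, coherentVec n π e₀ x.1⟫_ℂ = jacobiMultiplier n h⁻¹ x := by
    rw [rep_inner_left, hπ.rep_coherentVec, inner_smul_right, hπ.inner_coherentVec_left, mul_one]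
  rw [hπ.rep_apply_eq, inner_smul_left, ← jacobiKernel_smul_origin, mul_comm] at h1
  exact mul_right_cancel₀ h0 h1

end IsJacobiRep

end CoherentVector

/-! ### The coherent state vectors as exponential series -/

section CoherentSeries

variable {H : Type*} [NormedAddCommGroup H] [InnerProductSpace ℂ H]

lemma heisenbergFlow_add (y : ℂ) (s t : ℝ) :
    heisenbergFlow y (s + t) = heisenbergFlow y s * heisenbergFlow y t := by
  have h : ((s : ℂ) * y * (t * conj y)).im = 0 := by
    rw [mul_mul_mul_comm, Complex.mul_conj, ← Complex.ofReal_mul, ← Complex.ofReal_mul,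
      Complex.ofReal_im]
  refine JacobiGroup.ext ?_ ?_ ?_
  · simp [JacobiGroup.mul_def, heisenbergFlow]
  · simp [JacobiGroup.mul_def, heisenbergFlow, SU11.rot_one, add_mul]
  · simp only [JacobiGroup.mul_def, heisenbergFlow, inv_one, SU11.rot_one, map_mul,
      Complex.conj_ofReal, h, add_zero]

lemma boostFlow_add (y : ℂ) (hy : ‖y‖ = 1) (s t : ℝ) :
    boostFlow y hy (s + t) = boostFlow y hy s * boostFlow y hy t := by
  have h2 : y * conj y = 1 := by
    rw [Complex.mul_conj, Complex.normSq_eq_norm_sq, hy]; simp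
  refine JacobiGroup.ext (SU11.ext' ?_ ?_) ?_ ?_
  · rw [JacobiGroup.mul_def, SU11.a_mul]
    simp only [boostFlow, SU11.a_mk, SU11.b_mk, map_mul, Complex.conj_ofReal, Real.cosh_add]
    push_cast
    linear_combination -(Complex.sinh s * Complex.sinh t) * h2
  · rw [JacobiGroup.mul_def, SU11.b_mul]
    simp only [boostFlow, SU11.a_mk, SU11.b_mk, Complex.conj_ofReal, Real.sinh_add]
    push_cast
    ring
  · simp [JacobiGroup.mul_def, boostFlow, SU11.rot_zero]
  · simp [JacobiGroup.mul_def, boostFlow, SU11.rot_zero]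

/-- The generator of a one-parameter group commutes with integrals of continuous functions. -/
lemma hasDerivAt_rep_intervalIntegral [CompleteSpace H] {π : JacobiGroup →* (H ≃ₗᵢ[ℂ] H)}
    {γ : ℝ → JacobiGroup} (hγ : ∀ s t, γ (s + t) = γ s * γ t) {f A : ℝ → H} (hf : Continuous f)
    (hA : Continuous A) (hder : ∀ θ, HasDerivAt (fun s => π (γ s) (f θ)) (A θ) 0) (a b : ℝ) :
    HasDerivAt (fun s => π (γ s) (∫ θ in a..b, f θ)) (∫ θ in a..b, A θ) 0 := by
  have hder' : ∀ θ s, HasDerivAt (fun s => π (γ s) (f θ)) (π (γ s) (A θ)) s := by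
    intro θ s
    have h1 : (fun t => π (γ t) (f θ)) = fun t => π (γ s) (π (γ (t - s)) (f θ)) := by
      ext t
      rw [← rep_mul_apply, ← hγ, add_sub_cancel]
    have h2 := hder θ
    rw [← sub_self s] at h2
    rw [h1]
    exact ((π (γ s)).toContinuousLinearEquiv : H →L[ℂ] H).restrictScalars ℝ
      |>.hasFDerivAt.comp_hasDerivAt s (HasDerivAt.comp_sub_const s s h2)
  have hγ0 : γ 0 = 1 := by
    have := hγ 0 0
    rw [add_zero] at this
    exact left_eq_mul.1 this
  have hcont : ∀ s (g : ℝ → H), Continuous g → Continuous fun θ => π (γ s) (g θ) := fun s g hg =>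
    (π (γ s)).continuous.comp hg
  -- Because each π(γ s) is an isometry, ‖A θ‖ dominates the derivative for all s at once.
  have h3 := (intervalIntegral.hasDerivAt_integral_of_dominated_loc_of_deriv_le
    (μ := volume) (F := fun s θ => π (γ s) (f θ)) (F' := fun s θ => π (γ s) (A θ)) (x₀ := (0 : ℝ))
    (a := a) (b := b) (s := Set.univ) (bound := fun θ => ‖A θ‖) Filter.univ_mem
    (Filter.Eventually.of_forall fun s => (hcont s f hf).aestronglyMeasurable)
    ((hcont 0 f hf).intervalIntegrable a b) (hcont 0 A hA).aestronglyMeasurable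
    (Filter.Eventually.of_forall fun θ _ s _ => ((π (γ s)).norm_map _).le)
    (hA.norm.intervalIntegrable a b)
    (Filter.Eventually.of_forall fun θ _ s _ => hder' θ s)).2
  have h4 : ∀ s, ∫ θ in a..b, π (γ s) (f θ) = π (γ s) (∫ θ in a..b, f θ) := fun s =>
    ((π (γ s)).toContinuousLinearEquiv : H →L[ℂ] H).intervalIntegral_comp_comm
      (hf.intervalIntegrable a b)
  simp_rw [h4, hγ0, rep_one_apply] at h3
  exact h3

namespace IsJacobiRep

variable {n : ℕ} {π : JacobiGroup →* (H ≃ₗᵢ[ℂ] H)} {e₀ : H}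

/-- Read as y a⁺ - conj y a, this says that on e_x the operator a⁺ is ∂/∂z and a is z + w ∂/∂z. -/
lemma hasDerivAt_heisenbergFlow_coherentVec (hπ : IsJacobiRep n π e₀) (y : ℂ) (x : JacobiDomain) :
    HasDerivAt (fun s : ℝ => π (heisenbergFlow y s) (coherentVec n π e₀ x.1))
      (-(conj y * x.z) • coherentVec n π e₀ x.1 +
        fderiv ℂ (coherentVec n π e₀) x.1 (y - conj y * x.w, 0)) 0 := by
  have h1 : ∀ s : ℝ, π (heisenbergFlow y s) (coherentVec n π e₀ x.1) =
      Complex.exp (-(conj y * x.z) * s + (x.w * conj y ^ 2 / 2 - y * conj y / 2) * (s : ℂ) ^ 2) •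
        coherentVec n π e₀ (x.1 + s • ((y - conj y * x.w, 0) : ℂ × ℂ)) := by
    intro s
    have hx : (heisenbergFlow y s • x).1 = x.1 + s • ((y - conj y * x.w, 0) : ℂ × ℂ) := by
      refine Prod.ext ?_ ?_
      · change (heisenbergFlow y s • x).z = x.z + s • (y - conj y * x.w)
        simp [JacobiDomain.smul_z, heisenbergFlow]
        ring
      · change (heisenbergFlow y s • x).w = x.w + s • (0 : ℂ)
        simp [JacobiDomain.smul_w, heisenbergFlow]
    rw [hπ.rep_coherentVec, hx, jacobiMultiplier_eq]
    congr 1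
    simp only [jacobiExponent, SU11.den, heisenbergFlow, SU11.a_one, SU11.b_one, map_zero, map_one,
      map_mul, Complex.conj_ofReal]
    simp only [zero_mul, zero_add, one_pow, inv_one, one_mul, zero_div, Complex.ofReal_zero,
      mul_zero, neg_zero, add_zero, zero_sub]
    congr 1
    ring
  simp_rw [h1]
  have hs : HasDerivAt (fun s : ℝ => (s : ℂ)) 1 0 := Complex.ofRealCLM.hasDerivAt
  have h2 : HasDerivAt (fun s : ℝ => Complex.exp (-(conj y * x.z) * s +
      (x.w * conj y ^ 2 / 2 - y * conj y / 2) * (s : ℂ) ^ 2)) (-(conj y * x.z)) 0 := by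
    have h3 := ((hs.const_mul (-(conj y * x.z))).add
      ((hs.pow 2).const_mul (x.w * conj y ^ 2 / 2 - y * conj y / 2))).cexp
    convert! h3 using 1
    simp
  have h4 : HasDerivAt (fun s : ℝ => x.1 + s • ((y - conj y * x.w, 0) : ℂ × ℂ))
      (y - conj y * x.w, 0) 0 := by
    simpa using ((hasDerivAt_id (0 : ℝ)).smul_const ((y - conj y * x.w, 0) : ℂ × ℂ)).const_add x.1
  have h5 : HasDerivAt
      (fun s : ℝ => coherentVec n π e₀ (x.1 + s • ((y - conj y * x.w, 0) : ℂ × ℂ)))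
      (fderiv ℂ (coherentVec n π e₀) x.1 (y - conj y * x.w, 0)) 0 := by
    have h6 := (hπ.differentiableAt_coherentVec x).hasFDerivAt.restrictScalars ℝ
    have h7 : x.1 = x.1 + (0 : ℝ) • ((y - conj y * x.w, 0) : ℂ × ℂ) := by
      rw [zero_smul, add_zero]
    rw [h7] at h6
    have h8 := h6.comp_hasDerivAt 0 h4
    rwa [← h7] at h8
  convert! h2.smul h5 using 1
  simp [add_comm]

/-- Read as y K₊ - conj y K₋, this says that on e_x the operator K₊ is ∂/∂w and K₋ is nw + z²/2 + wz
∂/∂z + w² ∂/∂w. -/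
lemma hasDerivAt_boostFlow_coherentVec (hπ : IsJacobiRep n π e₀) (y : ℂ) (hy : ‖y‖ = 1)
    (x : JacobiDomain) :
    HasDerivAt (fun s : ℝ => π (boostFlow y hy s) (coherentVec n π e₀ x.1))
      ((-(n * (conj y * x.w)) - conj y * x.z ^ 2 / 2) • coherentVec n π e₀ x.1 +
        fderiv ℂ (coherentVec n π e₀) x.1
          (-(conj y * x.w * x.z), y - conj y * x.w ^ 2)) 0 := by
  set d : ℝ → ℂ := fun s => conj y * (Real.sinh s : ℂ) * x.w + (Real.cosh s : ℂ) with hddef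
  have hden : ∀ s, d s = (boostFlow y hy s).g.den x.w := by
    intro s
    simp only [hddef, SU11.den, boostFlow, SU11.a_mk, SU11.b_mk, map_mul, Complex.conj_ofReal]
  have hd : ∀ s, d s ≠ 0 := fun s => by
    rw [hden]; exact SU11.den_ne _ x
  have h1 : ∀ s : ℝ, π (boostFlow y hy s) (coherentVec n π e₀ x.1) =
      ((d s ^ n)⁻¹ * Complex.exp (-(conj y * (Real.sinh s : ℂ) * x.z ^ 2 * (2 * d s)⁻¹))) •
        coherentVec n π e₀ (x.z * (d s)⁻¹,
          ((Real.cosh s : ℂ) * x.w + y * (Real.sinh s : ℂ)) * (d s)⁻¹) := by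
    intro s
    have hx : (boostFlow y hy s • x).1 = (x.z * (d s)⁻¹,
          ((Real.cosh s : ℂ) * x.w + y * (Real.sinh s : ℂ)) * (d s)⁻¹) := by
      refine Prod.ext ?_ ?_
      · change (boostFlow y hy s • x).z = _
        rw [JacobiDomain.smul_z', ← hden, div_eq_mul_inv]
        simp [jacobiShift, boostFlow]
      · change (boostFlow y hy s • x).w = _
        rw [JacobiDomain.smul_w', ← hden, div_eq_mul_inv]
        rfl
    rw [hπ.rep_coherentVec, hx, jacobiMultiplier_eq, ← hden]
    congr 3
    have hα : (boostFlow y hy s).α = 0 := rfl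
    have ht : (boostFlow y hy s).t = 0 := rfl
    have hb : conj (boostFlow y hy s).g.b = conj y * (Real.sinh s : ℂ) := by
      simp only [boostFlow, SU11.b_mk, map_mul, Complex.conj_ofReal]
    simp only [jacobiExponent, jacobiShift, ← hden, hα, ht, hb]
    simp [div_eq_mul_inv]
  simp_rw [h1]
  have hsinh : HasDerivAt (fun s : ℝ => (Real.sinh s : ℂ)) 1 0 := by
    simpa using (Real.hasDerivAt_sinh 0).ofReal_comp
  have hcosh : HasDerivAt (fun s : ℝ => (Real.cosh s : ℂ)) 0 0 := by
    simpa using (Real.hasDerivAt_cosh 0).ofReal_comp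
  have hd' : HasDerivAt d (conj y * x.w) 0 := by
    have := ((hsinh.const_mul (conj y)).mul_const x.w).add hcosh
    convert! this using 1
    simp
  have hd0 : d 0 = 1 := by simp [hddef]
  have hinv : HasDerivAt (fun s => (d s)⁻¹) (-(conj y * x.w)) 0 := by
    have := hd'.inv (hd 0)
    simpa [hd0] using! this
  have hpow : HasDerivAt (fun s => (d s ^ n)⁻¹) (-(n * (conj y * x.w))) 0 := by
    have := (hd'.pow n).inv (pow_ne_zero n (hd 0))
    simpa [hd0] using! this
  have hexp : HasDerivAt
      (fun s => Complex.exp (-(conj y * (Real.sinh s : ℂ) * x.z ^ 2 * (2 * d s)⁻¹)))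
      (-(conj y * x.z ^ 2 / 2)) 0 := by
    have := ((((hsinh.const_mul (conj y)).mul_const (x.z ^ 2)).mul
      ((hd'.const_mul 2).inv (mul_ne_zero two_ne_zero (hd 0)))).neg).cexp
    convert! this using 1
    simp [hd0]
    ring
  have h4 : HasDerivAt (fun s : ℝ => (x.z * (d s)⁻¹,
      ((Real.cosh s : ℂ) * x.w + y * (Real.sinh s : ℂ)) * (d s)⁻¹))
      (-(conj y * x.w * x.z), y - conj y * x.w ^ 2) 0 := by
    refine HasDerivAt.prodMk ?_ ?_
    · convert! hinv.const_mul x.z using 1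
      ring
    · convert! ((hcosh.mul_const x.w).add (hsinh.const_mul y)).mul hinv using 1
      simp [hd0]
      ring
  have h5 : HasDerivAt (fun s : ℝ => coherentVec n π e₀ (x.z * (d s)⁻¹,
      ((Real.cosh s : ℂ) * x.w + y * (Real.sinh s : ℂ)) * (d s)⁻¹))
      (fderiv ℂ (coherentVec n π e₀) x.1 (-(conj y * x.w * x.z), y - conj y * x.w ^ 2)) 0 := by
    have h6 := (hπ.differentiableAt_coherentVec x).hasFDerivAt.restrictScalars ℝ
    have h7 : x.1 = (x.z * (d 0)⁻¹,
        ((Real.cosh 0 : ℂ) * x.w + y * (Real.sinh 0 : ℂ)) * (d 0)⁻¹) := by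
      rw [hd0]
      simp [JacobiDomain.z, JacobiDomain.w]
    rw [h7] at h6
    have h8 := h6.comp_hasDerivAt 0 h4
    rwa [← h7] at h8
  convert! (hpow.mul hexp).smul h5 using 1
  simp [hd0, JacobiDomain.z, JacobiDomain.w]
  rw [add_comm]
  congr 2

/-- Continuity is read off from the real derivative, with which the complex one agrees. -/
lemma continuous_fderiv_coherentVec (hπ : IsJacobiRep n π e₀) (v : ℂ × ℂ) :
    Continuous fun x : JacobiDomain => fderiv ℂ (coherentVec n π e₀) x.1 v := by
  have h1 : ∀ x : JacobiDomain, fderiv ℂ (coherentVec n π e₀) x.1 v =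
      fderiv ℝ (coherentVec n π e₀) x.1 v := by
    intro x
    rw [(hπ.differentiableAt_coherentVec x).fderiv_restrictScalars ℝ]
    rfl
  simp_rw [h1]
  refine continuous_iff_continuousAt.2 fun x => ?_
  have h2 : ContinuousAt (fderiv ℝ (coherentVec n π e₀)) x.1 :=
    ((contDiffAt_coherentVec n hπ.smooth x.2).fderiv_right (m := 0) (by simp)).continuousAt
  exact (h2.clm_apply continuousAt_const).comp
    continuous_subtype_val.continuousAt

lemma continuous_coherentVec (hπ : IsJacobiRep n π e₀) :
    Continuous fun x : JacobiDomain => coherentVec n π e₀ x.1 :=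
  continuous_iff_continuousAt.2 fun x =>
    (hπ.differentiableAt_coherentVec x).continuousAt.comp continuous_subtype_val.continuousAt

variable [CompleteSpace H]

/-- Integrals of coherent vectors are where a⁺ and K₊ can be iterated: the derivative defining
`derivedRep` exists there and passes under the integral. The combination of y = 1 and y = i keeps
only the part complex linear in y, which is ∂/∂z. -/
lemma opCreate_integral (hπ : IsJacobiRep n π e₀) {c : ℝ → ℂ} (hc : Continuous c)
    {P : ℝ → JacobiDomain} (hP : Continuous P) (a b : ℝ) :
    opCreate π (∫ θ in a..b, c θ • coherentVec n π e₀ (P θ).1) =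
      ∫ θ in a..b, c θ • fderiv ℂ (coherentVec n π e₀) (P θ).1 (1, 0) := by
  have hE := hπ.continuous_coherentVec.comp hP
  have hD := (hπ.continuous_fderiv_coherentVec (1, 0)).comp hP
  have hz := JacobiDomain.continuous_z.comp hP
  have hw := JacobiDomain.continuous_w.comp hP
  simp only [Function.comp_def] at hE hD hz hw
  have key : ∀ y : ℂ, derivedRep π (heisenbergFlow y)
      (∫ θ in a..b, c θ • coherentVec n π e₀ (P θ).1) =
      ∫ θ in a..b, c θ • (-(conj y * (P θ).z) • coherentVec n π e₀ (P θ).1 +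
        (y - conj y * (P θ).w) • fderiv ℂ (coherentVec n π e₀) (P θ).1 (1, 0)) := by
    intro y
    refine HasDerivAt.deriv (hasDerivAt_rep_intervalIntegral (heisenbergFlow_add y)
      (by fun_prop) (by fun_prop) (fun θ => ?_) a b)
    simp_rw [map_smul]
    refine HasDerivAt.const_smul (c θ) ?_
    convert! hπ.hasDerivAt_heisenbergFlow_coherentVec y (P θ) using 2
    rw [← map_smul]
    simp
  unfold opCreate
  have hint : ∀ y : ℂ, IntervalIntegrable (fun θ => c θ •
      (-(conj y * (P θ).z) • coherentVec n π e₀ (P θ).1 +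
        (y - conj y * (P θ).w) • fderiv ℂ (coherentVec n π e₀) (P θ).1 (1, 0))) volume a b :=
    fun y => Continuous.intervalIntegrable (by fun_prop) a b
  rw [key, key, ← intervalIntegral.integral_smul]
  refine (congrArg _ (intervalIntegral.integral_sub (hint 1)
    ((hint Complex.I).smul Complex.I)).symm).trans ?_
  rw [← intervalIntegral.integral_smul]
  refine intervalIntegral.integral_congr fun θ _ => ?_
  have hI := Complex.I_mul_I
  simp only [map_one, Complex.conj_I, Pi.smul_apply]
  match_scalars
  · linear_combination (-1 / 2 * c θ * (P θ).z) * hI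
  · linear_combination (-1 / 2 * c θ * (1 + (P θ).w)) * hI

lemma opKPlus_integral (hπ : IsJacobiRep n π e₀) {c : ℝ → ℂ} (hc : Continuous c)
    {P : ℝ → JacobiDomain} (hP : Continuous P) (a b : ℝ) :
    opKPlus π (∫ θ in a..b, c θ • coherentVec n π e₀ (P θ).1) =
      ∫ θ in a..b, c θ • fderiv ℂ (coherentVec n π e₀) (P θ).1 (0, 1) := by
  have hE := hπ.continuous_coherentVec.comp hP
  have hD := (hπ.continuous_fderiv_coherentVec (1, 0)).comp hP
  have hD2 := (hπ.continuous_fderiv_coherentVec (0, 1)).comp hP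
  have hz := JacobiDomain.continuous_z.comp hP
  have hw := JacobiDomain.continuous_w.comp hP
  simp only [Function.comp_def] at hE hD hD2 hz hw
  have key : ∀ (y : ℂ) (hy : ‖y‖ = 1), derivedRep π (boostFlow y hy)
      (∫ θ in a..b, c θ • coherentVec n π e₀ (P θ).1) =
      ∫ θ in a..b, c θ • ((-(n * (conj y * (P θ).w)) - conj y * (P θ).z ^ 2 / 2) •
        coherentVec n π e₀ (P θ).1 +
        (-(conj y * (P θ).w * (P θ).z)) • fderiv ℂ (coherentVec n π e₀) (P θ).1 (1, 0) +
        (y - conj y * (P θ).w ^ 2) • fderiv ℂ (coherentVec n π e₀) (P θ).1 (0, 1)) := by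
    intro y hy
    refine HasDerivAt.deriv (hasDerivAt_rep_intervalIntegral (boostFlow_add y hy)
      (by fun_prop) (by fun_prop) (fun θ => ?_) a b)
    simp_rw [map_smul]
    refine HasDerivAt.const_smul (c θ) ?_
    convert! hπ.hasDerivAt_boostFlow_coherentVec y hy (P θ) using 1
    rw [add_assoc, ← map_smul, ← map_smul, ← map_add]
    simp
  unfold opKPlus
  have hint : ∀ y : ℂ, IntervalIntegrable (fun θ => c θ •
      ((-(n * (conj y * (P θ).w)) - conj y * (P θ).z ^ 2 / 2) •
        coherentVec n π e₀ (P θ).1 +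
        (-(conj y * (P θ).w * (P θ).z)) • fderiv ℂ (coherentVec n π e₀) (P θ).1 (1, 0) +
        (y - conj y * (P θ).w ^ 2) • fderiv ℂ (coherentVec n π e₀) (P θ).1 (0, 1)))
        volume a b :=
    fun y => Continuous.intervalIntegrable (by fun_prop) a b
  rw [key, key, ← intervalIntegral.integral_smul]
  refine (congrArg _ (intervalIntegral.integral_sub (hint 1)
    ((hint Complex.I).smul Complex.I)).symm).trans ?_
  rw [← intervalIntegral.integral_smul]
  refine intervalIntegral.integral_congr fun θ _ => ?_
  have hI := Complex.I_mul_I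
  simp only [map_one, Complex.conj_I, Pi.smul_apply]
  match_scalars
  · linear_combination (1 / 2 * c θ * (-(n * (P θ).w) - (P θ).z ^ 2 / 2)) * hI
  · linear_combination (-1 / 2 * c θ * ((P θ).w * (P θ).z)) * hI
  · linear_combination (-1 / 2 * c θ * (1 + (P θ).w ^ 2)) * hI

end IsJacobiRep

/-- The kernel of Cauchy's formula on the unit circle for the `m`-th derivative at the centre. -/
def cauchyCoeff (m : ℕ) (θ : ℝ) : ℂ :=
  (2 * Real.pi * Complex.I / (m.factorial : ℂ))⁻¹ *
    (deriv (circleMap 0 1) θ * (1 / circleMap 0 1 θ ^ (m + 1)))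

lemma continuous_cauchyCoeff (m : ℕ) : Continuous (cauchyCoeff m) := by
  have h : ∀ θ, circleMap 0 1 θ ^ (m + 1) ≠ 0 := fun θ =>
    pow_ne_zero _ (circleMap_ne_center one_ne_zero)
  have hc := continuous_circleMap 0 1
  unfold cauchyCoeff
  simp only [deriv_circleMap, one_div]
  fun_prop (disch := exact h _)

lemma iteratedDeriv_eq_integral_cauchyCoeff [CompleteSpace H] {f : ℂ → H}
    (hf : DiffContOnCl ℂ f (Metric.ball 0 1)) (m : ℕ) :
    iteratedDeriv m f 0 =
      ∫ θ in (0 : ℝ)..2 * Real.pi, cauchyCoeff m θ • f (circleMap 0 1 θ) := by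
  have h := hf.circleIntegral_one_div_sub_center_pow_smul one_pos m
  have hne : 2 * Real.pi * Complex.I / (m.factorial : ℂ) ≠ 0 :=
    div_ne_zero Complex.two_pi_I_ne_zero (Nat.cast_ne_zero.2 m.factorial_ne_zero)
  rw [← inv_smul_eq_iff₀ hne, circleIntegral, ← intervalIntegral.integral_smul] at h
  rw [← h]
  simp only [cauchyCoeff, mul_smul, sub_zero]

namespace IsJacobiRep

variable {n : ℕ} {π : JacobiGroup →* (H ≃ₗᵢ[ℂ] H)} {e₀ : H}

lemma hasDerivAt_coherentVec_ray (hπ : IsJacobiRep n π e₀) (x : JacobiDomain) {t : ℂ}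
    (ht : ‖t • x.1.2‖ < 1) :
    HasDerivAt (fun t : ℂ => coherentVec n π e₀ (t • x.1))
      (x.z • fderiv ℂ (coherentVec n π e₀) (t • x.1) (1, 0) +
        x.w • fderiv ℂ (coherentVec n π e₀) (t • x.1) (0, 1)) t := by
  have h1 := (hπ.differentiableAt_coherentVec ⟨t • x.1, ht⟩).hasFDerivAt
  have h2 : HasDerivAt (fun t : ℂ => t • x.1) x.1 t := by
    simpa using (hasDerivAt_id t).smul_const x.1
  convert! h1.comp_hasDerivAt t h2 using 1
  rw [← map_smul, ← map_smul, ← map_add]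
  simp [JacobiDomain.z, JacobiDomain.w]

variable [CompleteSpace H]

/-- The m-th derivative is a Cauchy integral of the vectors e_{ζx} over |ζ| = 1. Under the integral
the operator acts as z ∂/∂z + w ∂/∂w, that is, as d/dζ along the ray, so the result is the m-th
derivative of the derivative. -/
lemma coherentOp_iteratedDeriv (hπ : IsJacobiRep n π e₀) (x : JacobiDomain) (m : ℕ) :
    x.z • opCreate π (iteratedDeriv m (fun t : ℂ => coherentVec n π e₀ (t • x.1)) 0) +
      x.w • opKPlus π (iteratedDeriv m (fun t : ℂ => coherentVec n π e₀ (t • x.1)) 0) =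
    iteratedDeriv (m + 1) (fun t : ℂ => coherentVec n π e₀ (t • x.1)) 0 := by
  set U : Set ℂ := {t | ‖t • x.1.2‖ < 1} with hU
  have hUo : IsOpen U := isOpen_lt (by fun_prop) continuous_const
  have hball : Metric.closedBall (0 : ℂ) 1 ⊆ U := by
    intro t ht
    have h1 : ‖t‖ ≤ 1 := by simpa using ht
    have h2 : ‖x.1.2‖ < 1 := x.2
    rw [hU, Set.mem_ofPred_eq, norm_smul]
    nlinarith [norm_nonneg x.1.2]
  have hd : DifferentiableOn ℂ (fun t : ℂ => coherentVec n π e₀ (t • x.1)) U := fun t ht =>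
    (hπ.hasDerivAt_coherentVec_ray x ht).differentiableAt.differentiableWithinAt
  have hmem : ∀ θ, circleMap 0 1 θ ∈ U := fun θ =>
    hball (circleMap_mem_closedBall 0 zero_le_one θ)
  have hP : Continuous fun θ => (⟨circleMap 0 1 θ • x.1, hmem θ⟩ : JacobiDomain) :=
    ((continuous_circleMap 0 1).smul continuous_const).subtype_mk _
  have hκ := continuous_cauchyCoeff m
  have hA := hπ.opCreate_integral hκ hP 0 (2 * Real.pi)
  have hB := hπ.opKPlus_integral hκ hP 0 (2 * Real.pi)
  have hint : ∀ v : ℂ × ℂ, IntervalIntegrable (fun θ => cauchyCoeff m θ •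
      fderiv ℂ (coherentVec n π e₀) (circleMap 0 1 θ • x.1) v) volume 0 (2 * Real.pi) :=
    fun v => (hκ.smul ((hπ.continuous_fderiv_coherentVec v).comp hP)).intervalIntegrable _ _
  rw [iteratedDeriv_succ', iteratedDeriv_eq_integral_cauchyCoeff (hd.diffContOnCl_ball hball),
    iteratedDeriv_eq_integral_cauchyCoeff ((hd.deriv hUo).diffContOnCl_ball hball), hA, hB,
    ← intervalIntegral.integral_smul, ← intervalIntegral.integral_smul]
  refine (intervalIntegral.integral_add ((hint _).smul x.z) ((hint _).smul x.w)).symm.trans ?_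
  refine intervalIntegral.integral_congr fun θ _ => ?_
  simp only [(hπ.hasDerivAt_coherentVec_ray x (hmem θ)).deriv, Pi.smul_apply, smul_add]
  rw [smul_comm x.z, smul_comm x.w]

/-- The exponential series of `z a⁺ + w K₊` at `e₀` converges to the coherent state vector. -/
lemma hasSum_coherentTerm (hπ : IsJacobiRep n π e₀) (x : JacobiDomain) :
    HasSum (coherentTerm π e₀ x) (coherentVec n π e₀ x.1) := by
  have hw : ‖x.1.2‖ < 1 := x.2
  have hw0 := norm_nonneg x.1.2
  -- This radius satisfies R > 1 and R|w| < 1, so t ↦ e_{tx} is holomorphic on a disc about 0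
  -- containing t = 1, where its Taylor series is evaluated.
  set R : ℝ := 2 / (1 + ‖x.1.2‖) with hR
  have hR1 : 1 < R := by
    rw [hR, lt_div_iff₀ (by positivity)]
    linarith
  have hRw : R * ‖x.1.2‖ < 1 := by
    rw [hR, div_mul_eq_mul_div, div_lt_one (by positivity)]
    linarith
  have hd : DifferentiableOn ℂ (fun t : ℂ => coherentVec n π e₀ (t • x.1))
      (Metric.ball 0 R) := by
    intro t ht
    refine (hπ.hasDerivAt_coherentVec_ray x ?_).differentiableAt.differentiableWithinAt
    have h1 : ‖t‖ < R := by simpa using ht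
    rw [norm_smul]
    nlinarith
  have h1 := Complex.hasSum_taylorSeries_on_ball hd (z := 1) (by simpa using hR1)
  simp only [sub_zero, one_pow, one_smul] at h1
  convert! h1 using 1
  funext m
  unfold coherentTerm
  congr 1
  induction m with
  | zero =>
    rw [Function.iterate_zero_apply, iteratedDeriv_zero, zero_smul]
    exact hπ.coherentVec_origin.symm
  | succ m ih => rw [Function.iterate_succ_apply', ih, hπ.coherentOp_iteratedDeriv]

end IsJacobiRep

end CoherentSeries

/-! ### The dual representation as a representation on the Fock space -/

namespace IsJacobiRep

variable {H : Type*} [NormedAddCommGroup H] [InnerProductSpace ℂ H] [CompleteSpace H]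
  {n : ℕ} {π : JacobiGroup →* (H ≃ₗᵢ[ℂ] H)} {e₀ : H}

variable (n π e₀) in
/-- Linear combinations of the functionals `⟪e_y, ·⟫`. -/
def coherentDual : (JacobiDomain →₀ ℂ) →ₗ[ℂ] (H →L[ℂ] ℂ) :=
  Finsupp.linearCombination ℂ fun y => InnerProductSpace.toDual ℂ H (coherentVec n π e₀ y.1)

/-- Both squared norms are the same quadratic expression in K. The coefficients on H are conjugated
because the Riesz map is antilinear. -/
lemma norm_coherentDual [Fact (2 ≤ n)] (hπ : IsJacobiRep n π e₀) (c : JacobiDomain →₀ ℂ) :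
    ‖Finsupp.linearCombination ℂ (fockKernel n) c‖ = ‖coherentDual n π e₀ c‖ := by
  have h1 : coherentDual n π e₀ c = InnerProductSpace.toDual ℂ H
      (∑ y ∈ c.support, conj (c y) • coherentVec n π e₀ y.1) := by
    rw [coherentDual, Finsupp.linearCombination_apply, Finsupp.sum, map_sum]
    refine Finset.sum_congr rfl fun y _ => ?_
    rw [map_smulₛₗ, Complex.conj_conj]
  rw [h1, LinearIsometryEquiv.norm_map, Finsupp.linearCombination_apply, Finsupp.sum,
    ← sq_eq_sq₀ (norm_nonneg _) (norm_nonneg _)]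
  refine Complex.ofReal_injective ?_
  have h2 := inner_self_eq_norm_sq_to_K (𝕜 := ℂ) (∑ y ∈ c.support, c y • fockKernel n y)
  have h3 := inner_self_eq_norm_sq_to_K (𝕜 := ℂ)
    (∑ y ∈ c.support, conj (c y) • coherentVec n π e₀ y.1)
  push_cast
  refine h2.symm.trans (Eq.trans ?_ h3)
  simp only [sum_inner, inner_sum, inner_smul_left, inner_smul_right, fockKernel_inner,
    fockKernel_apply, hπ.inner_coherentVec, Complex.conj_conj]
  simp_rw [Finset.mul_sum]
  rw [Finset.sum_comm]
  refine Finset.sum_congr rfl fun x _ => Finset.sum_congr rfl fun y _ => ?_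
  ring

/-- By cyclicity: each π(h) e₀ is a multiple of some e_x, so the closure contains the functionals
represented by a dense subspace. -/
lemma denseRange_coherentDual (hπ : IsJacobiRep n π e₀) : DenseRange (coherentDual n π e₀) := by
  set D := InnerProductSpace.toDual ℂ H
  set S : Submodule ℂ H :=
    (LinearMap.range (coherentDual n π e₀)).topologicalClosure.comap D.toLinearEquiv.toLinearMap
  have hS : IsClosed (S : Set H) :=
    (Submodule.isClosed_topologicalClosure _).preimage D.continuous
  have hmem : ∀ x : JacobiDomain, coherentVec n π e₀ x.1 ∈ S := fun x =>
    Submodule.le_topologicalClosure _ ⟨Finsupp.single x 1, by simp [coherentDual, D]⟩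
  have htop : (⊤ : Submodule ℂ H) ≤ S := by
    rw [← hπ.cyclic]
    refine Submodule.topologicalClosure_minimal _ (Submodule.span_le.2 ?_) hS
    rintro _ ⟨h, rfl⟩
    rw [SetLike.mem_coe]
    beta_reduce
    rw [hπ.rep_apply_eq]
    exact S.smul_mem _ (hmem _)
  intro ℓ
  have h := htop (Submodule.mem_top (x := D.symm ℓ))
  have h2 : D (D.symm ℓ) ∈ (LinearMap.range (coherentDual n π e₀)).topologicalClosure := h
  rw [D.apply_symm_apply] at h2
  exact h2

lemma _root_.denseRange_linearCombination_fockKernel (n : ℕ) [Fact (2 ≤ n)] :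
    DenseRange (Finsupp.linearCombination ℂ (fockKernel n)) := by
  intro f
  have h : f ∈ (Submodule.span ℂ (Set.range (fockKernel n))).topologicalClosure := by
    rw [span_fockKernel_dense]
    trivial
  rwa [← Finsupp.range_linearCombination] at h

/-- The isometry from the dual of the representation space onto the Fock space. -/
def dualIsometry [Fact (2 ≤ n)] (hπ : IsJacobiRep n π e₀) : (H →L[ℂ] ℂ) ≃ₗᵢ[ℂ] FockSpace n :=
  (LinearEquiv.refl ℂ (JacobiDomain →₀ ℂ)).extendOfIsometry (coherentDual n π e₀)
    (Finsupp.linearCombination ℂ (fockKernel n)) hπ.denseRange_coherentDual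
    (denseRange_linearCombination_fockKernel n) hπ.norm_coherentDual

/-- Both sides are continuous in ℓ, and on the functionals ⟪e_y, ·⟫, whose span is dense, both equal
K(x, y). -/
lemma dualIsometry_apply [Fact (2 ≤ n)] (hπ : IsJacobiRep n π e₀) (ℓ : H →L[ℂ] ℂ)
    (x : JacobiDomain) : hπ.dualIsometry ℓ x = ℓ (coherentVec n π e₀ x.1) := by
  rw [← fockKernel_inner]
  refine congrFun (hπ.denseRange_coherentDual.equalizer
    (g := fun ℓ : H →L[ℂ] ℂ => ⟪fockKernel n x, hπ.dualIsometry ℓ⟫_ℂ)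
    (h := fun ℓ => ℓ (coherentVec n π e₀ x.1))
    (continuous_const.inner hπ.dualIsometry.continuous) (by fun_prop) (funext fun c => ?_)) ℓ
  have h : hπ.dualIsometry (coherentDual n π e₀ c) =
      Finsupp.linearCombination ℂ (fockKernel n) c :=
    LinearEquiv.extendOfIsometry_eq _ _ _ _ _ _ c
  simp only [Function.comp_apply, h]
  clear h
  induction c using Finsupp.induction_linear with
  | zero => simp
  | add c d hc hd => rw [map_add, map_add, inner_add_right, add_apply, hc, hd]
  | single y a =>
    simp [coherentDual, fockKernel_inner, fockKernel_apply,
      hπ.inner_coherentVec]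

lemma dualIsometry_comp [Fact (2 ≤ n)] (hπ : IsJacobiRep n π e₀) (h : JacobiGroup)
    (ℓ : H →L[ℂ] ℂ) :
    hπ.dualIsometry (ℓ ∘L ((π h⁻¹).toContinuousLinearEquiv : H →L[ℂ] H)) =
      fockRep n h (hπ.dualIsometry ℓ) := by
  refine DFunLike.ext _ _ fun x => ?_
  rw [fockRep_apply, hπ.dualIsometry_apply, hπ.dualIsometry_apply]
  change ℓ (π h⁻¹ (coherentVec n π e₀ x.1)) = _
  rw [hπ.rep_coherentVec, map_smul, smul_eq_mul]

end IsJacobiRep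

lemma jacobiHolomorphic_kernel (n : ℕ) [Fact (2 ≤ n)] (y : JacobiDomain) :
    JacobiHolomorphic fun x => jacobiKernel n x y := by
  obtain ⟨F, hF, h⟩ := (fockKernel n y).mem.1
  exact ⟨F, hF, fun x => (h x).trans (fockKernel_apply n x y)⟩

end

theorem mainTheorem7 (n : ℕ) [Fact (2 ≤ n)] :
    -- `K` is a positive definite kernel, holomorphic in the first variable and antiholomorphic
    -- in the second one
    (∀ (m : ℕ) (x : Fin m → JacobiDomain),
      (Matrix.of fun i j => jacobiKernel n (x i) (x j)).PosSemidef) ∧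
    (∀ y, JacobiHolomorphic fun x => jacobiKernel n x y) ∧
    (∀ x, JacobiHolomorphic fun y => conj (jacobiKernel n x y)) ∧
    -- the Fock space is a Hilbert space with reproducing kernel `K`
    CompleteSpace (FockSpace n) ∧
    (∀ y, ∃ k : FockSpace n, (∀ x, k x = jacobiKernel n x y) ∧
      ∀ f : FockSpace n, ⟪k, f⟫_ℂ = f y) ∧
    -- `J` is a cocycle, and `K` is invariant
    (∀ (h₁ h₂ : JacobiGroup) (x : JacobiDomain),
      jacobiCocycle n (h₁ * h₂) x = jacobiCocycle n h₁ (h₂ • x) * jacobiCocycle n h₂ x) ∧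
    (∀ (h : JacobiGroup) (x y : JacobiDomain),
      jacobiKernel n (h • x) (h • y) =
        jacobiCocycle n h x * jacobiKernel n x y * conj (jacobiCocycle n h y)) ∧
    -- the continuous unitary representation attached to `K`
    ∃ πK : JacobiGroup →* (FockSpace n ≃ₗᵢ[ℂ] FockSpace n),
      (∀ f : FockSpace n, Continuous fun h => πK h f) ∧
      (∀ (h : JacobiGroup) (f : FockSpace n) (x : JacobiDomain),
        πK h f x = (jacobiCocycle n h⁻¹ x)⁻¹ * f (h⁻¹ • x)) ∧
      -- it is the realization on holomorphic functions of the dual of `π(g, α) = S(g) D(α)`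
      ∀ (H : Type*) [NormedAddCommGroup H] [InnerProductSpace ℂ H] [CompleteSpace H]
        (π : JacobiGroup →* (H ≃ₗᵢ[ℂ] H)) (e₀ : H), IsJacobiRep n π e₀ →
        ∃ e : JacobiDomain → H,
          (∀ x, HasSum (coherentTerm π e₀ x) (e x)) ∧
          (∀ (h : JacobiGroup) (x : JacobiDomain),
            π h (e x) = jacobiMultiplier n h x • e (h • x)) ∧
          (∀ x y, ⟪e y, e x⟫_ℂ = jacobiKernel n x y) ∧
          ∃ Φ : (H →L[ℂ] ℂ) ≃ₗᵢ[ℂ] FockSpace n,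
            (∀ (ℓ : H →L[ℂ] ℂ) (x : JacobiDomain), Φ ℓ x = ℓ (e x)) ∧
            ∀ (h : JacobiGroup) (ℓ : H →L[ℂ] ℂ),
              Φ (ℓ ∘L ((π h⁻¹).toContinuousLinearEquiv : H →L[ℂ] H)) = πK h (Φ ℓ) := by
  refine ⟨posSemidef_jacobiKernel n, fun y => ?_, fun x => ?_, inferInstance,
    exists_fockKernel n, jacobiCocycle_mul n, jacobiKernel_smul n, fockRep n,
    continuous_fockRep n, fun h f x => ?_, fun H _ _ _ π e₀ hπ =>
      ⟨fun x => coherentVec n π e₀ x.1, hπ.hasSum_coherentTerm, hπ.rep_coherentVec,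
        hπ.inner_coherentVec, hπ.dualIsometry, hπ.dualIsometry_apply, hπ.dualIsometry_comp⟩⟩
  · exact jacobiHolomorphic_kernel n y
  -- Hermitian symmetry reduces antiholomorphy in the second variable to holomorphy in the first.
  · simpa only [conj_jacobiKernel] using jacobiHolomorphic_kernel n x
  · rw [fockRep_apply, jacobiCocycle, inv_inv]
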